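/- **Model.** Let $\mathcal G=(\mathcal V,\mathcal E)$ be a finite directed graph with destination $d$, maximal lifetime $L\ge 1$, link capacities $C_{ij}\ge 0$ and link costs $e_{ij}\in\mathbb R$; let $\gamma\in\mathbb R$ be the reliability level. In slot $t=0,1,2,\dots$, $a_i^{(l)}(t)\in\{0,1,2,\dots\}$ packets of lifetime $l\in\{1,\dots,L\}$ arrive at node $i\neq d$. The arrival vectors are i.i.d. over $t$, bounded by $A_{\max}$, with means $\lambda_i^{(l)}$ (no arrivals at $d$). For a flow vector $x=\{x_{ij}^{(l)}\ge0\}$ write $x_{i\to}^{(l)}=\sum_j x_{ij}^{(l)}$, $x_{\to i}^{(l)}=\sum_j x_{ji}^{(l)}$, $x_{ij}=\sum_l x_{ij}^{(l)}$, $x_{\to d}=\sum_l x_{\to d}^{(l)}$, $h(x)=\sum_{(i,j)\in\mathcal E}e_{ij}x_{ij}$, and let $^{(\ge l)}$, $^{(\le l)}$ denote the sums over lifetimes $\ell\in\{l,\dots,L\}$ and $\ell\in\{1,\dots,l\}$. The queues of the actual network evolve by $Q(0)=0$ and $Q_i^{(l)}(t+1)=Q_i^{(l+1)}(t)-x_{i\to}^{(l+1)}(t)+x_{\to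 i}^{(l+1)}(t)+a_i^{(l)}(t)$ for $i\ne d$, $l\ge1$, with $Q_i^{(0)}=0$ and $Q_d^{(l)}=0$. A random flow process $x(t)\ge0$ is *admissible for $\mathscr P_1$* if $x_{i\to}^{(l)}(t)\le Q_i^{(l)}(t)$ for all $i,l,t$ almost surely, $\limsup_{T}\frac1T\sum_{t<T}\mathbb E\,x_{ij}(t)\le C_{ij}$ for all $(i,j)\in\mathcal E$, and $\liminf_{T}\frac1T\sum_{t<T}\mathbb E\,x_{\to d}(t)\ge\gamma\|\lambda\|_1$. The capacity region is the set of pairs $(\lambda,\gamma)$ for which an admissible process exists, and $h^\star(\lambda,\gamma)$ is the infimum over admissible processes of $\limsup_T\frac1T\sum_{t<T}\mathbb E\,h(x(t))$. **Virtual flow.** Fix $V\ge0$. Starting from $U_d(0)=0$, $U_i^{(l)}(0)=0$, let, for $i\ne d$, $$w_{ij}^{(l)}(t)=-Ve_{ij}-U_i^{(\le l)}(t)+\begin{cases}U_d(t)&j=d\\U_j^{(\le l-1)}(t)&j\neq d\end{cases},\qquad \nu_{ij}^{(l)}(t)=C_{ij}\,\mathbb I\{l=l^\star,\ w_{ij}^{(l^\star)}(t)>0\},$$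 where $l^\star\in\arg\max_{1\le l\le L}w_{ij}^{(l)}(t)$ (ties broken by any fixed measurable rule, which may depend on the link and the slot) and $\nu_{dj}^{(l)}(t)=0$, and let $U_d(t+1)=\max\{0,U_d(t)+\gamma\sum_{i,l}a_i^{(l)}(t)-\nu_{\to d}(t)\}$ and $U_i^{(l)}(t+1)=\max\{0,U_i^{(l)}(t)+\nu_{i\to}^{(\ge l)}(t)-\nu_{\to i}^{(\ge l+1)}(t)-a_i^{(\ge l)}(t)\}$ for $i\neq d$, $1\le l\le L$. **Flow-matching policy.** Let $\bar\nu(t)=\frac1t\sum_{\tau<t}\nu(\tau)$ and $\hat\lambda(t)=\frac1t\sum_{\tau<t}a(\tau)$ (both $0$ for $t=0$). In slot $t$, every packet of lifetime $l$ at node $i$ is, independently, sent to $j$ with probability $$\alpha_i^{(l)}(j)=\frac{\bar\nu_{ij}^{(l)}}{\max\big\{\bar\nu_{\to i}^{(\ge l+1)}+\hat\lambda_i^{(\ge l)}-\bar\nu_{i\to}^{(\ge l+1)},\ \bar\nu_{i\to}^{(l)}\big\}}\qquad(\text{with }0/0=0),$$ and stays at $i$ otherwise (the second entry of the maximum only normalizes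 the probabilities in slots in which their sum over $j$ would exceed $1$). Let $\mu(t)$ be the resulting flow in the actual network. **Proposition.** Let $(\lambda,\gamma)$ be a point of the capacity region (in particular, any interior point). Then $\mu(t)$ is admissible for $\mathscr P_1$. For $V>0$ its cost is near-optimal: $\limsup_T\frac1T\sum_{t<T}\mathbb E\,h(\mu(t))\le h^\star(\lambda,\gamma)+B/V$, with a constant $B$ depending only on the network, $A_{\max}$ and $\gamma$. Moreover, if the long-term average $x=\lim_T\frac1T\sum_{t<T}\mathbb E\,\nu(t)$ of the virtual flow exists, then $\lim_T\frac1T\sum_{t<T}\mathbb E\,\mu(t)=x$, $x_{ij}\le C_{ij}$ for all $(i,j)\in\mathcal E$, $x_{\to d}\ge\gamma\|\lambda\|_1$, and $\lim_T\frac1T\sum_{t<T}\mathbb E\,h(\mu(t))=h(x)$. -/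

import Mathlib

open MeasureTheory ProbabilityTheory Filter Topology

noncomputable section

namespace CloudNet

/-- A packet routing network on a finite node set `ι`, with directed links `E`, destination `d`,
maximal lifetime `L`, average link capacities `C` and unit transmission costs `e`. -/
structure Network (ι : Type*) where
  E : Finset (ι × ι)
  d : ι
  L : ℕ
  L_pos : 1 ≤ L
  C : ι → ι → ℝ
  C_nonneg : ∀ i j, 0 ≤ C i j
  e : ι → ι → ℝ

/-- A flow vector: `x i j l` is the amount of lifetime-`l` packets sent over `(i, j)`. -/
abbrev Flow (ι : Type*) := ι → ι → ℕ → ℝ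

/-- `g^{(≥ l)}`, the sum of `g` over the lifetimes in `{l, …, L}`. -/
def upFrom (L : ℕ) (g : ℕ → ℝ) (l : ℕ) : ℝ := ∑ k ∈ Finset.Icc l L, g k

/-- `g^{(≤ l)}`, the sum of `g` over the lifetimes in `{1, …, l}`. -/
def upTo (g : ℕ → ℝ) (l : ℕ) : ℝ := ∑ k ∈ Finset.Icc 1 l, g k

/-- `(1 / T) ∑_{t < T} z t`. -/
def timeAvg (z : ℕ → ℝ) (T : ℕ) : ℝ := (∑ t ∈ Finset.range T, z t) / T

/-- The long-term average of `z` exists and equals `c`. -/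
def HasAvg (z : ℕ → ℝ) (c : ℝ) : Prop := Tendsto (timeAvg z) atTop (𝓝 c)

/-- The upper long-term average (limit superior) of `z` is at most `c`. -/
def AvgLE (z : ℕ → ℝ) (c : ℝ) : Prop := ∀ ε > 0, ∀ᶠ T in atTop, timeAvg z T ≤ c + ε

/-- The lower long-term average (limit inferior) of `z` is at least `c`. -/
def AvgGE (z : ℕ → ℝ) (c : ℝ) : Prop := ∀ ε > 0, ∀ᶠ T in atTop, c - ε ≤ timeAvg z T

variable {ι : Type*} [Fintype ι] [LinearOrder ι]

/-- Outgoing flow `x_{i→}^{(l)}`. -/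
def outFlow (x : Flow ι) (i : ι) (l : ℕ) : ℝ := ∑ j, x i j l

/-- Incoming flow `x_{→i}^{(l)}`. -/
def inFlow (x : Flow ι) (i : ι) (l : ℕ) : ℝ := ∑ j, x j i l

namespace Network

variable (N : Network ι)

/-- `x` is indexed by the links of the network and the lifetimes `1, …, L` only:
it vanishes at every other index. -/
def IsFlow (x : Flow ι) : Prop := ∀ i j l, ¬ ((i, j) ∈ N.E ∧ 1 ≤ l ∧ l ≤ N.L) → x i j l = 0

/-- Total flow `x_{ij}` on a link. -/
def linkFlow (x : Flow ι) (i j : ι) : ℝ := ∑ l ∈ Finset.Icc 1 N.L, x i j l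

/-- Total flow `x_{→d}` into the destination. -/
def delivered (x : Flow ι) : ℝ := ∑ l ∈ Finset.Icc 1 N.L, inFlow x N.d l

/-- The cost `h(x) = ∑_{(i,j) ∈ E} e_{ij} x_{ij}`. -/
def cost (x : Flow ι) : ℝ := ∑ p ∈ N.E, N.e p.1 p.2 * N.linkFlow x p.1 p.2

/-- `‖λ‖₁` (arrival rates are non-negative). -/
def totalRate (lam : ι → ℕ → ℝ) : ℝ := ∑ i, ∑ l ∈ Finset.Icc 1 N.L, lam i l

/-! ### Arrivals -/

/-- `a t i l ω` is the number of packets of lifetime `l` that arrive at node `i` in slot `t`.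
The arrival vectors are i.i.d. over time (arbitrarily dependent over nodes and lifetimes), bounded
by `Amax`, have mean `lam`, do not occur at the destination and have lifetimes in `{1, …, L}`. -/
structure IsArrival {Ω : Type*} [MeasurableSpace Ω] (P : Measure Ω) (Amax : ℝ)
    (lam : ι → ℕ → ℝ) (a : ℕ → ι → ℕ → Ω → ℕ) : Prop where
  measurable : ∀ t i l, Measurable (a t i l)
  indep : iIndepFun (fun t ω i l => a t i l ω) P
  identDistrib : ∀ t, IdentDistrib (fun ω i l => a t i l ω) (fun ω i l => a 0 i l ω) P P
  bounded : ∀ t i l, ∀ᵐ ω ∂P, (a t i l ω : ℝ) ≤ Amax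
  mean : ∀ t i l, ∫ ω, (a t i l ω : ℝ) ∂P = lam i l
  support : ∀ t i l ω, ¬ (i ≠ N.d ∧ 1 ≤ l ∧ l ≤ N.L) → a t i l ω = 0

/-! ### The actual network: queues, admissible policies, capacity region -/

/-- One step of the queueing dynamics: packets that stay or are received lose one unit of lifetime,
outdated packets are dropped and packets at the destination are consumed. -/
def queueStep (Q : ι → ℕ → ℝ) (x : Flow ι) (a : ι → ℕ → ℕ) : ι → ℕ → ℝ := fun i l =>
  if i = N.d ∨ l = 0 then 0
  else Q i (l + 1) - outFlow x i (l + 1) + inFlow x i (l + 1) + a i l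

/-- The queue backlogs `Q_i^{(l)}(t)` under the flow decisions `x`, for an initially empty
network. -/
def queue (a : ℕ → ι → ℕ → ℕ) (x : ℕ → Flow ι) : ℕ → ι → ℕ → ℝ
  | 0 => fun _ _ => 0
  | t + 1 => N.queueStep (queue a x t) (x t) (a t)

/-- The random decisions `x t ω` (arrivals `a`) are admissible for the actual network at
arrival rates `lam` and reliability level `γ`. -/
structure Admissible {Ω : Type*} [MeasurableSpace Ω] (P : Measure Ω)
    (a : ℕ → ι → ℕ → Ω → ℕ) (lam : ι → ℕ → ℝ) (γ : ℝ) (x : ℕ → Ω → Flow ι) : Prop where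
  integrable : ∀ t i j l, Integrable (fun ω => x t ω i j l) P
  isFlow : ∀ t ω, N.IsFlow (x t ω)
  nonneg : ∀ᵐ ω ∂P, ∀ t i j l, 0 ≤ x t ω i j l
  capacity : ∀ i j, (i, j) ∈ N.E → AvgLE (fun t => ∫ ω, N.linkFlow (x t ω) i j ∂P) (N.C i j)
  availability : ∀ᵐ ω ∂P, ∀ t i l, 1 ≤ l → l ≤ N.L →
    outFlow (x t ω) i l ≤ N.queue (fun s k m => a s k m ω) (fun s => x s ω) t i l
  reliability : AvgGE (fun t => ∫ ω, N.delivered (x t ω) ∂P) (γ * N.totalRate lam)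

/-- The capacity region: the pairs `(λ, γ)` under which some admissible policy exists. -/
def capacityRegion : Set ((ι → ℕ → ℝ) × ℝ) :=
  {p | ∃ (Ω : Type) (_ : MeasurableSpace Ω) (P : Measure Ω) (_ : IsProbabilityMeasure P)
    (Amax : ℝ) (a : ℕ → ι → ℕ → Ω → ℕ) (x : ℕ → Ω → Flow ι),
    N.IsArrival P Amax p.1 a ∧ N.Admissible P a p.1 p.2 x}

/-- The real numbers `c` such that some admissible policy under `(lam, γ)` has long-term average
expected cost at most `c`; the optimal cost is the infimum of this set. -/
def achievableCosts (lam : ι → ℕ → ℝ) (γ : ℝ) : Set ℝ :=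
  {c | ∃ (Ω : Type) (_ : MeasurableSpace Ω) (P : Measure Ω) (_ : IsProbabilityMeasure P)
    (Amax : ℝ) (a : ℕ → ι → ℕ → Ω → ℕ) (x : ℕ → Ω → Flow ι),
    N.IsArrival P Amax lam a ∧ N.Admissible P a lam γ x ∧
    AvgLE (fun t => ∫ ω, N.cost (x t ω) ∂P) c}

/-! ### The virtual network: max-weight algorithm -/

/-- `sel t i j w` is the lifetime chosen for link `(i, j)` in slot `t` at weights `w`; it is a
maximizer of `w` over `{1, …, L}`, with an arbitrary measurable way to break ties. -/
structure IsArgmaxRule (sel : ℕ → ι → ι → (ℕ → ℝ) → ℕ) : Prop where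
  measurable : ∀ t i j, Measurable (sel t i j)
  mem : ∀ t i j (w : ℕ → ℝ), 1 ≤ sel t i j w ∧ sel t i j w ≤ N.L
  le : ∀ t i j (w : ℕ → ℝ) (l : ℕ), 1 ≤ l → l ≤ N.L → w l ≤ w (sel t i j w)

/-- The weights `w_{ij}^{(l)}`. -/
def weight (V : ℝ) (Ud : ℝ) (U : ι → ℕ → ℝ) (i j : ι) (l : ℕ) : ℝ :=
  - V * N.e i j - upTo (U i) l + (if j = N.d then Ud else upTo (U j) (l - 1))

/-- The max-weight flow at virtual queues `(Ud, U)`: each link out of a node other than the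
destination spends its whole capacity on the selected lifetime if its weight is positive
(nothing is ever sent out of the destination). -/
def maxWeightFlow (V : ℝ) (sel : ι → ι → (ℕ → ℝ) → ℕ) (Ud : ℝ) (U : ι → ℕ → ℝ) : Flow ι :=
  fun i j l =>
    if (i, j) ∈ N.E ∧ i ≠ N.d ∧ l = sel i j (N.weight V Ud U i j) ∧ 0 < N.weight V Ud U i j l
    then N.C i j else 0

/-- The virtual queues `(U_d(t), U_i^{(l)}(t))`, initially empty (the values of the second component
at `i = d` or outside the lifetimes `1, …, L` are never used). -/
def virtualQueue (V γ : ℝ) (sel : ℕ → ι → ι → (ℕ → ℝ) → ℕ) (a : ℕ → ι → ℕ → ℕ) :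
    ℕ → ℝ × (ι → ℕ → ℝ)
  | 0 => (0, fun _ _ => 0)
  | t + 1 =>
    let S := virtualQueue V γ sel a t
    let ν := N.maxWeightFlow V (sel t) S.1 S.2
    (max 0 (S.1 + γ * N.totalRate (fun i l => (a t i l : ℝ)) - N.delivered ν),
     fun i l => max 0 (S.2 i l + upFrom N.L (outFlow ν i) l - upFrom N.L (inFlow ν i) (l + 1)
        - upFrom N.L (fun k => (a t i k : ℝ)) l))

/-- The virtual flows `ν(t)`. -/
def virtualFlow (V γ : ℝ) (sel : ℕ → ι → ι → (ℕ → ℝ) → ℕ) (a : ℕ → ι → ℕ → ℕ) (t : ℕ) :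
    Flow ι :=
  N.maxWeightFlow V (sel t) (N.virtualQueue V γ sel a t).1 (N.virtualQueue V γ sel a t).2

/-! ### The flow-matching policy -/

/-- The forwarding probabilities `α_i^{(l)}(j)` obtained from a flow `x` and arrival rates `lam`,
`x_{ij}^{(l)} / (x_{→i}^{(≥ l+1)} + λ_i^{(≥ l)} - x_{i→}^{(≥ l+1)})`.
They sum to at most `1` over `j` exactly if the denominator is at least `x_{i→}^{(l)}`, that is, if
`x_{i→}^{(≥ l)} ≤ x_{→i}^{(≥ l+1)} + λ_i^{(≥ l)}`; otherwise they are normalized to have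
sum `1` by taking `x_{i→}^{(l)}` as denominator. (They are `0` if `x_{i→}^{(l)} = 0`.) -/
def forwardProb (x : Flow ι) (lam : ι → ℕ → ℝ) (i : ι) (l : ℕ) (j : ι) : ℝ :=
  x i j l / max (upFrom N.L (inFlow x i) (l + 1) + upFrom N.L (lam i) l
      - upFrom N.L (outFlow x i) (l + 1)) (outFlow x i l)

/-- The forwarding probabilities `α(t)`: those of the empirical averages over the slots
`0, …, t - 1` of the virtual flows and of the arrivals. -/
def empiricalProb (V γ : ℝ) (sel : ℕ → ι → ι → (ℕ → ℝ) → ℕ) (a : ℕ → ι → ℕ → ℕ) (t : ℕ) :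
    ι → ℕ → ι → ℝ :=
  N.forwardProb (fun i j l => timeAvg (fun τ => N.virtualFlow V γ sel a τ i j l) t)
    (fun i l => timeAvg (fun τ => (a τ i l : ℝ)) t)

end Network

/-- A packet with mark `r` (uniform in `[0, 1]`) is sent to node `j` under the
sub-probability vector `p`: this has probability `p j`; with the remaining probability it stays. -/
def SendsTo (p : ι → ℝ) (r : ℝ) (j : ι) : Prop :=
  ∑ k ∈ Finset.univ.filter (· < j), p k ≤ r ∧ r < ∑ k ∈ Finset.univ.filter (· ≤ j), p k

open Classical in
/-- The numbers of packets sent if there are `Q i l` packets of lifetime `l` at node `i` (a natural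
number), and the `k`-th of them draws its next hop from `p i l` by its mark `r i l k`. -/
def routedFlow (p : ι → ℕ → ι → ℝ) (Q : ι → ℕ → ℝ) (r : ι → ℕ → ℕ → ℝ) : Flow ι :=
  fun i j l => (((Finset.range ⌊Q i l⌋₊).filter (fun k => SendsTo (p i l) (r i l k) j)).card : ℝ)

namespace Network

variable (N : Network ι)

/-- The backlogs of the actual network under the flow-matching policy. -/
def matchingQueue (V γ : ℝ) (sel : ℕ → ι → ι → (ℕ → ℝ) → ℕ) (a : ℕ → ι → ℕ → ℕ)
    (r : ℕ → ι → ℕ → ℕ → ℝ) : ℕ → ι → ℕ → ℝ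
  | 0 => fun _ _ => 0
  | t + 1 =>
    let Q := matchingQueue V γ sel a r t
    N.queueStep Q (routedFlow (N.empiricalProb V γ sel a t) Q (r t)) (a t)

/-- The flows `μ(t)` of the flow-matching policy. -/
def matchingFlow (V γ : ℝ) (sel : ℕ → ι → ι → (ℕ → ℝ) → ℕ) (a : ℕ → ι → ℕ → ℕ)
    (r : ℕ → ι → ℕ → ℕ → ℝ) (t : ℕ) : Flow ι :=
  routedFlow (N.empiricalProb V γ sel a t) (N.matchingQueue V γ sel a r t) (r t)

end Network

/-- Randomization of the routing: independent marks, uniform in `[0, 1]` and independent of the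
arrivals; `r t i l k` belongs to the `k`-th packet of lifetime `l` at node `i` in slot `t`. -/
structure IsMarks {Ω : Type*} [MeasurableSpace Ω] (P : Measure Ω)
    (a : ℕ → ι → ℕ → Ω → ℕ) (r : ℕ → ι → ℕ → ℕ → Ω → ℝ) : Prop where
  measurable : ∀ t i l k, Measurable (r t i l k)
  uniform : ∀ t i l k, P.map (r t i l k) = (volume : Measure ℝ).restrict (Set.Icc 0 1)
  indep : iIndepFun (fun (q : ℕ × ι × ℕ × ℕ) ω => r q.1 q.2.1 q.2.2.1 q.2.2.2 ω) P
  indep_arrivals : IndepFun (fun ω t i l => a t i l ω) (fun ω t i l k => r t i l k ω) P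

/-- The virtual flow process driven by the random arrivals. -/
def virtualProcess {Ω : Type*} (N : Network ι) (V γ : ℝ) (sel : ℕ → ι → ι → (ℕ → ℝ) → ℕ)
    (a : ℕ → ι → ℕ → Ω → ℕ) (t : ℕ) (ω : Ω) : Flow ι :=
  N.virtualFlow V γ sel (fun s i l => a s i l ω) t

/-- The flow process of the flow-matching policy. -/
def matchingProcess {Ω : Type*} (N : Network ι) (V γ : ℝ) (sel : ℕ → ι → ι → (ℕ → ℝ) → ℕ)
    (a : ℕ → ι → ℕ → Ω → ℕ) (r : ℕ → ι → ℕ → ℕ → Ω → ℝ) (t : ℕ) (ω : Ω) : Flow ι :=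
  N.matchingFlow V γ sel (fun s i l => a s i l ω) (fun s i l k => r s i l k ω) t

end CloudNet

end

set_option linter.unusedSectionVars false

/-! The empirical averages of the virtual network describe a fluid, and the actual network follows
this fluid in the mean, slot by slot.

Benchmark: the backlog of the packets with lifetime at least `l` is non-negative, so the mean flows
of an admissible process satisfy a cumulative balance at each node (`Admissible.conservation`).
Their time averages eventually lie in a compact box and accumulate at a flow that is `Feasible`; its
cost is at most any bound on the long-term cost (`Admissible.exists_feasible_cost_le`). Capacity
region and competing policies enter only through such deterministic flows.

Virtual network: by exchanging sums over lifetimes, the linear part of drift-plus-penalty is minus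
the total weight of the flow, up to arrival terms, so the max-weight flow minimizes it. Compared
with a feasible flow, the remaining terms have non-positive mean, because the virtual queues of slot
`t` are non-negative and independent of the arrivals in slot `t`. The summed inequality
`IsArrival.integral_lyapunov_add_le` gives the cost bound with gap `B / V`, and also second moments
of order `T`. Hence the mean virtual queues divided by `T` vanish, and with them the mean violation
of balance and reliability by the empirical averages.

Matching: the target of the backlog at lifetime `l` is `available`, the numerator-to-probability
ratio of the fluid; it obeys the same recursion in `l` as the queues (`available_eq_add`). The
forwarding probabilities depend on the arrivals and are correlated with the backlogs, so comparing
plain expectations does not close an induction. The comparison is therefore made for `E[G Q]` with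
every bounded weight `G` that is a function of the arrivals before a reference slot `t`.
Multiplication by the probabilities of slot `t` yields another such weight
(`IsWeight.mul_empiricalProb`), and later arrivals are independent of it. Lifetimes go down from `L
+ 1`, where everything is zero, so a window of `L` slots after `t` suffices, in which empirical
averages move by `O(1/t)` only. A probability may still change much when its denominator is small,
but then few packets are affected: the bound `probVariation` on the change is itself a weight, and
its product with `available` is small.

The outcome `IsArrival.tendsto_integral_matchingFlow_sub` is that the mean flow of slot `t` minus
the mean of the empirical average of the virtual flows tends to zero. All claims follow by
continuity of linear functionals and Cesàro averaging. -/

namespace CloudNet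

/-! ### Time averages -/

theorem timeAvg_add (y z : ℕ → ℝ) (T : ℕ) :
    timeAvg (fun t => y t + z t) T = timeAvg y T + timeAvg z T := by
  simp only [timeAvg, Finset.sum_add_distrib, add_div]

theorem timeAvg_sub (y z : ℕ → ℝ) (T : ℕ) :
    timeAvg (fun t => y t - z t) T = timeAvg y T - timeAvg z T := by
  simp only [timeAvg, Finset.sum_sub_distrib, sub_div]

theorem timeAvg_const_mul (c : ℝ) (z : ℕ → ℝ) (T : ℕ) :
    timeAvg (fun t => c * z t) T = c * timeAvg z T := by
  simp only [timeAvg, ← Finset.mul_sum, mul_div_assoc]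

theorem timeAvg_sum {κ : Type*} (s : Finset κ) (z : κ → ℕ → ℝ) (T : ℕ) :
    timeAvg (fun t => ∑ k ∈ s, z k t) T = ∑ k ∈ s, timeAvg (z k) T := by
  simp only [timeAvg]
  rw [Finset.sum_comm, Finset.sum_div]

theorem timeAvg_mono {y z : ℕ → ℝ} (h : ∀ t, y t ≤ z t) (T : ℕ) :
    timeAvg y T ≤ timeAvg z T :=
  div_le_div_of_nonneg_right (Finset.sum_le_sum fun t _ => h t) (Nat.cast_nonneg T)

theorem timeAvg_nonneg {z : ℕ → ℝ} (h : ∀ t, 0 ≤ z t) (T : ℕ) : 0 ≤ timeAvg z T :=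
  div_nonneg (Finset.sum_nonneg fun t _ => h t) (Nat.cast_nonneg T)

theorem mul_timeAvg (z : ℕ → ℝ) (T : ℕ) : T * timeAvg z T = ∑ t ∈ Finset.range T, z t := by
  rcases Nat.eq_zero_or_pos T with rfl | h
  · simp
  · rw [timeAvg, mul_div_cancel₀]
    positivity

theorem timeAvg_le_of_le {z : ℕ → ℝ} {K : ℝ} (hK : 0 ≤ K) (h : ∀ t, z t ≤ K) (T : ℕ) :
    timeAvg z T ≤ K := by
  rcases Nat.eq_zero_or_pos T with rfl | hT
  · simpa [timeAvg] using hK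
  · rw [timeAvg, div_le_iff₀ (by positivity)]
    calc ∑ t ∈ Finset.range T, z t ≤ ∑ t ∈ Finset.range T, K := Finset.sum_le_sum fun t _ => h t
      _ = K * T := by simp [mul_comm]

theorem abs_timeAvg_le {z : ℕ → ℝ} {K : ℝ} (h : ∀ t, |z t| ≤ K) (T : ℕ) :
    |timeAvg z T| ≤ K := by
  have hK : 0 ≤ K := (abs_nonneg _).trans (h 0)
  rw [abs_le']
  refine ⟨timeAvg_le_of_le hK (fun t => (le_abs_self _).trans (h t)) T, ?_⟩
  have := timeAvg_le_of_le (z := fun t => (-1) * z t) hK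
    (fun t => by simpa using (neg_le_abs (z t)).trans (h t)) T
  rw [timeAvg_const_mul] at this
  linarith

/-- Writing `m t` for the running mean, `(t + 1) (m (t + 1) - m t) = z t - m t`. This slow variation
is what later freezes the forwarding probabilities over a window of `L` slots. -/
theorem abs_timeAvg_succ_sub_le {z : ℕ → ℝ} {K : ℝ} (h : ∀ t, |z t| ≤ K) (t : ℕ) :
    |timeAvg z (t + 1) - timeAvg z t| ≤ 2 * K / (t + 1) := by
  have h1 := mul_timeAvg z (t + 1)
  rw [Finset.sum_range_succ, ← mul_timeAvg] at h1
  push_cast at h1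
  have hp : (0 : ℝ) < t + 1 := by positivity
  rw [le_div_iff₀ hp, ← abs_of_pos hp, ← abs_mul]
  have : (timeAvg z (t + 1) - timeAvg z t) * (t + 1) = z t - timeAvg z t := by linarith
  rw [this]
  calc |z t - timeAvg z t| ≤ |z t| + |timeAvg z t| := abs_sub _ _
    _ ≤ 2 * K := by linarith [h t, abs_timeAvg_le h t]

theorem abs_timeAvg_add_sub_le {z : ℕ → ℝ} {K : ℝ} (h : ∀ t, |z t| ≤ K) (t k : ℕ) :
    |timeAvg z (t + k) - timeAvg z t| ≤ 2 * K * k / (t + 1) := by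
  have hK : 0 ≤ K := (abs_nonneg _).trans (h 0)
  induction k with
  | zero => simp
  | succ k ih =>
    have h1 := abs_timeAvg_succ_sub_le h (t + k)
    have h2 : 2 * K / (((t + k : ℕ) : ℝ) + 1) ≤ 2 * K / (t + 1) := by
      apply div_le_div_of_nonneg_left <;> first | positivity | (push_cast; linarith [k.cast_nonneg (α := ℝ)])
    have h3 : 2 * K * ((k + 1 : ℕ) : ℝ) / (t + 1) = 2 * K * k / (t + 1) + 2 * K / (t + 1) := by
      push_cast; ring
    rw [h3, ← add_assoc]
    have := abs_sub_le (timeAvg z (t + k + 1)) (timeAvg z (t + k)) (timeAvg z t)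
    linarith

theorem timeAvg_eq_cesaro (z : ℕ → ℝ) :
    timeAvg z = fun n : ℕ => (n : ℝ)⁻¹ * ∑ i ∈ Finset.range n, z i := by
  funext n
  rw [timeAvg, div_eq_inv_mul]

theorem avgLE_of_eventually_le {u : ℕ → ℝ} {c : ℝ} (h : ∀ ε > 0, ∀ᶠ t in atTop, u t ≤ c + ε) :
    AvgLE u c := by
  -- Only upper deviations matter: truncation from below at `c` gives a convergent sequence, to
  -- which Cesàro's theorem applies.
  have h1 : Tendsto (fun t => max (u t) c) atTop (𝓝 c) := by
    rw [Metric.tendsto_atTop']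
    intro ε hε
    obtain ⟨n, hn⟩ := eventually_atTop.1 (h (ε / 2) (by positivity))
    refine ⟨n, fun t ht => ?_⟩
    have := hn t ht.le
    rw [Real.dist_eq, abs_of_nonneg (by linarith [le_max_right (u t) c])]
    have : max (u t) c ≤ c + ε / 2 := max_le this (by linarith)
    linarith
  have h2 := h1.cesaro
  rw [← timeAvg_eq_cesaro] at h2
  intro ε hε
  filter_upwards [h2.eventually (gt_mem_nhds (show c < c + ε by linarith))] with T hT
  exact (timeAvg_mono (fun t => le_max_left _ c) T).trans hT.le

theorem avgGE_of_eventually_ge {u : ℕ → ℝ} {c : ℝ} (h : ∀ ε > 0, ∀ᶠ t in atTop, c - ε ≤ u t) :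
    AvgGE u c := by
  have := avgLE_of_eventually_le (u := fun t => (-1) * u t) (c := -c) (fun ε hε => by
    filter_upwards [h ε hε] with t ht
    linarith)
  intro ε hε
  filter_upwards [this ε hε] with T hT
  rw [timeAvg_const_mul] at hT
  linarith

theorem hasAvg_of_tendsto {u : ℕ → ℝ} {c : ℝ} (h : Tendsto u atTop (𝓝 c)) : HasAvg u c := by
  have := h.cesaro
  rwa [← timeAvg_eq_cesaro] at this

/-! ### Partial sums over lifetimes -/

/-- Exchange of the two sums over `l ≤ k`. It turns virtual queues multiplied by cumulative flows
into the cumulative backlogs of the max-weight rule; the shifted version below accounts for the unit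
of lifetime lost on a link. -/
theorem sum_mul_upFrom (L : ℕ) (u g : ℕ → ℝ) :
    ∑ l ∈ Finset.Icc 1 L, u l * upFrom L g l = ∑ k ∈ Finset.Icc 1 L, g k * upTo u k := by
  simp only [upFrom, upTo, Finset.mul_sum]
  rw [Finset.sum_comm' (t' := Finset.Icc 1 L) (s' := fun k => Finset.Icc 1 k)]
  · simp only [mul_comm]
  · intro x y
    simp only [Finset.mem_Icc]
    omega

theorem sum_mul_upFrom_succ (L : ℕ) (u g : ℕ → ℝ) :
    ∑ l ∈ Finset.Icc 1 L, u l * upFrom L g (l + 1)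
      = ∑ k ∈ Finset.Icc 1 L, g k * upTo u (k - 1) := by
  simp only [upFrom, upTo, Finset.mul_sum]
  rw [Finset.sum_comm' (t' := Finset.Icc 1 L) (s' := fun k => Finset.Icc 1 (k - 1))]
  · simp only [mul_comm]
  · intro x y
    simp only [Finset.mem_Icc]
    omega

theorem upFrom_eq_add {L l : ℕ} (h : l ≤ L) (g : ℕ → ℝ) :
    upFrom L g l = g l + upFrom L g (l + 1) := by
  rw [upFrom, upFrom, ← Finset.add_sum_Ioc_eq_sum_Icc h]
  congr 2
  ext k
  simp only [Finset.mem_Ioc, Finset.mem_Icc]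
  omega

theorem upFrom_of_lt {L l : ℕ} (h : L < l) (g : ℕ → ℝ) : upFrom L g l = 0 := by
  rw [upFrom, Finset.Icc_eq_empty (by omega), Finset.sum_empty]

theorem abs_sum_le_card_mul {κ : Type*} (s : Finset κ) {g : κ → ℝ} {b : ℝ} (h : ∀ k ∈ s, |g k| ≤ b) :
    |∑ k ∈ s, g k| ≤ s.card * b :=
  (Finset.abs_sum_le_sum_abs _ _).trans ((Finset.sum_le_card_nsmul _ _ _ h).trans (by simp))

theorem abs_upFrom_le {L l : ℕ} (hl : 1 ≤ l) {g : ℕ → ℝ} {b : ℝ} (h : ∀ k, |g k| ≤ b) :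
    |upFrom L g l| ≤ L * b := by
  have hb : 0 ≤ b := (abs_nonneg _).trans (h 0)
  refine (abs_sum_le_card_mul _ fun k _ => h k).trans (mul_le_mul_of_nonneg_right ?_ hb)
  rw [Nat.card_Icc]
  exact_mod_cast (by omega)

variable {ι : Type*} [Fintype ι] [LinearOrder ι]

theorem sum_lifetimes_outFlow (L : ℕ) (x : Flow ι) (c : ℕ → ℝ) (i : ι) :
    ∑ l ∈ Finset.Icc 1 L, outFlow x i l * c l = ∑ j, ∑ l ∈ Finset.Icc 1 L, c l * x i j l := by
  simp only [outFlow, Finset.sum_mul]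
  rw [Finset.sum_comm]
  simp only [mul_comm]

theorem sum_lifetimes_inFlow (L : ℕ) (x : Flow ι) (c : ℕ → ℝ) (j : ι) :
    ∑ l ∈ Finset.Icc 1 L, inFlow x j l * c l = ∑ i, ∑ l ∈ Finset.Icc 1 L, c l * x i j l := by
  simp only [inFlow, Finset.sum_mul]
  rw [Finset.sum_comm]
  simp only [mul_comm]

namespace Network

variable (N : Network ι)

/-! ### Max-weight flows -/

theorem cost_eq_sum {x : Flow ι} (hx : N.IsFlow x) :
    N.cost x = ∑ i, ∑ j, ∑ l ∈ Finset.Icc 1 N.L, N.e i j * x i j l := by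
  rw [cost, ← Finset.sum_product' (f := fun i j => ∑ l ∈ Finset.Icc 1 N.L, N.e i j * x i j l)]
  simp only [linkFlow, Finset.mul_sum]
  refine Finset.sum_subset (Finset.subset_univ _) fun p _ hp => Finset.sum_eq_zero fun l _ => ?_
  rw [hx p.1 p.2 l (fun h => hp h.1), mul_zero]

/-- The drift-plus-penalty of a flow is its total weight with the opposite sign. -/
theorem drift_add_penalty_eq {x : Flow ι} (hx : N.IsFlow x) (hd : ∀ j l, x N.d j l = 0)
    (V Ud : ℝ) (U : ι → ℕ → ℝ) :
    V * N.cost x - Ud * N.delivered x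
      + ∑ i ∈ Finset.univ.erase N.d, ∑ l ∈ Finset.Icc 1 N.L,
          U i l * (upFrom N.L (outFlow x i) l - upFrom N.L (inFlow x i) (l + 1))
      = - ∑ i, ∑ j, ∑ l ∈ Finset.Icc 1 N.L, N.weight V Ud U i j l * x i j l := by
  have hout : ∑ i ∈ Finset.univ.erase N.d, ∑ l ∈ Finset.Icc 1 N.L,
      U i l * upFrom N.L (outFlow x i) l
      = ∑ i, ∑ j, ∑ l ∈ Finset.Icc 1 N.L, upTo (U i) l * x i j l := by
    simp only [sum_mul_upFrom, sum_lifetimes_outFlow]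
    refine Finset.sum_subset (Finset.subset_univ _) fun i _ hi => ?_
    obtain rfl : i = N.d := by simpa using hi
    simp [hd]
  have hin : Ud * N.delivered x + ∑ i ∈ Finset.univ.erase N.d, ∑ l ∈ Finset.Icc 1 N.L,
      U i l * upFrom N.L (inFlow x i) (l + 1)
      = ∑ i, ∑ j, ∑ l ∈ Finset.Icc 1 N.L,
          (if j = N.d then Ud else upTo (U j) (l - 1)) * x i j l := by
    -- Grouping by the receiving node isolates the destination, whose share is exactly the term with
    -- `Ud`.
    rw [Finset.sum_comm (s := Finset.univ) (t := Finset.univ),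
      ← Finset.add_sum_erase Finset.univ _ (Finset.mem_univ N.d)]
    congr 1
    · rw [delivered, mul_comm, Finset.sum_mul,
        sum_lifetimes_inFlow N.L x (fun _ => Ud) N.d]
      simp
    · refine Finset.sum_congr rfl fun j hj => ?_
      rw [sum_mul_upFrom_succ, sum_lifetimes_inFlow N.L x (fun l => upTo (U j) (l - 1)) j]
      simp [Finset.ne_of_mem_erase hj]
  have hV : V * N.cost x = ∑ i, ∑ j, ∑ l ∈ Finset.Icc 1 N.L, V * N.e i j * x i j l := by
    rw [N.cost_eq_sum hx]
    simp only [Finset.mul_sum, mul_assoc]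
  have key : ∑ i, ∑ j, ∑ l ∈ Finset.Icc 1 N.L, N.weight V Ud U i j l * x i j l
      = - (V * N.cost x) - (∑ i, ∑ j, ∑ l ∈ Finset.Icc 1 N.L, upTo (U i) l * x i j l)
        + ∑ i, ∑ j, ∑ l ∈ Finset.Icc 1 N.L,
          (if j = N.d then Ud else upTo (U j) (l - 1)) * x i j l := by
    rw [hV]
    simp only [← Finset.sum_neg_distrib, ← Finset.sum_add_distrib, ← Finset.sum_sub_distrib]
    refine Finset.sum_congr rfl fun i _ => Finset.sum_congr rfl fun j _ =>
      Finset.sum_congr rfl fun l _ => ?_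
    rw [weight]
    ring
  simp only [mul_sub, Finset.sum_sub_distrib]
  rw [key, ← hout, ← hin]
  ring

/-- `∑ C`, an upper bound for every link capacity. -/
def capSum (N : Network ι) : ℝ := ∑ i, ∑ j, N.C i j

theorem C_le_capSum (i j : ι) : N.C i j ≤ N.capSum :=
  (Finset.single_le_sum (f := fun j => N.C i j) (fun j _ => N.C_nonneg i j)
    (Finset.mem_univ j)).trans
  (Finset.single_le_sum (f := fun i => ∑ j, N.C i j)
    (fun i _ => Finset.sum_nonneg fun j _ => N.C_nonneg i j) (Finset.mem_univ i))

theorem capSum_nonneg : 0 ≤ N.capSum :=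
  Finset.sum_nonneg fun i _ => Finset.sum_nonneg fun j _ => N.C_nonneg i j

section MaxWeight

variable {N} {V : ℝ} {sel : ι → ι → (ℕ → ℝ) → ℕ} {Ud : ℝ} {U : ι → ℕ → ℝ}

theorem maxWeightFlow_nonneg (i j : ι) (l : ℕ) : 0 ≤ N.maxWeightFlow V sel Ud U i j l := by
  rw [maxWeightFlow]
  split_ifs
  exacts [N.C_nonneg i j, le_rfl]

theorem maxWeightFlow_le (i j : ι) (l : ℕ) : N.maxWeightFlow V sel Ud U i j l ≤ N.C i j := by
  rw [maxWeightFlow]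
  split_ifs
  exacts [le_rfl, N.C_nonneg i j]

theorem maxWeightFlow_dest (j : ι) (l : ℕ) : N.maxWeightFlow V sel Ud U N.d j l = 0 := by
  simp [maxWeightFlow]

variable (hsel : ∀ i j (w : ℕ → ℝ), 1 ≤ sel i j w ∧ sel i j w ≤ N.L)
include hsel

theorem isFlow_maxWeightFlow : N.IsFlow (N.maxWeightFlow V sel Ud U) := by
  intro i j l h
  rw [maxWeightFlow, if_neg]
  rintro ⟨hE, -, rfl, -⟩
  exact h ⟨hE, hsel _ _ _⟩

/-- At most the selected lifetime carries flow, so each sum over lifetimes has one term. Applied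
with weight one this yields the link capacity constraint. -/
theorem sum_mul_maxWeightFlow (i j : ι) (c : ℕ → ℝ) :
    ∑ l ∈ Finset.Icc 1 N.L, c l * N.maxWeightFlow V sel Ud U i j l
      = c (sel i j (N.weight V Ud U i j))
        * N.maxWeightFlow V sel Ud U i j (sel i j (N.weight V Ud U i j)) := by
  refine Finset.sum_eq_single_of_mem _ (Finset.mem_Icc.2 (hsel _ _ _)) fun l _ hl => ?_
  rw [maxWeightFlow, if_neg (fun h => hl h.2.2.1), mul_zero]

theorem linkFlow_maxWeightFlow_le (i j : ι) :
    N.linkFlow (N.maxWeightFlow V sel Ud U) i j ≤ N.C i j := by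
  have := sum_mul_maxWeightFlow (V := V) (Ud := Ud) (U := U) hsel i j (fun _ => 1)
  simp only [one_mul] at this
  rw [linkFlow, this]
  exact maxWeightFlow_le _ _ _

/-- The max-weight flow has the largest total weight under the capacity constraints. -/
theorem sum_weight_mul_le
    (hmax : ∀ i j (w : ℕ → ℝ) (l : ℕ), 1 ≤ l → l ≤ N.L → w l ≤ w (sel i j w)) {x : Flow ι}
    (hx : N.IsFlow x) (hd : ∀ j l, x N.d j l = 0) (hpos : ∀ i j l, 0 ≤ x i j l)
    (hcap : ∀ i j, (i, j) ∈ N.E → N.linkFlow x i j ≤ N.C i j) :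
    ∑ i, ∑ j, ∑ l ∈ Finset.Icc 1 N.L, N.weight V Ud U i j l * x i j l
      ≤ ∑ i, ∑ j, ∑ l ∈ Finset.Icc 1 N.L,
        N.weight V Ud U i j l * N.maxWeightFlow V sel Ud U i j l := by
  refine Finset.sum_le_sum fun i _ => Finset.sum_le_sum fun j _ => ?_
  by_cases h : (i, j) ∈ N.E ∧ i ≠ N.d
  · rw [sum_mul_maxWeightFlow hsel i j]
    set w := N.weight V Ud U i j
    calc ∑ l ∈ Finset.Icc 1 N.L, w l * x i j l
        -- Replacing every weight by the positive part of the largest one makes the bound depend on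
        -- the total link flow only, which the capacity controls.
        ≤ ∑ l ∈ Finset.Icc 1 N.L, max (w (sel i j w)) 0 * x i j l := by
          refine Finset.sum_le_sum fun l hl => mul_le_mul_of_nonneg_right ?_ (hpos i j l)
          rw [Finset.mem_Icc] at hl
          exact (hmax i j w l hl.1 hl.2).trans (le_max_left _ _)
      _ = max (w (sel i j w)) 0 * N.linkFlow x i j := by rw [linkFlow, Finset.mul_sum]
      _ ≤ max (w (sel i j w)) 0 * N.C i j :=
          mul_le_mul_of_nonneg_left (hcap i j h.1) (le_max_right _ _)
      _ = w (sel i j w) * N.maxWeightFlow V sel Ud U i j (sel i j w) := by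
          rw [maxWeightFlow]
          by_cases hw : 0 < w (sel i j w)
          · rw [if_pos ⟨h.1, h.2, rfl, hw⟩, max_eq_left hw.le]
          · rw [if_neg (fun h => hw h.2.2.2), max_eq_right (not_lt.1 hw)]
            simp
  -- Off the links and out of the destination both flows vanish.
  · have h0 : ∀ l, x i j l = 0 := by
      intro l
      by_cases hE : (i, j) ∈ N.E
      · obtain rfl : i = N.d := by
          by_contra hne
          exact h ⟨hE, hne⟩
        exact hd j l
      · exact hx i j l (fun h' => hE h'.1)
    have h1 : ∀ l, N.maxWeightFlow V sel Ud U i j l = 0 := by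
      intro l
      rw [maxWeightFlow, if_neg (fun h' => h ⟨h'.1, h'.2.1⟩)]
    simp [h0, h1]

end MaxWeight

/-! ### Virtual queues -/

/-- The average flows that satisfy the constraints of the virtual network. -/
structure Feasible (lam : ι → ℕ → ℝ) (γ : ℝ) (x : Flow ι) : Prop where
  isFlow : N.IsFlow x
  nonneg : ∀ i j l, 0 ≤ x i j l
  out_dest : ∀ j l, x N.d j l = 0
  capacity : ∀ i j, (i, j) ∈ N.E → N.linkFlow x i j ≤ N.C i j
  conservation : ∀ i, i ≠ N.d → ∀ l, 1 ≤ l → l ≤ N.L →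
    upFrom N.L (outFlow x i) l ≤ upFrom N.L (inFlow x i) (l + 1) + upFrom N.L (lam i) l
  reliability : γ * N.totalRate lam ≤ N.delivered x

/-- The sum of the squares of the virtual queues that are in use. -/
def lyapunov (S : ℝ × (ι → ℕ → ℝ)) : ℝ :=
  S.1 ^ 2 + ∑ i ∈ Finset.univ.erase N.d, ∑ l ∈ Finset.Icc 1 N.L, S.2 i l ^ 2

/-- A bound for the change of every virtual queue in a slot. -/
def stepBound (γ A : ℝ) : ℝ :=
  2 * (N.L * (Fintype.card ι * N.capSum)) + (|γ| + 1) * (Fintype.card ι * (N.L * A))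

theorem abs_outFlow_le {x : Flow ι} {K : ℝ} (h : ∀ i j l, |x i j l| ≤ K) (i : ι) (l : ℕ) :
    |outFlow x i l| ≤ Fintype.card ι * K :=
  abs_sum_le_card_mul _ fun j _ => h i j l

theorem abs_inFlow_le {x : Flow ι} {K : ℝ} (h : ∀ i j l, |x i j l| ≤ K) (i : ι) (l : ℕ) :
    |inFlow x i l| ≤ Fintype.card ι * K :=
  abs_sum_le_card_mul _ fun j _ => h j i l

theorem abs_totalRate_le {lam : ι → ℕ → ℝ} {A : ℝ} (h : ∀ i l, |lam i l| ≤ A) :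
    |N.totalRate lam| ≤ Fintype.card ι * (N.L * A) := by
  refine abs_sum_le_card_mul _ fun i _ => ?_
  refine (abs_sum_le_card_mul _ fun l _ => h i l).trans (by simp)

theorem one_le_card (N : Network ι) : (1 : ℝ) ≤ Fintype.card ι := by
  exact_mod_cast Fintype.card_pos_iff.2 ⟨N.d⟩

/-- The index `l'` of the outgoing flow is kept free: `l' = l` is the increment of a virtual queue,
`l' = l + 1` the summand of `available`. -/
theorem abs_upFrom_balance_le {x : Flow ι} {lam : ι → ℕ → ℝ} {A : ℝ}
    (hx : ∀ i j l, |x i j l| ≤ N.capSum) (h : ∀ i l, |lam i l| ≤ A) (γ : ℝ) (i : ι) {l l' : ℕ}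
    (hl : 1 ≤ l) (hl' : 1 ≤ l') :
    |upFrom N.L (outFlow x i) l' - upFrom N.L (inFlow x i) (l + 1) - upFrom N.L (lam i) l|
      ≤ N.stepBound γ A := by
  have hA : 0 ≤ A := (abs_nonneg _).trans (h N.d 0)
  have h1 := abs_upFrom_le (L := N.L) hl' (abs_outFlow_le hx i)
  have h2 := abs_upFrom_le (L := N.L) (l := l + 1) (by omega) (abs_inFlow_le hx i)
  have h3 := abs_upFrom_le (L := N.L) hl (h i)
  have h4 : N.L * A ≤ (|γ| + 1) * (Fintype.card ι * (N.L * A)) := by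
    have h5 : (0 : ℝ) ≤ N.L * A := by positivity
    calc N.L * A = 1 * (1 * (N.L * A)) := by ring
      _ ≤ (|γ| + 1) * (Fintype.card ι * (N.L * A)) := by
        gcongr
        · linarith [abs_nonneg γ]
        · exact N.one_le_card
  rw [stepBound]
  rw [abs_le] at *
  constructor <;> linarith [h1.1, h2.1, h3.1, h1.2, h2.2, h3.2]

theorem abs_delivery_le {x : Flow ι} {lam : ι → ℕ → ℝ} {A : ℝ}
    (hx : ∀ i j l, |x i j l| ≤ N.capSum) (h : ∀ i l, |lam i l| ≤ A) (γ : ℝ) :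
    |γ * N.totalRate lam - N.delivered x| ≤ N.stepBound γ A := by
  have hA : 0 ≤ A := (abs_nonneg _).trans (h N.d 0)
  have h1 : |N.delivered x| ≤ N.L * (Fintype.card ι * N.capSum) :=
    abs_upFrom_le le_rfl (abs_inFlow_le hx N.d)
  have h2 : |γ * N.totalRate lam| ≤ |γ| * (Fintype.card ι * (N.L * A)) := by
    rw [abs_mul]
    gcongr
    exact N.abs_totalRate_le h
  have h3 : (0 : ℝ) ≤ Fintype.card ι * (N.L * A) := by positivity
  have h4 : (0 : ℝ) ≤ N.L * (Fintype.card ι * N.capSum) := by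
    have := N.capSum_nonneg
    positivity
  rw [stepBound]
  refine (abs_sub _ _).trans ?_
  linarith

/-- Reflection at zero can only decrease the square. -/
theorem sq_max_zero_le (u y : ℝ) : max 0 (u + y) ^ 2 ≤ u ^ 2 + 2 * (u * y) + y ^ 2 := by
  rcases le_total 0 (u + y) with h | h
  · rw [max_eq_right h]
    exact le_of_eq (by ring)
  · rw [max_eq_left h]
    nlinarith [sq_nonneg (u + y)]

variable {N}
variable {V γ : ℝ} {sel : ℕ → ι → ι → (ℕ → ℝ) → ℕ} {a : ℕ → ι → ℕ → ℕ}

theorem virtualQueue_fst_nonneg (t : ℕ) : 0 ≤ (N.virtualQueue V γ sel a t).1 := by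
  cases t
  · exact le_rfl
  · exact le_max_left _ _

theorem virtualQueue_snd_nonneg (t : ℕ) (i : ι) (l : ℕ) :
    0 ≤ (N.virtualQueue V γ sel a t).2 i l := by
  cases t
  · exact le_rfl
  · exact le_max_left _ _

theorem virtualFlow_nonneg (t : ℕ) (i j : ι) (l : ℕ) : 0 ≤ N.virtualFlow V γ sel a t i j l :=
  maxWeightFlow_nonneg _ _ _

theorem abs_virtualFlow_le (t : ℕ) (i j : ι) (l : ℕ) :
    |N.virtualFlow V γ sel a t i j l| ≤ N.capSum := by
  rw [abs_of_nonneg (virtualFlow_nonneg _ _ _ _)]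
  exact (maxWeightFlow_le _ _ _).trans (N.C_le_capSum _ _)

theorem virtualFlow_dest (t : ℕ) (j : ι) (l : ℕ) : N.virtualFlow V γ sel a t N.d j l = 0 :=
  maxWeightFlow_dest _ _

theorem virtualQueue_succ_fst (t : ℕ) : (N.virtualQueue V γ sel a (t + 1)).1
    = max 0 ((N.virtualQueue V γ sel a t).1 + (γ * N.totalRate (fun i l => (a t i l : ℝ))
        - N.delivered (N.virtualFlow V γ sel a t))) := by
  rw [← add_sub_assoc]
  rfl

theorem virtualQueue_succ_snd (t : ℕ) (i : ι) (l : ℕ) : (N.virtualQueue V γ sel a (t + 1)).2 i l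
    = max 0 ((N.virtualQueue V γ sel a t).2 i l
      + (upFrom N.L (outFlow (N.virtualFlow V γ sel a t) i) l
        - upFrom N.L (inFlow (N.virtualFlow V γ sel a t) i) (l + 1)
        - upFrom N.L (fun k => (a t i k : ℝ)) l)) := by
  rw [← add_sub_assoc, ← add_sub_assoc]
  rfl

theorem IsArgmaxRule.isFlow_virtualFlow (hsel : N.IsArgmaxRule sel) (t : ℕ) :
    N.IsFlow (N.virtualFlow V γ sel a t) :=
  isFlow_maxWeightFlow (hsel.mem t)

/-- One-slot drift of the virtual queues under the max-weight flow, compared with any flow `x`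
under the capacity constraints. -/
theorem lyapunov_succ_le (hsel : N.IsArgmaxRule sel) {A : ℝ} (t : ℕ)
    (ha : ∀ i l, (a t i l : ℝ) ≤ A) {lam : ι → ℕ → ℝ} {x : Flow ι} (hx : N.Feasible lam γ x) :
    N.lyapunov (N.virtualQueue V γ sel a (t + 1))
        + 2 * (V * N.cost (N.virtualFlow V γ sel a t))
      ≤ N.lyapunov (N.virtualQueue V γ sel a t)
        + (1 + Fintype.card ι * N.L) * N.stepBound γ A ^ 2
        + 2 * (V * N.cost x
          + (N.virtualQueue V γ sel a t).1
            * (γ * N.totalRate (fun i l => (a t i l : ℝ)) - N.delivered x)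
          + ∑ i ∈ Finset.univ.erase N.d, ∑ l ∈ Finset.Icc 1 N.L,
            (N.virtualQueue V γ sel a t).2 i l * (upFrom N.L (outFlow x i) l
              - upFrom N.L (inFlow x i) (l + 1) - upFrom N.L (fun k => (a t i k : ℝ)) l)) := by
  have habs : ∀ i l, |(a t i l : ℝ)| ≤ A := fun i l => by
    rw [Nat.abs_cast]
    exact ha i l
  set S := N.virtualQueue V γ sel a t
  set ν := N.virtualFlow V γ sel a t with hν
  set b : ι → ℕ → ℝ := fun i l => upFrom N.L (fun k => (a t i k : ℝ)) l
  set g := γ * N.totalRate (fun i l => (a t i l : ℝ))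
  have hνb : ∀ i j l, |ν i j l| ≤ N.capSum := abs_virtualFlow_le t
  have h1 : (N.virtualQueue V γ sel a (t + 1)).1 ^ 2
      ≤ S.1 ^ 2 + 2 * (S.1 * (g - N.delivered ν)) + N.stepBound γ A ^ 2 := by
    rw [virtualQueue_succ_fst]
    refine (sq_max_zero_le _ _).trans (add_le_add le_rfl ?_)
    exact sq_le_sq' (abs_le.1 (N.abs_delivery_le hνb habs γ)).1
      (abs_le.1 (N.abs_delivery_le hνb habs γ)).2
  have h2 : ∑ i ∈ Finset.univ.erase N.d, ∑ l ∈ Finset.Icc 1 N.L,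
        (N.virtualQueue V γ sel a (t + 1)).2 i l ^ 2
      ≤ ∑ i ∈ Finset.univ.erase N.d, ∑ l ∈ Finset.Icc 1 N.L, (S.2 i l ^ 2
          + 2 * (S.2 i l * (upFrom N.L (outFlow ν i) l - upFrom N.L (inFlow ν i) (l + 1) - b i l))
          + N.stepBound γ A ^ 2) := by
    refine Finset.sum_le_sum fun i _ => Finset.sum_le_sum fun l hl => ?_
    have hl1 := (Finset.mem_Icc.1 hl).1
    rw [virtualQueue_succ_snd]
    refine (sq_max_zero_le _ _).trans (add_le_add le_rfl ?_)
    have := abs_le.1 (N.abs_upFrom_balance_le hνb habs γ i hl1 hl1)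
    exact sq_le_sq' this.1 this.2
  have h3 : ∑ i ∈ Finset.univ.erase N.d, ∑ l ∈ Finset.Icc 1 N.L, N.stepBound γ A ^ 2
      ≤ Fintype.card ι * N.L * N.stepBound γ A ^ 2 := by
    rw [Finset.sum_const, Finset.sum_const, nsmul_eq_mul, nsmul_eq_mul, mul_assoc]
    simp only [Nat.card_Icc, Nat.add_sub_cancel]
    gcongr
    exact Finset.card_le_univ _
  -- The arrival terms are the same for `ν` and `x`. Once they are split off, drift plus penalty of
  -- either flow is minus its total weight, and `ν` has the largest total weight.
  have hflow : ∀ y : Flow ι, ∑ i ∈ Finset.univ.erase N.d, ∑ l ∈ Finset.Icc 1 N.L,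
      S.2 i l * (upFrom N.L (outFlow y i) l - upFrom N.L (inFlow y i) (l + 1) - b i l)
      = ∑ i ∈ Finset.univ.erase N.d, ∑ l ∈ Finset.Icc 1 N.L,
          S.2 i l * (upFrom N.L (outFlow y i) l - upFrom N.L (inFlow y i) (l + 1))
        - ∑ i ∈ Finset.univ.erase N.d, ∑ l ∈ Finset.Icc 1 N.L, S.2 i l * b i l := by
    intro y
    simp only [← Finset.sum_sub_distrib]
    refine Finset.sum_congr rfl fun i _ => Finset.sum_congr rfl fun l _ => by ring
  have h4 := N.drift_add_penalty_eq (hsel.isFlow_virtualFlow (a := a) (V := V) (γ := γ) t)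
    (fun j l => virtualFlow_dest t j l) V S.1 S.2
  have h5 := N.drift_add_penalty_eq hx.isFlow hx.out_dest V S.1 S.2
  have h6 := sum_weight_mul_le (V := V) (Ud := S.1) (U := S.2) (hsel.mem t) (hsel.le t) hx.isFlow
    hx.out_dest hx.nonneg hx.capacity
  change _ ≤ ∑ i, ∑ j, ∑ l ∈ Finset.Icc 1 N.L, N.weight V S.1 S.2 i j l * ν i j l at h6
  have h7 := hflow x
  have h8 := hflow ν
  rw [← hν] at h4
  simp only [Finset.sum_add_distrib, ← Finset.mul_sum] at h2
  rw [lyapunov, lyapunov]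
  rw [h8] at h2
  change _ ≤ _ + _ + 2 * (V * N.cost x + S.1 * (g - N.delivered x) +
    ∑ i ∈ Finset.univ.erase N.d, ∑ l ∈ Finset.Icc 1 N.L,
      S.2 i l * (upFrom N.L (outFlow x i) l - upFrom N.L (inFlow x i) (l + 1) - b i l))
  rw [h7]
  linarith

/-- This crude linear growth serves only to make every variable of a slot bounded, hence integrable;
the decay of the queues divided by `t` comes from the drift. -/
theorem virtualQueue_le {A : ℝ} (ha : ∀ t i l, (a t i l : ℝ) ≤ A) (t : ℕ) :
    (N.virtualQueue V γ sel a t).1 ≤ t * N.stepBound γ A ∧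
      ∀ i l, 1 ≤ l → (N.virtualQueue V γ sel a t).2 i l ≤ t * N.stepBound γ A := by
  have habs : ∀ t i l, |(a t i l : ℝ)| ≤ A := fun t i l => by
    rw [Nat.abs_cast]
    exact ha t i l
  have hA : 0 ≤ A := (abs_nonneg _).trans (habs 0 N.d 0)
  have hK : 0 ≤ N.stepBound γ A := by
    have := N.capSum_nonneg
    rw [stepBound]
    positivity
  induction t with
  | zero => simp [virtualQueue]
  | succ t ih =>
    refine ⟨?_, fun i l hl => ?_⟩
    · rw [virtualQueue_succ_fst]
      have := (abs_le.1 (N.abs_delivery_le (abs_virtualFlow_le (V := V) (γ := γ) (sel := sel)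
        (a := a) t) (habs t) γ)).2
      refine max_le (by positivity) ?_
      push_cast
      linarith [ih.1]
    · rw [virtualQueue_succ_snd]
      have := (abs_le.1 (N.abs_upFrom_balance_le (abs_virtualFlow_le (V := V) (γ := γ) (sel := sel)
        (a := a) t) (habs t) γ i hl hl)).2
      refine max_le (by positivity) ?_
      push_cast
      linarith [ih.2 i l hl]

end Network

/-! ### Linear functionals of flows commute with averages and expectations -/

/-- The empirical averages of a sequence of flows. -/
noncomputable def flowAvg (x : ℕ → Flow ι) (T : ℕ) : Flow ι :=
  fun i j l => timeAvg (fun t => x t i j l) T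

/-- The expectation of a random flow. -/
noncomputable def meanFlow {Ω : Type*} [MeasurableSpace Ω] (P : Measure Ω) (x : Ω → Flow ι) :
    Flow ι :=
  fun i j l => ∫ ω, x ω i j l ∂P

theorem upFrom_timeAvg (L : ℕ) (g : ℕ → ℕ → ℝ) (l T : ℕ) :
    upFrom L (fun k => timeAvg (fun t => g t k) T) l = timeAvg (fun t => upFrom L (g t) l) T :=
  (timeAvg_sum _ (fun k t => g t k) T).symm

theorem outFlow_flowAvg (x : ℕ → Flow ι) (i : ι) (T : ℕ) :
    outFlow (flowAvg x T) i = fun l => timeAvg (fun t => outFlow (x t) i l) T :=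
  funext fun l => (timeAvg_sum _ (fun j t => x t i j l) T).symm

theorem inFlow_flowAvg (x : ℕ → Flow ι) (i : ι) (T : ℕ) :
    inFlow (flowAvg x T) i = fun l => timeAvg (fun t => inFlow (x t) i l) T :=
  funext fun l => (timeAvg_sum _ (fun j t => x t j i l) T).symm

theorem upFrom_outFlow_flowAvg (L : ℕ) (x : ℕ → Flow ι) (i : ι) (l T : ℕ) :
    upFrom L (outFlow (flowAvg x T) i) l = timeAvg (fun t => upFrom L (outFlow (x t) i) l) T := by
  rw [outFlow_flowAvg]
  exact upFrom_timeAvg L (fun t k => outFlow (x t) i k) l T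

theorem upFrom_inFlow_flowAvg (L : ℕ) (x : ℕ → Flow ι) (i : ι) (l T : ℕ) :
    upFrom L (inFlow (flowAvg x T) i) l = timeAvg (fun t => upFrom L (inFlow (x t) i) l) T := by
  rw [inFlow_flowAvg]
  exact upFrom_timeAvg L (fun t k => inFlow (x t) i k) l T

section Mean

variable {Ω : Type*} [MeasurableSpace Ω] {P : Measure Ω} {x : Ω → Flow ι}

theorem integral_upFrom {g : Ω → ℕ → ℝ} (hg : ∀ k, Integrable (fun ω => g ω k) P) (L l : ℕ) :
    ∫ ω, upFrom L (g ω) l ∂P = upFrom L (fun k => ∫ ω, g ω k ∂P) l :=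
  integral_finsetSum _ fun k _ => hg k

theorem integrable_upFrom {g : Ω → ℕ → ℝ} (hg : ∀ k, Integrable (fun ω => g ω k) P) (L l : ℕ) :
    Integrable (fun ω => upFrom L (g ω) l) P :=
  integrable_finsetSum _ fun k _ => hg k

variable (hx : ∀ i j l, Integrable (fun ω => x ω i j l) P)
include hx

theorem integrable_outFlow (i : ι) (l : ℕ) : Integrable (fun ω => outFlow (x ω) i l) P :=
  integrable_finsetSum _ fun j _ => hx i j l

theorem integrable_inFlow (i : ι) (l : ℕ) : Integrable (fun ω => inFlow (x ω) i l) P :=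
  integrable_finsetSum _ fun j _ => hx j i l

theorem outFlow_meanFlow (i : ι) (l : ℕ) :
    outFlow (meanFlow P x) i l = ∫ ω, outFlow (x ω) i l ∂P :=
  (integral_finsetSum _ fun j _ => hx i j l).symm

theorem inFlow_meanFlow (i : ι) (l : ℕ) :
    inFlow (meanFlow P x) i l = ∫ ω, inFlow (x ω) i l ∂P :=
  (integral_finsetSum _ fun j _ => hx j i l).symm

theorem linkFlow_meanFlow (N : Network ι) (i j : ι) :
    N.linkFlow (meanFlow P x) i j = ∫ ω, N.linkFlow (x ω) i j ∂P :=
  (integral_finsetSum _ fun l _ => hx i j l).symm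

theorem integrable_linkFlow (N : Network ι) (i j : ι) :
    Integrable (fun ω => N.linkFlow (x ω) i j) P :=
  integrable_finsetSum _ fun l _ => hx i j l

theorem delivered_meanFlow (N : Network ι) :
    N.delivered (meanFlow P x) = ∫ ω, N.delivered (x ω) ∂P := by
  simp only [Network.delivered, inFlow_meanFlow hx]
  exact (integral_finsetSum _ fun _ _ => integrable_inFlow hx _ _).symm

theorem integrable_delivered (N : Network ι) : Integrable (fun ω => N.delivered (x ω)) P :=
  integrable_finsetSum _ fun _ _ => integrable_inFlow hx _ _

theorem cost_meanFlow (N : Network ι) :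
    N.cost (meanFlow P x) = ∫ ω, N.cost (x ω) ∂P := by
  simp only [Network.cost, linkFlow_meanFlow hx, ← integral_const_mul]
  exact (integral_finsetSum _ fun _ _ => (integrable_linkFlow hx N _ _).const_mul _).symm

theorem integrable_cost (N : Network ι) : Integrable (fun ω => N.cost (x ω)) P :=
  integrable_finsetSum _ fun _ _ => (integrable_linkFlow hx N _ _).const_mul _

end Mean

namespace Network

variable {N : Network ι}

theorem linkFlow_flowAvg (x : ℕ → Flow ι) (i j : ι) (T : ℕ) :
    N.linkFlow (flowAvg x T) i j = timeAvg (fun t => N.linkFlow (x t) i j) T :=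
  (timeAvg_sum _ (fun l t => x t i j l) T).symm

theorem delivered_flowAvg (x : ℕ → Flow ι) (T : ℕ) :
    N.delivered (flowAvg x T) = timeAvg (fun t => N.delivered (x t)) T :=
  upFrom_inFlow_flowAvg N.L x N.d 1 T

theorem cost_flowAvg (x : ℕ → Flow ι) (T : ℕ) :
    N.cost (flowAvg x T) = timeAvg (fun t => N.cost (x t)) T := by
  simp only [cost, linkFlow_flowAvg, ← timeAvg_const_mul]
  exact (timeAvg_sum _ (fun (p : ι × ι) t => N.e p.1 p.2 * N.linkFlow (x t) p.1 p.2) T).symm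

theorem totalRate_timeAvg (g : ℕ → ι → ℕ → ℝ) (T : ℕ) :
    N.totalRate (fun i l => timeAvg (fun t => g t i l) T) = timeAvg (fun t => N.totalRate (g t)) T := by
  simp only [totalRate]
  rw [timeAvg_sum]
  simp only [timeAvg_sum]

theorem continuous_cost : Continuous fun x : Flow ι => N.cost x := by
  unfold cost linkFlow
  fun_prop

theorem continuous_linkFlow (i j : ι) : Continuous fun x : Flow ι => N.linkFlow x i j := by
  unfold linkFlow
  fun_prop

theorem continuous_delivered : Continuous fun x : Flow ι => N.delivered x := by
  unfold delivered inFlow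
  fun_prop

/-! ### The time averages of an admissible process accumulate at a feasible flow -/

section Queue

variable {a : ℕ → ι → ℕ → ℕ} {x : ℕ → Flow ι}

theorem queue_of_lt (ha : ∀ t i l, N.L < l → a t i l = 0) (hx : ∀ t, N.IsFlow (x t)) (t : ℕ) (i : ι)
    {l : ℕ} (hl : N.L < l) : N.queue a x t i l = 0 := by
  induction t generalizing l with
  | zero => rfl
  | succ t ih =>
    have h0 : ∀ i j, x t i j (l + 1) = 0 := fun i j => hx t i j _ (by omega)
    rw [queue, queueStep]
    split_ifs
    · rfl
    · simp [ih (show N.L < l + 1 by omega), outFlow, inFlow, h0, ha t i l hl]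

/-- The accumulated balance dominates the non-negative backlog of lifetimes at least `l`. It need
not equal it, since packets ageing from `l` to `l - 1` leave this class. -/
theorem sum_balance_nonneg (ha : ∀ t i l, N.L < l → a t i l = 0) (hx : ∀ t, N.IsFlow (x t))
    (hpos : ∀ t i j l, 0 ≤ x t i j l)
    (hq : ∀ t i l, 1 ≤ l → l ≤ N.L → outFlow (x t) i l ≤ N.queue a x t i l) {i : ι} (hi : i ≠ N.d)
    {l : ℕ} (hl : 1 ≤ l) (hlL : l ≤ N.L) (T : ℕ) :
    0 ≤ ∑ t ∈ Finset.range T, (upFrom N.L (inFlow (x t) i) (l + 1)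
      + upFrom N.L (fun k => (a t i k : ℝ)) l - upFrom N.L (outFlow (x t) i) l) := by
  have key : upFrom N.L (N.queue a x T i) l
      ≤ ∑ t ∈ Finset.range T, (upFrom N.L (inFlow (x t) i) (l + 1)
      + upFrom N.L (fun k => (a t i k : ℝ)) l - upFrom N.L (outFlow (x t) i) l) := by
    induction T with
    | zero => simp [queue, upFrom]
    | succ T ih =>
      rw [Finset.sum_range_succ]
      have hs : upFrom N.L (N.queue a x (T + 1) i) l
          = upFrom N.L (N.queue a x T i) (l + 1) - upFrom N.L (outFlow (x T) i) (l + 1)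
            + upFrom N.L (inFlow (x T) i) (l + 1) + upFrom N.L (fun k => (a T i k : ℝ)) l := by
        -- The dynamics shift lifetimes by one; the term at `L + 1` that the shift brings in
        -- vanishes for backlogs and flows.
        have hshift : ∀ g : ℕ → ℝ, g (N.L + 1) = 0 →
            ∑ k ∈ Finset.Icc l N.L, g (k + 1) = upFrom N.L g (l + 1) := by
          intro g hg
          have e1 : ∀ m, Finset.Icc m N.L = Finset.Ico m (N.L + 1) := fun m => by
            ext k
            simp only [Finset.mem_Icc, Finset.mem_Ico]
            omega
          rw [upFrom, e1, e1, Finset.sum_Ico_add' g,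
            Finset.sum_Ico_succ_top (by omega : l + 1 ≤ N.L + 1), hg, add_zero]
        have h0 : ∀ i j, x T i j (N.L + 1) = 0 := fun i j => hx T i j _ (by omega)
        rw [← hshift _ (queue_of_lt ha hx T i (Nat.lt_succ_self _)),
          ← hshift (outFlow (x T) i) (by simp [outFlow, h0]),
          ← hshift (inFlow (x T) i) (by simp [inFlow, h0]), upFrom, upFrom,
          ← Finset.sum_sub_distrib, ← Finset.sum_add_distrib, ← Finset.sum_add_distrib]
        refine Finset.sum_congr rfl fun k hk => ?_
        have := (Finset.mem_Icc.1 hk).1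
        rw [queue, queueStep, if_neg (by simp only [hi, false_or]; omega)]
      -- The discarded term is the remaining backlog at lifetime `l` after transmission, which is
      -- non-negative by availability.
      have h1 := upFrom_eq_add hlL (N.queue a x T i)
      have h2 := upFrom_eq_add hlL (outFlow (x T) i)
      have h3 := hq T i l hl hlL
      linarith
  refine le_trans (Finset.sum_nonneg fun k hk => ?_) key
  rw [Finset.mem_Icc] at hk
  exact (Finset.sum_nonneg fun j _ => hpos T i j k).trans (hq T i k (hl.trans hk.1) hk.2)

end Queue

section Arrival

variable {Ω : Type*} [MeasurableSpace Ω] {P : Measure Ω} [IsProbabilityMeasure P] {Amax : ℝ}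
  {lam : ι → ℕ → ℝ} {a : ℕ → ι → ℕ → Ω → ℕ}

theorem IsArrival.measurable_cast (ha : N.IsArrival P Amax lam a) (t : ℕ) (i : ι) (l : ℕ) :
    Measurable fun ω => (a t i l ω : ℝ) :=
  (measurable_of_countable (fun n : ℕ => (n : ℝ))).comp (ha.measurable t i l)

theorem IsArrival.memLp (ha : N.IsArrival P Amax lam a) (t : ℕ) (i : ι) (l : ℕ) :
    MemLp (fun ω => (a t i l ω : ℝ)) ⊤ P := by
  refine memLp_top_of_bound (ha.measurable_cast t i l).aestronglyMeasurable Amax ?_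
  filter_upwards [ha.bounded t i l] with ω hω
  rwa [Real.norm_eq_abs, Nat.abs_cast]

theorem IsArrival.integrable (ha : N.IsArrival P Amax lam a) (t : ℕ) (i : ι) (l : ℕ) :
    Integrable (fun ω => (a t i l ω : ℝ)) P :=
  (ha.memLp t i l).integrable le_top

variable {γ : ℝ} {x : ℕ → Ω → Flow ι}

theorem Admissible.conservation (ha : N.IsArrival P Amax lam a) (h : N.Admissible P a lam γ x)
    {i : ι} (hi : i ≠ N.d) {l : ℕ} (hl : 1 ≤ l) (hlL : l ≤ N.L) {T : ℕ} (hT : 0 < T) :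
    upFrom N.L (outFlow (flowAvg (fun t => meanFlow P (x t)) T) i) l
      ≤ upFrom N.L (inFlow (flowAvg (fun t => meanFlow P (x t)) T) i) (l + 1)
        + upFrom N.L (lam i) l := by
  have h0 : 0 ≤ ∫ ω, ∑ t ∈ Finset.range T, (upFrom N.L (inFlow (x t ω) i) (l + 1)
      + upFrom N.L (fun k => (a t i k ω : ℝ)) l - upFrom N.L (outFlow (x t ω) i) l) ∂P := by
    refine integral_nonneg_of_ae ?_
    filter_upwards [h.nonneg, h.availability] with ω h1 h2
    exact sum_balance_nonneg (a := fun s k m => a s k m ω) (x := fun s => x s ω)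
      (fun t i l hl => ha.support t i l ω (by omega)) (fun t => h.isFlow t ω) h1 h2 hi hl hlL T
  have hin : ∀ t, Integrable (fun ω => upFrom N.L (inFlow (x t ω) i) (l + 1)) P := fun t =>
    integrable_upFrom (fun k => integrable_inFlow (h.integrable t) i k) _ _
  have hout : ∀ t, Integrable (fun ω => upFrom N.L (outFlow (x t ω) i) l) P := fun t =>
    integrable_upFrom (fun k => integrable_outFlow (h.integrable t) i k) _ _
  have har : ∀ t, Integrable (fun ω => upFrom N.L (fun k => (a t i k ω : ℝ)) l) P := fun t =>
    integrable_upFrom (fun k => ha.integrable t i k) _ _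
  rw [integral_finsetSum _ fun t _ => by exact ((hin t).add (har t)).sub (hout t)] at h0
  have h1 : ∀ t, ∫ ω, (upFrom N.L (inFlow (x t ω) i) (l + 1)
      + upFrom N.L (fun k => (a t i k ω : ℝ)) l - upFrom N.L (outFlow (x t ω) i) l) ∂P
      = upFrom N.L (inFlow (meanFlow P (x t)) i) (l + 1) + upFrom N.L (lam i) l
        - upFrom N.L (outFlow (meanFlow P (x t)) i) l := by
    intro t
    rw [integral_sub (by exact (hin t).add (har t)) (hout t), integral_add (hin t) (har t),
      integral_upFrom (fun k => integrable_inFlow (h.integrable t) i k),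
      integral_upFrom (fun k => integrable_outFlow (h.integrable t) i k),
      integral_upFrom (fun k => ha.integrable t i k)]
    simp only [← inFlow_meanFlow (h.integrable t), ← outFlow_meanFlow (h.integrable t), ha.mean]
  simp only [h1] at h0
  rw [upFrom_outFlow_flowAvg, upFrom_inFlow_flowAvg]
  have h2 : 0 ≤ timeAvg (fun t => upFrom N.L (inFlow (meanFlow P (x t)) i) (l + 1)
      + upFrom N.L (lam i) l - upFrom N.L (outFlow (meanFlow P (x t)) i) l) T :=
    div_nonneg h0 (Nat.cast_nonneg T)
  rw [timeAvg_sub, timeAvg_add] at h2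
  have h3 : timeAvg (fun _ => upFrom N.L (lam i) l) T = upFrom N.L (lam i) l := by
    rw [timeAvg, Finset.sum_const, Finset.card_range, nsmul_eq_mul, mul_div_cancel_left₀]
    positivity
  linarith

theorem Admissible.meanFlow_nonneg (h : N.Admissible P a lam γ x) (t : ℕ) (i j : ι) (l : ℕ) :
    0 ≤ meanFlow P (x t) i j l := by
  refine integral_nonneg_of_ae ?_
  filter_upwards [h.nonneg] with ω hω
  exact hω t i j l

theorem Admissible.isFlow_meanFlow (h : N.Admissible P a lam γ x) (t : ℕ) :
    N.IsFlow (meanFlow P (x t)) := by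
  intro i j l hl
  rw [meanFlow]
  simp [h.isFlow t _ i j l hl]

/-- The destination has no backlog, so availability leaves nothing to send from it. -/
theorem Admissible.meanFlow_dest (h : N.Admissible P a lam γ x) (t : ℕ) (j : ι) (l : ℕ) :
    meanFlow P (x t) N.d j l = 0 := by
  by_cases hl : 1 ≤ l ∧ l ≤ N.L
  · refine integral_eq_zero_of_ae ?_
    filter_upwards [h.nonneg, h.availability] with ω h1 h2
    refine le_antisymm ?_ (h1 t N.d j l)
    refine (Finset.single_le_sum (f := fun j => x t ω N.d j l) (fun j _ => h1 t N.d j l)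
      (Finset.mem_univ j)).trans ((h2 t N.d l hl.1 hl.2).trans (le_of_eq ?_))
    cases t <;> simp [queue, queueStep]
  · exact h.isFlow_meanFlow t N.d j l (fun h' => hl h'.2)

/-- Compactness: the averages eventually lie in a product of intervals, and the constraints, exact
or asymptotic, pass to the limit of a subsequence coordinate by coordinate. -/
theorem Admissible.exists_feasible (ha : N.IsArrival P Amax lam a)
    (h : N.Admissible P a lam γ x) :
    ∃ (y : Flow ι) (φ : ℕ → ℕ), StrictMono φ ∧ N.Feasible lam γ y ∧
      Tendsto (fun n => flowAvg (fun t => meanFlow P (x t)) (φ n)) atTop (𝓝 y) := by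
  set z := fun T => flowAvg (fun t => meanFlow P (x t)) T with hz
  have hz0 : ∀ T i j l, 0 ≤ z T i j l := fun T i j l =>
    timeAvg_nonneg (fun t => h.meanFlow_nonneg t i j l) T
  have hzf : ∀ T, N.IsFlow (z T) := fun T i j l hl => by
    simp [hz, flowAvg, h.isFlow_meanFlow _ i j l hl, timeAvg]
  have hcap : ∀ i j, (i, j) ∈ N.E → AvgLE (fun t => N.linkFlow (meanFlow P (x t)) i j) (N.C i j) := by
    intro i j hij
    simp only [linkFlow_meanFlow (h.integrable _)]
    exact h.capacity i j hij
  -- Capacities hold only as upper limits, so the box has one unit of slack.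
  have hev : ∀ᶠ T in atTop, ∀ p ∈ N.E, N.linkFlow (z T) p.1 p.2 ≤ N.C p.1 p.2 + 1 := by
    rw [eventually_all_finset]
    intro p hp
    filter_upwards [hcap p.1 p.2 hp 1 one_pos] with T hT
    rw [hz, linkFlow_flowAvg]
    exact hT
  obtain ⟨y, -, φ, hφ, hlim⟩ := (isCompact_univ_pi fun i => isCompact_univ_pi fun j =>
      isCompact_univ_pi fun _ => isCompact_Icc (a := (0 : ℝ)) (b := N.C i j + 1)).tendsto_subseq'
      (x := z) (by
    refine Eventually.frequently ?_
    filter_upwards [hev] with T hT i _ j _ l _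
    refine ⟨hz0 T i j l, ?_⟩
    by_cases hl : (i, j) ∈ N.E ∧ 1 ≤ l ∧ l ≤ N.L
    · exact (Finset.single_le_sum (f := fun l => z T i j l) (fun l _ => hz0 T i j l)
        (Finset.mem_Icc.2 hl.2)).trans (hT (i, j) hl.1)
    · rw [hzf T i j l hl]
      linarith [N.C_nonneg i j])
  have hcoord : ∀ i j l, Tendsto (fun n => z (φ n) i j l) atTop (𝓝 (y i j l)) := fun i j l =>
    ((show Continuous fun y : Flow ι => y i j l by fun_prop).tendsto y).comp hlim
  refine ⟨y, φ, hφ, ⟨?_, ?_, ?_, ?_, ?_, ?_⟩, hlim⟩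
  · intro i j l hl
    refine tendsto_nhds_unique (hcoord i j l) ?_
    simp [hzf _ i j l hl]
  · exact fun i j l => ge_of_tendsto' (hcoord i j l) fun n => hz0 _ i j l
  · intro j l
    refine tendsto_nhds_unique (hcoord N.d j l) ?_
    simp [hz, flowAvg, h.meanFlow_dest, timeAvg]
  · intro i j hij
    refine le_of_forall_pos_le_add fun ε hε => ?_
    refine le_of_tendsto (((continuous_linkFlow i j).tendsto y).comp hlim) ?_
    filter_upwards [hφ.tendsto_atTop.eventually (hcap i j hij ε hε)] with n hn
    simpa only [hz, Function.comp, linkFlow_flowAvg] using hn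
  · intro i hi l hl hlL
    have hc1 : Continuous fun x : Flow ι => upFrom N.L (outFlow x i) l := by
      unfold upFrom outFlow
      fun_prop
    have hc2 : Continuous fun x : Flow ι =>
        upFrom N.L (inFlow x i) (l + 1) + upFrom N.L (lam i) l := by
      unfold upFrom inFlow
      fun_prop
    refine le_of_tendsto_of_tendsto ((hc1.tendsto y).comp hlim) ((hc2.tendsto y).comp hlim) ?_
    filter_upwards [hφ.tendsto_atTop.eventually (eventually_gt_atTop 0)] with n hn
    exact h.conservation ha hi hl hlL hn
  · have hrel := h.reliability
    simp only [← delivered_meanFlow (h.integrable _)] at hrel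
    refine le_of_forall_pos_sub_le fun ε hε => ?_
    refine ge_of_tendsto ((continuous_delivered.tendsto y).comp hlim) ?_
    filter_upwards [hφ.tendsto_atTop.eventually (hrel ε hε)] with n hn
    simpa only [hz, Function.comp, delivered_flowAvg] using hn

theorem Admissible.exists_feasible_cost_le (ha : N.IsArrival P Amax lam a)
    (h : N.Admissible P a lam γ x) {c : ℝ} (hc : AvgLE (fun t => ∫ ω, N.cost (x t ω) ∂P) c) :
    ∃ y : Flow ι, N.Feasible lam γ y ∧ N.cost y ≤ c := by
  obtain ⟨y, φ, hφ, hy, hlim⟩ := h.exists_feasible ha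
  refine ⟨y, hy, le_of_forall_pos_le_add fun ε hε => ?_⟩
  simp only [← cost_meanFlow (h.integrable _)] at hc
  refine le_of_tendsto ((continuous_cost.tendsto y).comp hlim) ?_
  filter_upwards [hφ.tendsto_atTop.eventually (hc ε hε)] with n hn
  simpa only [Function.comp, cost_flowAvg] using hn

end Arrival

end Network

/-! ### Independence of a family member from a functional of the other members -/

/-- A function that ignores the coordinates outside `S` factors through the restriction to `S`, with
default values filled in elsewhere; disjoint blocks of an independent family are independent. It is
used for past arrivals against a later one, and for earlier marks against a current one. -/
theorem iIndepFun_indepFun_of_dependsOn {κ Ω X β : Type*} [MeasurableSpace Ω] [MeasurableSpace X]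
    [MeasurableSpace β] [Inhabited X] {P : Measure Ω} {Y : κ → Ω → X} (hY : iIndepFun Y P)
    (hm : ∀ i, Measurable (Y i)) {S : Set κ} {k : κ} (hk : k ∉ S) {G : (κ → X) → β}
    (hG : Measurable G) (hdep : DependsOn G S) :
    IndepFun (fun ω => G (fun i => Y i ω)) (Y k) P := by
  classical
  let ext : (S → X) → κ → X := fun f i => if h : i ∈ S then f ⟨i, h⟩ else default
  have hext : Measurable ext := by
    refine measurable_pi_lambda _ fun i => ?_
    by_cases h : i ∈ S
    · simpa only [ext, h, dite_true] using measurable_pi_apply (⟨i, h⟩ : S)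
    · simp only [ext, h, dite_false, measurable_const]
  have hGeq : (fun ω => G (fun i => Y i ω)) = (G ∘ ext) ∘ fun ω (i : S) => Y i ω := by
    funext ω
    refine hdep fun i hi => ?_
    simp only [ext, hi, dite_true]
  have hindep := indep_iSup_of_disjoint (fun i => (hm i).comap_le) hY.iIndep
    (Set.disjoint_singleton_right.2 hk)
  have hbase : IndepFun (fun ω (i : S) => Y i ω) (Y k) P := by
    refine indep_of_indep_of_le_left (indep_of_indep_of_le_right hindep ?_) ?_
    · exact le_iSup₂_of_le (f := fun i (_ : i ∈ ({k} : Set κ)) => MeasurableSpace.comap (Y i) _)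
        k rfl le_rfl
    · change MeasurableSpace.comap _ (⨆ i, MeasurableSpace.comap (fun b : S → X => b i) _) ≤ _
      rw [MeasurableSpace.comap_iSup]
      refine iSup_le fun i => ?_
      rw [MeasurableSpace.comap_comp]
      exact le_iSup₂_of_le (f := fun i (_ : i ∈ S) => MeasurableSpace.comap (Y i) _) i.1 i.2 le_rfl
  rw [hGeq]
  exact hbase.comp (hG.comp hext) measurable_id

/-- Fubini's theorem for a function of two independent random variables. -/
theorem IndepFun_integral_eq_integral_integral {Ω X Y : Type*} [MeasurableSpace Ω]
    [MeasurableSpace X] [MeasurableSpace Y] {P : Measure Ω} [IsProbabilityMeasure P] {f : Ω → X}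
    {g : Ω → Y} (h : IndepFun f g P) (hf : Measurable f) (hg : Measurable g) {F : X → Y → ℝ}
    (hF : Measurable (Function.uncurry F)) (hi : Integrable (fun ω => F (f ω) (g ω)) P) :
    ∫ ω, F (f ω) (g ω) ∂P = ∫ ω, ∫ ω', F (f ω) (g ω') ∂P ∂P := by
  have := Measure.isProbabilityMeasure_map (μ := P) hf.aemeasurable
  have := Measure.isProbabilityMeasure_map (μ := P) hg.aemeasurable
  have hmap := (indepFun_iff_map_prod_eq_prod_map_map hf.aemeasurable hg.aemeasurable).1 h
  have h1 : Integrable (Function.uncurry F) ((P.map f).prod (P.map g)) := by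
    rw [← hmap, integrable_map_measure hF.aestronglyMeasurable (hf.prodMk hg).aemeasurable]
    exact hi
  calc ∫ ω, F (f ω) (g ω) ∂P = ∫ z, Function.uncurry F z ∂(P.map fun ω => (f ω, g ω)) := by
        rw [integral_map (hf.prodMk hg).aemeasurable hF.aestronglyMeasurable]
        rfl
    _ = ∫ x, ∫ y, F x y ∂(P.map g) ∂(P.map f) := by rw [hmap, integral_prod _ h1]; rfl
    _ = ∫ ω, ∫ y, F (f ω) y ∂(P.map g) ∂P :=
        integral_map hf.aemeasurable hF.stronglyMeasurable.integral_prod_right'.aestronglyMeasurable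
    _ = _ := by
        refine integral_congr_ae (Eventually.of_forall fun ω => ?_)
        exact integral_map hg.aemeasurable
          (hF.comp measurable_prodMk_left).aestronglyMeasurable

/-- A realization of the arrival process. -/
def arrivalPath {Ω : Type*} (a : ℕ → ι → ℕ → Ω → ℕ) (ω : Ω) : ℕ → ι → ℕ → ℕ :=
  fun s i l => a s i l ω

/-! ### Causality and measurability of the virtual network -/

namespace Network

variable {N : Network ι} {V γ : ℝ} {sel : ℕ → ι → ι → (ℕ → ℝ) → ℕ}

theorem virtualQueue_congr {a b : ℕ → ι → ℕ → ℕ} {t : ℕ} (h : ∀ s < t, a s = b s) :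
    N.virtualQueue V γ sel a t = N.virtualQueue V γ sel b t := by
  induction t with
  | zero => rfl
  | succ t ih =>
    rw [virtualQueue, virtualQueue, ih fun s hs => h s (by omega), h t (by omega)]

theorem virtualFlow_congr {a b : ℕ → ι → ℕ → ℕ} {t : ℕ} (h : ∀ s < t, a s = b s) :
    N.virtualFlow V γ sel a t = N.virtualFlow V γ sel b t := by
  rw [virtualFlow, virtualFlow, virtualQueue_congr h]

theorem measurable_weight {X : Type*} [MeasurableSpace X] {Ud : X → ℝ} {U : X → ι → ℕ → ℝ}
    (hUd : Measurable Ud) (hU : ∀ i l, Measurable fun a => U a i l) (i j : ι) (l : ℕ) :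
    Measurable fun a => N.weight V (Ud a) (U a) i j l := by
  have h : ∀ i l, Measurable fun a => upTo (U a i) l := fun i l =>
    Finset.measurable_fun_sum _ fun k _ => hU i k
  unfold weight
  refine (measurable_const.sub (h i l)).add ?_
  by_cases hj : j = N.d
  · simpa only [hj, if_true] using hUd
  · simpa only [hj, if_false] using h j _

theorem measurable_maxWeightFlow {X : Type*} [MeasurableSpace X] {Ud : X → ℝ}
    {U : X → ι → ℕ → ℝ} (hUd : Measurable Ud) (hU : ∀ i l, Measurable fun a => U a i l)
    {sel : ι → ι → (ℕ → ℝ) → ℕ} (hsel : ∀ i j, Measurable (sel i j)) (i j : ι) (l : ℕ) :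
    Measurable fun a => N.maxWeightFlow V sel (Ud a) (U a) i j l := by
  have hw : ∀ l, Measurable fun a => N.weight V (Ud a) (U a) i j l :=
    measurable_weight hUd hU i j
  unfold maxWeightFlow
  refine Measurable.ite ?_ measurable_const measurable_const
  refine (MeasurableSet.const _).inter ((MeasurableSet.const _).inter (.inter ?_ ?_))
  · exact measurableSet_eq_fun measurable_const ((hsel i j).comp (measurable_pi_iff.2 hw))
  · exact measurableSet_lt measurable_const (hw l)

theorem measurable_upFrom {X : Type*} [MeasurableSpace X] {g : X → ℕ → ℝ}
    (hg : ∀ k, Measurable fun a => g a k) (L l : ℕ) : Measurable fun a => upFrom L (g a) l :=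
  Finset.measurable_fun_sum _ fun k _ => hg k

theorem measurable_outFlow {X : Type*} [MeasurableSpace X] {x : X → Flow ι}
    (hx : ∀ i j l, Measurable fun a => x a i j l) (i : ι) (l : ℕ) :
    Measurable fun a => outFlow (x a) i l :=
  Finset.measurable_fun_sum _ fun j _ => hx i j l

theorem measurable_inFlow {X : Type*} [MeasurableSpace X] {x : X → Flow ι}
    (hx : ∀ i j l, Measurable fun a => x a i j l) (i : ι) (l : ℕ) :
    Measurable fun a => inFlow (x a) i l :=
  Finset.measurable_fun_sum _ fun j _ => hx j i l

theorem measurable_timeAvg {X : Type*} [MeasurableSpace X] {z : X → ℕ → ℝ}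
    (hz : ∀ t, Measurable fun a => z a t) (T : ℕ) : Measurable fun a => timeAvg (z a) T :=
  (Finset.measurable_fun_sum _ fun k _ => hz k).div_const _

theorem measurable_apply (t : ℕ) (i : ι) (l : ℕ) :
    Measurable fun a : ℕ → ι → ℕ → ℕ => (a t i l : ℝ) :=
  (measurable_of_countable (fun n : ℕ => (n : ℝ))).comp (by fun_prop)

theorem measurable_virtualQueue (hsel : N.IsArgmaxRule sel) (t : ℕ) :
    (Measurable fun a => (N.virtualQueue V γ sel a t).1) ∧
      ∀ i l, Measurable fun a => (N.virtualQueue V γ sel a t).2 i l := by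
  induction t with
  | zero => exact ⟨measurable_const, fun _ _ => measurable_const⟩
  | succ t ih =>
    have hν : ∀ i j l, Measurable fun a => N.virtualFlow V γ sel a t i j l := fun i j l =>
      measurable_maxWeightFlow ih.1 ih.2 (hsel.measurable t) i j l
    constructor
    · simp only [virtualQueue_succ_fst]
      refine measurable_const.max (ih.1.add (.sub (.const_mul ?_ _) ?_))
      · exact Finset.measurable_fun_sum _ fun i _ => Finset.measurable_fun_sum _ fun l _ =>
          measurable_apply t i l
      · exact Finset.measurable_fun_sum _ fun l _ => measurable_inFlow hν _ _
    · intro i l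
      simp only [virtualQueue_succ_snd]
      exact measurable_const.max ((ih.2 i l).add
        (((measurable_upFrom (measurable_outFlow hν i) _ _).sub
          (measurable_upFrom (measurable_inFlow hν i) _ _)).sub
          (measurable_upFrom (measurable_apply t i) _ _)))

theorem measurable_virtualFlow (hsel : N.IsArgmaxRule sel) (t : ℕ) (i j : ι) (l : ℕ) :
    Measurable fun a => N.virtualFlow V γ sel a t i j l :=
  measurable_maxWeightFlow (measurable_virtualQueue hsel t).1 (measurable_virtualQueue hsel t).2
    (hsel.measurable t) i j l

/-! ### Rate stability and cost of the virtual network -/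

section Random

variable {Ω : Type*} [MeasurableSpace Ω] {P : Measure Ω} [IsProbabilityMeasure P] {Amax : ℝ}
  {lam : ι → ℕ → ℝ} {a : ℕ → ι → ℕ → Ω → ℕ}

theorem IsArrival.measurable_path (ha : N.IsArrival P Amax lam a) : Measurable (arrivalPath a) :=
  measurable_pi_lambda _ fun t => measurable_pi_lambda _ fun i => measurable_pi_lambda _ fun l =>
    ha.measurable t i l

theorem IsArrival.ae_le (ha : N.IsArrival P Amax lam a) :
    ∀ᵐ ω ∂P, ∀ t i l, (arrivalPath a ω t i l : ℝ) ≤ Amax := by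
  simp only [ae_all_iff]
  exact ha.bounded

/-- Arrivals in slot `s ≥ t` are independent of any function of the arrivals before `t`. -/
theorem IsArrival.integral_mul (ha : N.IsArrival P Amax lam a) {t s : ℕ} (hts : t ≤ s)
    {G : (ℕ → ι → ℕ → ℕ) → ℝ} (hG : Measurable G) (hdep : DependsOn G (Set.Iio t)) (i : ι) (l : ℕ) :
    ∫ ω, G (arrivalPath a ω) * (a s i l ω : ℝ) ∂P
      = (∫ ω, G (arrivalPath a ω) ∂P) * lam i l := by
  have h1 := iIndepFun_indepFun_of_dependsOn ha.indep
    (fun t => measurable_pi_lambda _ fun i => measurable_pi_lambda _ fun l => ha.measurable t i l)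
    (S := Set.Iio t) (k := s) (by simpa using hts) hG hdep
  have h2 := h1.comp measurable_id (show Measurable fun b : ι → ℕ → ℕ => (b i l : ℝ) from
    (measurable_of_countable (fun n : ℕ => (n : ℝ))).comp (by fun_prop))
  have h3 := h2.integral_fun_mul_eq_mul_integral
    (hG.comp ha.measurable_path).aestronglyMeasurable (ha.measurable_cast s i l).aestronglyMeasurable
  rw [← ha.mean s i l]
  exact h3

/-- A bound along the almost sure paths with arrivals at most `Amax` is enough. Working in `L^∞`
keeps all products that occur integrable. -/
theorem IsArrival.memLp_of_bound (ha : N.IsArrival P Amax lam a) {G : (ℕ → ι → ℕ → ℕ) → ℝ}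
    (hG : Measurable G) {K : ℝ} (hK : ∀ b, (∀ t i l, (b t i l : ℝ) ≤ Amax) → |G b| ≤ K) :
    MemLp (fun ω => G (arrivalPath a ω)) ⊤ P := by
  refine memLp_top_of_bound (hG.comp ha.measurable_path).aestronglyMeasurable K ?_
  filter_upwards [ha.ae_le] with ω hω
  exact hK _ hω

theorem IsArrival.memLp_virtualQueue_fst (ha : N.IsArrival P Amax lam a)
    (hsel : N.IsArgmaxRule sel) (t : ℕ) :
    MemLp (fun ω => (N.virtualQueue V γ sel (arrivalPath a ω) t).1) ⊤ P :=
  ha.memLp_of_bound (measurable_virtualQueue hsel t).1 fun b hb => by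
    rw [abs_of_nonneg (virtualQueue_fst_nonneg t)]
    exact (virtualQueue_le hb t).1

theorem IsArrival.memLp_virtualQueue_snd (ha : N.IsArrival P Amax lam a)
    (hsel : N.IsArgmaxRule sel) (t : ℕ) (i : ι) {l : ℕ} (hl : 1 ≤ l) :
    MemLp (fun ω => (N.virtualQueue V γ sel (arrivalPath a ω) t).2 i l) ⊤ P :=
  ha.memLp_of_bound ((measurable_virtualQueue hsel t).2 i l) fun b hb => by
    rw [abs_of_nonneg (virtualQueue_snd_nonneg t i l)]
    exact (virtualQueue_le hb t).2 i l hl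

theorem IsArrival.memLp_virtualFlow (ha : N.IsArrival P Amax lam a)
    (hsel : N.IsArgmaxRule sel) (t : ℕ) (i j : ι) (l : ℕ) :
    MemLp (fun ω => N.virtualFlow V γ sel (arrivalPath a ω) t i j l) ⊤ P :=
  ha.memLp_of_bound (measurable_virtualFlow hsel t i j l) fun _ _ => abs_virtualFlow_le t i j l

theorem memLp_top_mul {f g : Ω → ℝ} (hf : MemLp f ⊤ P) (hg : MemLp g ⊤ P) :
    MemLp (fun ω => f ω * g ω) ⊤ P :=
  hg.mul hf

theorem IsArrival.memLp_lyapunov (ha : N.IsArrival P Amax lam a)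
    (hsel : N.IsArgmaxRule sel) (t : ℕ) :
    MemLp (fun ω => N.lyapunov (N.virtualQueue V γ sel (arrivalPath a ω) t)) ⊤ P := by
  simp only [lyapunov, sq]
  have h1 := ha.memLp_virtualQueue_fst (V := V) (γ := γ) hsel t
  refine (memLp_top_mul h1 h1).add ?_
  refine memLp_finsetSum _ fun i _ => memLp_finsetSum _ fun l hl => ?_
  have h2 := ha.memLp_virtualQueue_snd (V := V) (γ := γ) hsel t i (Finset.mem_Icc.1 hl).1
  exact memLp_top_mul h2 h2

theorem dependsOn_virtualQueue_fst (t : ℕ) :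
    DependsOn (fun b => (N.virtualQueue V γ sel b t).1) (Set.Iio t) := fun b b' h => by
  simp only [virtualQueue_congr (b := b') fun s hs => h s hs]

theorem dependsOn_virtualQueue_snd (t : ℕ) (i : ι) (l : ℕ) :
    DependsOn (fun b => (N.virtualQueue V γ sel b t).2 i l) (Set.Iio t) := fun b b' h => by
  simp only [virtualQueue_congr (b := b') fun s hs => h s hs]

/-- In the mean, the arrivals in the comparison terms may be replaced by their rates, and
feasibility of `x` then gives these terms the favourable sign. -/
theorem IsArrival.integral_lyapunov_succ_le (ha : N.IsArrival P Amax lam a)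
    (hsel : N.IsArgmaxRule sel) {x : Flow ι} (hx : N.Feasible lam γ x) (t : ℕ) :
    ∫ ω, N.lyapunov (N.virtualQueue V γ sel (arrivalPath a ω) (t + 1)) ∂P
        + 2 * (V * ∫ ω, N.cost (N.virtualFlow V γ sel (arrivalPath a ω) t) ∂P)
      ≤ ∫ ω, N.lyapunov (N.virtualQueue V γ sel (arrivalPath a ω) t) ∂P
        + (1 + Fintype.card ι * N.L) * N.stepBound γ Amax ^ 2 + 2 * (V * N.cost x) := by
  set S := fun ω => N.virtualQueue V γ sel (arrivalPath a ω) t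
  set K := (1 + Fintype.card ι * N.L) * N.stepBound γ Amax ^ 2
  have hW : ∀ t, Integrable
      (fun ω => N.lyapunov (N.virtualQueue V γ sel (arrivalPath a ω) t)) P := fun t =>
    (ha.memLp_lyapunov hsel t).integrable le_top
  have hh : Integrable (fun ω => N.cost (N.virtualFlow V γ sel (arrivalPath a ω) t)) P :=
    integrable_cost (fun i j l => (ha.memLp_virtualFlow hsel t i j l).integrable le_top) N
  have har : ∀ i l, MemLp (fun ω => upFrom N.L (fun k => (a t i k ω : ℝ)) l) ⊤ P := fun i l =>
    memLp_finsetSum _ fun k _ => ha.memLp t i k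
  have htot : MemLp (fun ω => N.totalRate (fun i l => (a t i l ω : ℝ))) ⊤ P :=
    memLp_finsetSum _ fun i _ => memLp_finsetSum _ fun k _ => ha.memLp t i k
  have hS1 := ha.memLp_virtualQueue_fst (V := V) (γ := γ) hsel t
  have hS2 : ∀ i l, 1 ≤ l → MemLp (fun ω => (S ω).2 i l) ⊤ P := fun i l hl =>
    ha.memLp_virtualQueue_snd (V := V) (γ := γ) hsel t i hl
  set c2 : ι → ℕ → ℝ := fun i l => upFrom N.L (outFlow x i) l - upFrom N.L (inFlow x i) (l + 1)
  have hR1 : MemLp (fun ω => (S ω).1 * (γ * N.totalRate (fun i l => (a t i l ω : ℝ))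
      - N.delivered x)) ⊤ P :=
    memLp_top_mul hS1 ((htot.const_mul γ).sub (memLp_const _))
  have hR2 : ∀ i l, 1 ≤ l → MemLp (fun ω => (S ω).2 i l *
      (c2 i l - upFrom N.L (fun k => (a t i k ω : ℝ)) l)) ⊤ P := fun i l hl =>
    memLp_top_mul (hS2 i l hl) ((memLp_const _).sub (har i l))
  have hR2s : ∀ i, MemLp (fun ω => ∑ l ∈ Finset.Icc 1 N.L, (S ω).2 i l *
      (c2 i l - upFrom N.L (fun k => (a t i k ω : ℝ)) l)) ⊤ P := fun i =>
    memLp_finsetSum _ fun l hl => hR2 i l (Finset.mem_Icc.1 hl).1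
  have hR2ss : MemLp (fun ω => ∑ i ∈ Finset.univ.erase N.d, ∑ l ∈ Finset.Icc 1 N.L, (S ω).2 i l *
      (c2 i l - upFrom N.L (fun k => (a t i k ω : ℝ)) l)) ⊤ P :=
    memLp_finsetSum _ fun i _ => hR2s i
  -- the comparison terms are non-positive in the mean
  have hneg1 : ∫ ω, (S ω).1 * (γ * N.totalRate (fun i l => (a t i l ω : ℝ))
      - N.delivered x) ∂P ≤ 0 := by
    have e : ∫ ω, (S ω).1 * N.totalRate (fun i l => (a t i l ω : ℝ)) ∂P
        = (∫ ω, (S ω).1 ∂P) * N.totalRate lam := by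
      simp only [totalRate, Finset.mul_sum]
      rw [integral_finsetSum _ fun i _ => by
        exact (memLp_finsetSum _ fun k _ => memLp_top_mul hS1 (ha.memLp t i k)).integrable le_top]
      refine Finset.sum_congr rfl fun i _ => ?_
      rw [integral_finsetSum _ fun k _ => by
        exact (memLp_top_mul hS1 (ha.memLp t i k)).integrable le_top]
      exact Finset.sum_congr rfl fun k _ => ha.integral_mul le_rfl
        (measurable_virtualQueue hsel t).1 (dependsOn_virtualQueue_fst t) i k
    have e2 : ∀ ω, (S ω).1 * (γ * N.totalRate (fun i l => (a t i l ω : ℝ)) - N.delivered x)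
        = γ * ((S ω).1 * N.totalRate (fun i l => (a t i l ω : ℝ))) - (S ω).1 * N.delivered x :=
      fun ω => by ring
    simp only [e2]
    rw [integral_sub (((memLp_top_mul hS1 htot).const_mul γ).integrable le_top)
      ((hS1.integrable le_top).mul_const _), integral_const_mul, e, integral_mul_const]
    have h0 : 0 ≤ ∫ ω, (S ω).1 ∂P := integral_nonneg fun ω => virtualQueue_fst_nonneg t
    nlinarith [mul_le_mul_of_nonneg_left hx.reliability h0]
  have hneg2 : ∀ i, i ≠ N.d → ∀ l, 1 ≤ l → l ≤ N.L → ∫ ω, (S ω).2 i l *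
      (c2 i l - upFrom N.L (fun k => (a t i k ω : ℝ)) l) ∂P ≤ 0 := by
    intro i hi l hl hlL
    have e : ∫ ω, (S ω).2 i l * upFrom N.L (fun k => (a t i k ω : ℝ)) l ∂P
        = (∫ ω, (S ω).2 i l ∂P) * upFrom N.L (lam i) l := by
      simp only [upFrom, Finset.mul_sum]
      rw [integral_finsetSum _ fun k _ => by
        exact (memLp_top_mul (hS2 i l hl) (ha.memLp t i k)).integrable le_top]
      exact Finset.sum_congr rfl fun k _ => ha.integral_mul le_rfl
        ((measurable_virtualQueue hsel t).2 i l) (dependsOn_virtualQueue_snd t i l) i k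
    simp only [mul_sub]
    rw [integral_sub (((hS2 i l hl).integrable le_top).mul_const _)
      ((memLp_top_mul (hS2 i l hl) (har i l)).integrable le_top), e, integral_mul_const]
    have h0 : 0 ≤ ∫ ω, (S ω).2 i l ∂P := integral_nonneg fun ω => virtualQueue_snd_nonneg t i l
    have h1 := hx.conservation i hi l hl hlL
    have h2 : c2 i l ≤ upFrom N.L (lam i) l := by simp only [c2]; linarith
    nlinarith [mul_le_mul_of_nonneg_left h2 h0]
  have hneg3 : ∫ ω, ∑ i ∈ Finset.univ.erase N.d, ∑ l ∈ Finset.Icc 1 N.L, (S ω).2 i l *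
      (c2 i l - upFrom N.L (fun k => (a t i k ω : ℝ)) l) ∂P ≤ 0 := by
    rw [integral_finsetSum _ fun i _ => (hR2s i).integrable le_top]
    refine Finset.sum_nonpos fun i hi => ?_
    rw [integral_finsetSum _ fun l hl =>
      (hR2 i l (Finset.mem_Icc.1 hl).1).integrable le_top]
    exact Finset.sum_nonpos fun l hl => hneg2 i (Finset.ne_of_mem_erase hi) l
      (Finset.mem_Icc.1 hl).1 (Finset.mem_Icc.1 hl).2
  have hmain := integral_mono_ae
    (f := fun ω => N.lyapunov (N.virtualQueue V γ sel (arrivalPath a ω) (t + 1))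
      + 2 * (V * N.cost (N.virtualFlow V γ sel (arrivalPath a ω) t)))
    (g := fun ω => N.lyapunov (S ω) + K + 2 * (V * N.cost x
      + (S ω).1 * (γ * N.totalRate (fun i l => (a t i l ω : ℝ)) - N.delivered x)
      + ∑ i ∈ Finset.univ.erase N.d, ∑ l ∈ Finset.Icc 1 N.L, (S ω).2 i l *
      (c2 i l - upFrom N.L (fun k => (a t i k ω : ℝ)) l))) (μ := P)
    ((hW _).add ((hh.const_mul V).const_mul 2))
    (((hW t).add (integrable_const K)).add
      ((((integrable_const _).add (hR1.integrable le_top)).add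
        (hR2ss.integrable le_top)).const_mul 2)) (by
    filter_upwards [ha.ae_le] with ω hω
    exact lyapunov_succ_le hsel t (hω t) hx)
  rw [integral_add (hW _) ((hh.const_mul V).const_mul 2), integral_const_mul 2, integral_const_mul V,
    integral_add (by exact (hW t).add (integrable_const K)) (by
      exact ((((integrable_const _).add (hR1.integrable le_top)).add
        (hR2ss.integrable le_top)).const_mul 2)), integral_add (hW t) (integrable_const K),
    integral_const_mul 2, integral_add (by exact (integrable_const _).add (hR1.integrable le_top))
      (hR2ss.integrable le_top), integral_add (integrable_const _) (hR1.integrable le_top)] at hmain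
  simp only [integral_const, probReal_univ, one_smul] at hmain
  linarith

end Random

end Network

/-! ### Empirical averages of the virtual network and decay of the virtual queues -/

namespace Network

variable {N : Network ι} {V γ : ℝ} {sel : ℕ → ι → ι → (ℕ → ℝ) → ℕ}

theorem exists_abs_cost_le (N : Network ι) (K : ℝ) :
    ∃ H, ∀ x : Flow ι, (∀ i j l, |x i j l| ≤ K) → |N.cost x| ≤ H := by
  refine ⟨∑ p ∈ N.E, |N.e p.1 p.2| * (N.L * K), fun x hx => ?_⟩
  refine (Finset.abs_sum_le_sum_abs _ _).trans (Finset.sum_le_sum fun p _ => ?_)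
  rw [abs_mul]
  exact mul_le_mul_of_nonneg_left (abs_upFrom_le le_rfl fun k => hx p.1 p.2 k) (abs_nonneg _)

section Path

variable {b : ℕ → ι → ℕ → ℕ}

/-- The empirical averages of the virtual flows. -/
noncomputable def virtualAvg (N : Network ι) (V γ : ℝ) (sel : ℕ → ι → ι → (ℕ → ℝ) → ℕ)
    (b : ℕ → ι → ℕ → ℕ) (t : ℕ) : Flow ι :=
  flowAvg (N.virtualFlow V γ sel b) t

/-- The empirical arrival rates. -/
noncomputable def arrivalAvg (b : ℕ → ι → ℕ → ℕ) (t : ℕ) (i : ι) (l : ℕ) : ℝ :=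
  timeAvg (fun τ => (b τ i l : ℝ)) t

theorem virtualAvg_nonneg (t : ℕ) (i j : ι) (l : ℕ) : 0 ≤ N.virtualAvg V γ sel b t i j l :=
  timeAvg_nonneg (fun τ => virtualFlow_nonneg τ i j l) t

theorem abs_virtualAvg_le (t : ℕ) (i j : ι) (l : ℕ) :
    |N.virtualAvg V γ sel b t i j l| ≤ N.capSum :=
  abs_timeAvg_le (fun τ => abs_virtualFlow_le τ i j l) t

theorem virtualAvg_dest (t : ℕ) (j : ι) (l : ℕ) : N.virtualAvg V γ sel b t N.d j l = 0 := by
  simp [virtualAvg, flowAvg, virtualFlow_dest, timeAvg]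

theorem IsArgmaxRule.isFlow_virtualAvg (hsel : N.IsArgmaxRule sel) (t : ℕ) :
    N.IsFlow (N.virtualAvg V γ sel b t) := fun i j l h => by
  simp [virtualAvg, flowAvg, hsel.isFlow_virtualFlow _ i j l h, timeAvg]

theorem IsArgmaxRule.linkFlow_virtualAvg_le (hsel : N.IsArgmaxRule sel) (t : ℕ) (i j : ι) :
    N.linkFlow (N.virtualAvg V γ sel b t) i j ≤ N.C i j := by
  rw [virtualAvg, linkFlow_flowAvg]
  exact timeAvg_le_of_le (N.C_nonneg i j)
    (fun τ => linkFlow_maxWeightFlow_le (hsel.mem τ) i j) t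

/-- Truncation at zero only increases a virtual queue, so the queue dominates the accumulated
imbalance; division by `t` gives the violation by the averages. -/
theorem balance_virtualAvg_le (t : ℕ) (i : ι) (l : ℕ) :
    upFrom N.L (outFlow (N.virtualAvg V γ sel b t) i) l
      - upFrom N.L (inFlow (N.virtualAvg V γ sel b t) i) (l + 1) - upFrom N.L (arrivalAvg b t i) l
      ≤ (N.virtualQueue V γ sel b t).2 i l / t := by
  have h : ∀ t, ∑ τ ∈ Finset.range t, (upFrom N.L (outFlow (N.virtualFlow V γ sel b τ) i) l
      - upFrom N.L (inFlow (N.virtualFlow V γ sel b τ) i) (l + 1)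
      - upFrom N.L (fun k => (b τ i k : ℝ)) l) ≤ (N.virtualQueue V γ sel b t).2 i l := by
    intro t
    induction t with
    | zero => simp [virtualQueue]
    | succ t ih =>
      rw [Finset.sum_range_succ, virtualQueue_succ_snd]
      exact (add_le_add_left ih _).trans (le_max_right _ _)
  have e : upFrom N.L (arrivalAvg b t i) l
      = timeAvg (fun τ => upFrom N.L (fun k => (b τ i k : ℝ)) l) t :=
    upFrom_timeAvg N.L (fun τ k => (b τ i k : ℝ)) l t
  rw [virtualAvg, upFrom_outFlow_flowAvg, upFrom_inFlow_flowAvg, e, ← timeAvg_sub, ← timeAvg_sub]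
  exact div_le_div_of_nonneg_right (h t) (Nat.cast_nonneg t)

theorem sub_delivered_virtualAvg_le (t : ℕ) :
    γ * N.totalRate (arrivalAvg b t) - N.delivered (N.virtualAvg V γ sel b t)
      ≤ (N.virtualQueue V γ sel b t).1 / t := by
  have h : ∀ t, ∑ τ ∈ Finset.range t, (γ * N.totalRate (fun i l => (b τ i l : ℝ))
      - N.delivered (N.virtualFlow V γ sel b τ)) ≤ (N.virtualQueue V γ sel b t).1 := by
    intro t
    induction t with
    | zero => simp [virtualQueue]
    | succ t ih =>
      rw [Finset.sum_range_succ, virtualQueue_succ_fst]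
      exact (add_le_add_left ih _).trans (le_max_right _ _)
  have e : N.totalRate (arrivalAvg b t)
      = timeAvg (fun τ => N.totalRate (fun i l => (b τ i l : ℝ))) t :=
    totalRate_timeAvg (fun τ i l => (b τ i l : ℝ)) t
  rw [virtualAvg, delivered_flowAvg, e, ← timeAvg_const_mul, ← timeAvg_sub]
  exact div_le_div_of_nonneg_right (h t) (Nat.cast_nonneg t)

end Path

section Random

variable {Ω : Type*} [MeasurableSpace Ω] {P : Measure Ω} [IsProbabilityMeasure P] {Amax : ℝ}
  {lam : ι → ℕ → ℝ} {a : ℕ → ι → ℕ → Ω → ℕ}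

theorem IsArrival.integrable_virtualFlow (ha : N.IsArrival P Amax lam a)
    (hsel : N.IsArgmaxRule sel) (t : ℕ) (i j : ι) (l : ℕ) :
    Integrable (fun ω => N.virtualFlow V γ sel (arrivalPath a ω) t i j l) P :=
  (ha.memLp_virtualFlow hsel t i j l).integrable le_top

theorem lyapunov_nonneg (S : ℝ × (ι → ℕ → ℝ)) : 0 ≤ N.lyapunov S :=
  add_nonneg (sq_nonneg _) (Finset.sum_nonneg fun _ _ => Finset.sum_nonneg fun _ _ => sq_nonneg _)

theorem IsArrival.integral_lyapunov_add_le (ha : N.IsArrival P Amax lam a)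
    (hsel : N.IsArgmaxRule sel) {x : Flow ι} (hx : N.Feasible lam γ x) (T : ℕ) :
    ∫ ω, N.lyapunov (N.virtualQueue V γ sel (arrivalPath a ω) T) ∂P
        + 2 * (V * ∑ t ∈ Finset.range T, ∫ ω, N.cost (N.virtualFlow V γ sel (arrivalPath a ω) t) ∂P)
      ≤ T * ((1 + Fintype.card ι * N.L) * N.stepBound γ Amax ^ 2 + 2 * (V * N.cost x)) := by
  induction T with
  | zero => simp [virtualQueue, lyapunov]
  | succ T ih =>
    rw [Finset.sum_range_succ]
    have := ha.integral_lyapunov_succ_le (V := V) hsel hx T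
    push_cast
    linarith

/-- The virtual network is within `B / V` of the cost of every feasible flow. -/
theorem IsArrival.timeAvg_cost_virtualFlow_le (ha : N.IsArrival P Amax lam a)
    (hsel : N.IsArgmaxRule sel) {x : Flow ι} (hx : N.Feasible lam γ x) (hV : 0 < V) {T : ℕ}
    (hT : 0 < T) :
    timeAvg (fun t => ∫ ω, N.cost (N.virtualFlow V γ sel (arrivalPath a ω) t) ∂P) T
      ≤ N.cost x + (1 + Fintype.card ι * N.L) * N.stepBound γ Amax ^ 2 / 2 / V := by
  have h1 := ha.integral_lyapunov_add_le (V := V) hsel hx T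
  have h2 : 0 ≤ ∫ ω, N.lyapunov (N.virtualQueue V γ sel (arrivalPath a ω) T) ∂P :=
    integral_nonneg fun ω => lyapunov_nonneg _
  rw [← mul_timeAvg] at h1
  set z := timeAvg (fun t => ∫ ω, N.cost (N.virtualFlow V γ sel (arrivalPath a ω) t) ∂P) T
  set K := (1 + Fintype.card ι * N.L) * N.stepBound γ Amax ^ 2
  have h3 : (T : ℝ) * (2 * (V * z)) ≤ T * (K + 2 * (V * N.cost x)) := by linarith
  have h4 := le_of_mul_le_mul_left h3 (by positivity)
  rw [← sub_le_iff_le_add', le_div_iff₀ hV]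
  linarith

theorem sq_integral_le {f : Ω → ℝ} (hf : MemLp f ⊤ P) : (∫ ω, f ω ∂P) ^ 2 ≤ ∫ ω, f ω ^ 2 ∂P := by
  have h := variance_nonneg f P
  rw [variance_eq_sub (hf.mono_exponent le_top)] at h
  simpa using h

/-- The virtual queues are rate stable in the mean. -/
theorem IsArrival.exists_tendsto_virtualQueue (ha : N.IsArrival P Amax lam a)
    (hsel : N.IsArgmaxRule sel) (hV : 0 ≤ V) {x : Flow ι} (hx : N.Feasible lam γ x) :
    ∃ ε : ℕ → ℝ, Tendsto ε atTop (𝓝 0) ∧ ∀ T,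
      ∫ ω, (N.virtualQueue V γ sel (arrivalPath a ω) T).1 / T ∂P ≤ ε T ∧
      ∀ i, i ≠ N.d → ∀ l, 1 ≤ l → l ≤ N.L →
        ∫ ω, (N.virtualQueue V γ sel (arrivalPath a ω) T).2 i l / T ∂P ≤ ε T := by
  obtain ⟨H, hH⟩ := N.exists_abs_cost_le N.capSum
  set K := (1 + Fintype.card ι * N.L) * N.stepBound γ Amax ^ 2 + 2 * (V * N.cost x) + 2 * (V * H)
  -- Costs may be negative, but those of virtual flows are at least `-H`; moving them to the right
  -- leaves second moments linear in `T`.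
  have hW : ∀ T : ℕ, ∫ ω, N.lyapunov (N.virtualQueue V γ sel (arrivalPath a ω) T) ∂P ≤ T * K := by
    intro T
    have h1 := ha.integral_lyapunov_add_le (V := V) hsel hx T
    have h2 : - (T * H) ≤ ∑ t ∈ Finset.range T,
        ∫ ω, N.cost (N.virtualFlow V γ sel (arrivalPath a ω) t) ∂P := by
      have : ∑ t ∈ Finset.range T, (-H) ≤ ∑ t ∈ Finset.range T,
          ∫ ω, N.cost (N.virtualFlow V γ sel (arrivalPath a ω) t) ∂P := by
        refine Finset.sum_le_sum fun t _ => ?_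
        have h3 : ∫ _ : Ω, (-H) ∂P ≤ ∫ ω, N.cost (N.virtualFlow V γ sel (arrivalPath a ω) t) ∂P :=
          integral_mono (integrable_const _)
            (integrable_cost (fun i j l => ha.integrable_virtualFlow hsel t i j l) N)
            fun ω => (abs_le.1 (hH _ fun i j l => abs_virtualFlow_le t i j l)).1
        simpa using h3
      simpa using this
    have h4 := mul_le_mul_of_nonneg_left h2 hV
    have h5 : T * K = T * ((1 + Fintype.card ι * N.L) * N.stepBound γ Amax ^ 2
      + 2 * (V * N.cost x)) + 2 * (V * (T * H)) := by ring
    linarith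
  -- A second moment of at most `T * K` bounds the mean by `√(T K)`, hence the mean divided by `T`
  -- by `√(K / T)`.
  have key : ∀ (T : ℕ) (f : Ω → ℝ), MemLp f ⊤ P →
      (∀ ω, f ω ^ 2 ≤ N.lyapunov (N.virtualQueue V γ sel (arrivalPath a ω) T)) →
      ∫ ω, f ω / T ∂P ≤ √(K / T) := by
    intro T f hf hfW
    rcases Nat.eq_zero_or_pos T with rfl | hT
    · simp
    have h1 : ∫ ω, f ω ^ 2 ∂P ≤ T * K :=
      (integral_mono (by simpa only [sq] using (memLp_top_mul hf hf).integrable le_top)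
        ((ha.memLp_lyapunov hsel T).integrable le_top) hfW).trans (hW T)
    have h2 := (sq_integral_le hf).trans h1
    rw [integral_div]
    refine Real.le_sqrt_of_sq_le ?_
    have hT' : (0 : ℝ) < T := by exact_mod_cast hT
    rw [div_pow, div_le_div_iff₀ (by positivity) hT']
    nlinarith
  refine ⟨fun T => √(K / T), ?_, fun T => ⟨?_, fun i hi l hl hlL => ?_⟩⟩
  · simpa using (tendsto_const_div_atTop_nhds_zero_nat K).sqrt
  · refine key T _ (ha.memLp_virtualQueue_fst hsel T) fun ω => ?_
    exact le_add_of_nonneg_right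
      (Finset.sum_nonneg fun _ _ => Finset.sum_nonneg fun _ _ => sq_nonneg _)
  · refine key T _ (ha.memLp_virtualQueue_snd hsel T i hl) fun ω => ?_
    refine le_add_of_nonneg_of_le (sq_nonneg _) ?_
    refine le_trans ?_ (Finset.single_le_sum (f := fun i => ∑ l ∈ Finset.Icc 1 N.L,
      (N.virtualQueue V γ sel (arrivalPath a ω) T).2 i l ^ 2)
      (fun _ _ => Finset.sum_nonneg fun _ _ => sq_nonneg _)
      (Finset.mem_erase.2 ⟨hi, Finset.mem_univ i⟩))
    exact Finset.single_le_sum (f := fun l =>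
      (N.virtualQueue V γ sel (arrivalPath a ω) T).2 i l ^ 2) (fun _ _ => sq_nonneg _)
      (Finset.mem_Icc.2 ⟨hl, hlL⟩)

/-- The empirical arrival rates converge in the mean. -/
theorem IsArrival.tendsto_integral_abs_arrivalAvg_sub (ha : N.IsArrival P Amax lam a) (i : ι)
    (l : ℕ) :
    Tendsto (fun t => ∫ ω, |arrivalAvg (arrivalPath a ω) t i l - lam i l| ∂P) atTop (𝓝 0) := by
  have hev : Measurable fun b : ι → ℕ → ℕ => (b i l : ℝ) :=
    (measurable_of_countable (fun n : ℕ => (n : ℝ))).comp (by fun_prop)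
  have h := strong_law_Lp (μ := P) (p := 1) le_rfl ENNReal.one_ne_top
    (fun t ω => (a t i l ω : ℝ)) ((ha.memLp 0 i l).mono_exponent le_top)
    (fun s t hst => (ha.indep.indepFun hst).comp hev hev)
    (fun t => (ha.identDistrib t).comp hev)
  have h2 := (ENNReal.tendsto_toReal ENNReal.zero_ne_top).comp h
  refine h2.congr fun t => ?_
  have hm : AEStronglyMeasurable (fun ω => arrivalAvg (arrivalPath a ω) t i l - lam i l) P :=
    ((measurable_timeAvg (fun τ => ha.measurable_cast τ i l) t).sub_const _).aestronglyMeasurable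
  have e : (fun ω => (t : ℝ)⁻¹ • (∑ i_1 ∈ Finset.range t, (a i_1 i l ω : ℝ))
      - ∫ ω, (a 0 i l ω : ℝ) ∂P) = fun ω => arrivalAvg (arrivalPath a ω) t i l - lam i l := by
    funext ω
    rw [ha.mean, arrivalAvg, timeAvg_eq_cesaro]
    rfl
  simp only [Function.comp]
  rw [e, eLpNorm_one_eq_lintegral_enorm, ← integral_norm_eq_lintegral_enorm hm]
  rfl

end Random

end Network

/-! ### Routing packets by uniform marks -/

theorem sum_filter_le_eq (p : ι → ℝ) (j : ι) :
    ∑ k ∈ Finset.univ.filter (· ≤ j), p k = p j + ∑ k ∈ Finset.univ.filter (· < j), p k := by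
  rw [← Finset.sum_insert (by simp)]
  refine Finset.sum_congr ?_ fun _ _ => rfl
  ext k
  simp [le_iff_eq_or_lt]

/-- The intervals of marks belonging to different next hops are disjoint. -/
theorem SendsTo.unique {p : ι → ℝ} (hp : ∀ j, 0 ≤ p j) {r : ℝ} {j j' : ι} (h : SendsTo p r j)
    (h' : SendsTo p r j') : j = j' := by
  have key : ∀ {j j' : ι}, SendsTo p r j → SendsTo p r j' → ¬ j < j' := by
    intro j j' h h' hlt
    have : ∑ k ∈ Finset.univ.filter (· ≤ j), p k ≤ ∑ k ∈ Finset.univ.filter (· < j'), p k := by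
      refine Finset.sum_le_sum_of_subset_of_nonneg (fun k hk => ?_) fun k _ _ => hp k
      simp only [Finset.mem_filter, Finset.mem_univ, true_and] at hk ⊢
      exact hk.trans_lt hlt
    linarith [h.2, h'.1]
  exact le_antisymm (not_lt.1 (key h' h)) (not_lt.1 (key h h'))

theorem not_sendsTo_of_eq_zero {p : ι → ℝ} {j : ι} (hp : p j = 0) (r : ℝ) : ¬ SendsTo p r j := by
  rintro ⟨h1, h2⟩
  rw [sum_filter_le_eq, hp] at h2
  linarith

theorem measurableSet_sendsTo {X : Type*} [MeasurableSpace X] {p : X → ι → ℝ} {r : X → ℝ}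
    (hp : ∀ j, Measurable fun z => p z j) (hr : Measurable r) (j : ι) :
    MeasurableSet {z | SendsTo (p z) (r z) j} :=
  (measurableSet_le (Finset.measurable_fun_sum _ fun k _ => hp k) hr).inter
    (measurableSet_lt hr (Finset.measurable_fun_sum _ fun k _ => hp k))

-- The marks that select `j` form an interval of length `p j`, and it lies in `[0, 1]` because the
-- probabilities sum to at most one.
open Classical in
theorem integral_sendsTo {Ω : Type*} [MeasurableSpace Ω] {P : Measure Ω} {r : Ω → ℝ}
    (hr : Measurable r) (hu : P.map r = (volume : Measure ℝ).restrict (Set.Icc 0 1)) {p : ι → ℝ}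
    (hp : ∀ j, 0 ≤ p j) (hsum : ∑ j, p j ≤ 1) (j : ι) :
    ∫ ω, (if SendsTo p (r ω) j then (1 : ℝ) else 0) ∂P = p j := by
  set lo := ∑ k ∈ Finset.univ.filter (· < j), p k with hlo
  have hhi : ∑ k ∈ Finset.univ.filter (· ≤ j), p k = p j + lo := sum_filter_le_eq p j
  have hlo0 : 0 ≤ lo := Finset.sum_nonneg fun k _ => hp k
  have hhi1 : p j + lo ≤ 1 := by
    rw [← hhi]
    exact (Finset.sum_le_sum_of_subset_of_nonneg (Finset.subset_univ _) fun k _ _ => hp k).trans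
      hsum
  have e : (fun ω => if SendsTo p (r ω) j then (1 : ℝ) else 0)
      = (r ⁻¹' Set.Ico lo (p j + lo)).indicator 1 := by
    funext ω
    by_cases h : SendsTo p (r ω) j
    · rw [if_pos h, Set.indicator_of_mem (by rw [← hhi]; exact h)]
      rfl
    · rw [if_neg h, Set.indicator_of_notMem (by rw [← hhi]; exact h)]
  rw [e, integral_indicator_one (hr measurableSet_Ico), Measure.real,
    ← Measure.map_apply hr measurableSet_Ico, hu, Measure.restrict_apply measurableSet_Ico,
    Set.inter_eq_left.2, Real.volume_Ico, add_sub_cancel_right, ENNReal.toReal_ofReal (hp j)]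
  exact fun y hy => ⟨hlo0.trans hy.1, hy.2.le.trans hhi1⟩

section Routed

variable {p : ι → ℕ → ι → ℝ} {Q : ι → ℕ → ℝ} {r : ι → ℕ → ℕ → ℝ}

theorem routedFlow_nonneg (i j : ι) (l : ℕ) : 0 ≤ routedFlow p Q r i j l := Nat.cast_nonneg _

theorem routedFlow_eq_zero {i j : ι} {l : ℕ} (hp : p i l j = 0) : routedFlow p Q r i j l = 0 := by
  simp [routedFlow, not_sendsTo_of_eq_zero hp]

/-- Each packet has at most one next hop. The count is kept as a natural number so that backlogs
stay integers. -/
theorem exists_outFlow_routedFlow_eq (hp : ∀ i l j, 0 ≤ p i l j) (i : ι) (l : ℕ) :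
    ∃ m : ℕ, outFlow (routedFlow p Q r) i l = m ∧ m ≤ ⌊Q i l⌋₊ := by
  classical
  refine ⟨_, (Nat.cast_sum _ _).symm, ?_⟩
  rw [← Finset.card_biUnion]
  · refine (Finset.card_le_card (t := Finset.range ⌊Q i l⌋₊) ?_).trans (by simp)
    refine Finset.biUnion_subset.2 fun j _ => Finset.filter_subset _ _
  · intro j _ j' _ hne
    refine Finset.disjoint_left.2 fun k hk hk' => hne ?_
    exact (Finset.mem_filter.1 hk).2.unique (hp i l) (Finset.mem_filter.1 hk').2

-- With a fixed range of packet indices, each summand separates the backlog from the mark of one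
-- packet, the form in which independence can be used.
open Classical in
theorem routedFlow_eq_sum {M : ℕ} {i : ι} {l : ℕ} (hM : ⌊Q i l⌋₊ ≤ M) (j : ι) :
    routedFlow p Q r i j l = ∑ k ∈ Finset.range M, (if k < ⌊Q i l⌋₊ then (1 : ℝ) else 0)
      * (if SendsTo (p i l) (r i l k) j then 1 else 0) := by
  have e : Finset.range ⌊Q i l⌋₊ = (Finset.range M).filter (· < ⌊Q i l⌋₊) := by
    ext k
    simp only [Finset.mem_range, Finset.mem_filter]
    omega
  simp only [ite_mul, one_mul, zero_mul, routedFlow, Finset.card_filter]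
  rw [← Finset.sum_filter (· < ⌊Q i l⌋₊), ← e]
  push_cast
  rfl

end Routed

theorem measurable_routedFlow {X : Type*} [MeasurableSpace X] {p : X → ι → ℕ → ι → ℝ}
    {Q : X → ι → ℕ → ℝ} {r : X → ι → ℕ → ℕ → ℝ} (hp : ∀ i l j, Measurable fun z => p z i l j)
    (hQ : ∀ i l, Measurable fun z => Q z i l) (hr : ∀ i l k, Measurable fun z => r z i l k)
    (i j : ι) (l : ℕ) : Measurable fun z => routedFlow (p z) (Q z) (r z) i j l := by
  classical
  have h : Measurable fun y : ℕ × X => (((Finset.range y.1).filter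
      (fun k => SendsTo (p y.2 i l) (r y.2 i l k) j)).card : ℝ) := by
    refine measurable_from_prod_countable_right fun n => ?_
    simp only [Finset.card_filter]
    push_cast
    refine Finset.measurable_fun_sum _ fun k _ => ?_
    exact Measurable.ite (measurableSet_sendsTo (hp i l) (hr i l k) j) measurable_const
      measurable_const
  convert h.comp ((hQ i l).nat_floor.prodMk measurable_id) using 2
  simp only [Function.comp, routedFlow, id]

namespace Network

variable {N : Network ι}

/-! ### Forwarding probabilities -/

/-- The amount of lifetime-`l` packets that a flow `x` makes available at a node, if outdated
packets are dropped. -/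
noncomputable def available (N : Network ι) (x : Flow ι) (lam : ι → ℕ → ℝ) (i : ι) (l : ℕ) : ℝ :=
  upFrom N.L (inFlow x i) (l + 1) + upFrom N.L (lam i) l - upFrom N.L (outFlow x i) (l + 1)

section Forward

variable {x : Flow ι} {lam : ι → ℕ → ℝ}

theorem forwardProb_eq (i : ι) (l : ℕ) (j : ι) : N.forwardProb x lam i l j
    = x i j l / max (N.available x lam i l) (outFlow x i l) := rfl

variable (hx : ∀ i j l, 0 ≤ x i j l)
include hx

theorem outFlow_nonneg (i : ι) (l : ℕ) : 0 ≤ outFlow x i l :=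
  Finset.sum_nonneg fun j _ => hx i j l

theorem le_outFlow (i j : ι) (l : ℕ) : x i j l ≤ outFlow x i l :=
  Finset.single_le_sum (f := fun j => x i j l) (fun j _ => hx i j l) (Finset.mem_univ j)

theorem forwardProb_nonneg (i : ι) (l : ℕ) (j : ι) : 0 ≤ N.forwardProb x lam i l j :=
  div_nonneg (hx i j l) (le_max_of_le_right (outFlow_nonneg hx i l))

theorem sum_forwardProb_le_one (i : ι) (l : ℕ) : ∑ j, N.forwardProb x lam i l j ≤ 1 := by
  simp only [forwardProb_eq, ← Finset.sum_div]
  exact div_le_one_of_le₀ (le_max_right _ _) (le_max_of_le_right (outFlow_nonneg hx i l))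

theorem forwardProb_le_one (i : ι) (l : ℕ) (j : ι) : N.forwardProb x lam i l j ≤ 1 :=
  (Finset.single_le_sum (fun j _ => forwardProb_nonneg hx i l j) (Finset.mem_univ j)).trans
    (sum_forwardProb_le_one hx i l)

/-- The convention `0 / 0 = 0` is harmless: a vanishing denominator forces `x i j l = 0`. -/
theorem forwardProb_mul_max (i : ι) (l : ℕ) (j : ι) :
    N.forwardProb x lam i l j * max (N.available x lam i l) (outFlow x i l) = x i j l := by
  rw [forwardProb_eq]
  rcases eq_or_ne (max (N.available x lam i l) (outFlow x i l)) 0 with h | h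
  · have h1 : x i j l ≤ 0 := (le_outFlow hx i j l).trans ((le_max_right _ _).trans h.le)
    rw [h, mul_zero]
    exact (le_antisymm h1 (hx i j l)).symm
  · exact div_mul_cancel₀ _ h

/-- The fluid forwarded from the available amount differs from `x` by the overload at most. -/
theorem abs_forwardProb_mul_available_sub_le (i : ι) (l : ℕ) (j : ι) :
    |N.forwardProb x lam i l j * N.available x lam i l - x i j l|
      ≤ max 0 (outFlow x i l - N.available x lam i l) := by
  have h0 := forwardProb_nonneg (N := N) (lam := lam) hx i l j
  have h1 := forwardProb_le_one (N := N) (lam := lam) hx i l j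
  have h2 := forwardProb_mul_max (N := N) (lam := lam) hx i l j
  rcases le_total (N.available x lam i l) (outFlow x i l) with h | h
  · rw [max_eq_right h] at h2
    rw [← h2, ← mul_sub, abs_mul, abs_of_nonneg h0, abs_sub_comm, abs_of_nonneg (sub_nonneg.2 h),
      max_eq_right (sub_nonneg.2 h)]
    exact mul_le_of_le_one_left (sub_nonneg.2 h) h1
  · rw [max_eq_left h] at h2
    rw [h2, sub_self, abs_zero]
    exact le_max_left _ _

/-- Sensitivity of the forwarding probabilities. -/
theorem abs_forwardProb_sub_le {x' : Flow ι} (hx' : ∀ i j l, 0 ≤ x' i j l) {lam' : ι → ℕ → ℝ}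
    {i j : ι} {l : ℕ} {δ : ℝ} (hδ : 0 < δ)
    (h : |x' i j l - x i j l| + |N.available x' lam' i l - N.available x lam i l|
      + |outFlow x' i l - outFlow x i l| ≤ δ) :
    |N.forwardProb x' lam' i l j - N.forwardProb x lam i l j|
      ≤ δ / max (max (N.available x lam i l) (outFlow x i l)) δ := by
  have h0 := forwardProb_nonneg (N := N) (lam := lam) hx i l j
  have h1 := forwardProb_le_one (N := N) (lam := lam) hx i l j
  have h0' := forwardProb_nonneg (N := N) (lam := lam') hx' i l j
  have h1' := forwardProb_le_one (N := N) (lam := lam') hx' i l j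
  have h2 := forwardProb_mul_max (N := N) (lam := lam) hx i l j
  have h2' := forwardProb_mul_max (N := N) (lam := lam') hx' i l j
  have hm0 : 0 ≤ max (N.available x lam i l) (outFlow x i l) :=
    le_max_of_le_right (outFlow_nonneg hx i l)
  have hmm : |max (N.available x lam i l) (outFlow x i l)
      - max (N.available x' lam' i l) (outFlow x' i l)|
      ≤ |N.available x' lam' i l - N.available x lam i l| + |outFlow x' i l - outFlow x i l| := by
    refine (abs_max_sub_max_le_max _ _ _ _).trans ?_
    rw [abs_sub_comm (N.available x lam i l), abs_sub_comm (outFlow x i l)]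
    exact max_le_add_of_nonneg (abs_nonneg _) (abs_nonneg _)
  set m := max (N.available x lam i l) (outFlow x i l)
  set m' := max (N.available x' lam' i l) (outFlow x' i l)
  set p := N.forwardProb x lam i l j
  set p' := N.forwardProb x' lam' i l j
  have hd : |p' - p| ≤ 1 := abs_le.2 ⟨by linarith, by linarith⟩
  have hmul : |p' - p| * m ≤ δ := by
    rw [← abs_of_nonneg hm0, ← abs_mul]
    -- This uses `p * m = x i j l` and `p' * m' = x' i j l`. For `m` below `δ` the trivial bound one
    -- takes over, hence the maximum with `δ` in the denominator.
    have e : (p' - p) * m = p' * (m - m') + (x' i j l - x i j l) := by linarith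
    rw [e]
    refine (abs_add_le _ _).trans ?_
    rw [abs_mul, abs_of_nonneg h0']
    have := mul_le_of_le_one_left (abs_nonneg (m - m')) h1'
    linarith
  rw [le_div_iff₀ (lt_max_of_lt_right hδ)]
  rcases le_total m δ with hmδ | hmδ
  · rw [max_eq_right hmδ]
    exact mul_le_of_le_one_left hδ.le hd
  · rwa [max_eq_left hmδ]

end Forward

/-! ### Queues under the flow-matching policy -/

section Matching

variable {V γ : ℝ} {sel : ℕ → ι → ι → (ℕ → ℝ) → ℕ} {b : ℕ → ι → ℕ → ℕ}
  {ρ : ℕ → ι → ℕ → ℕ → ℝ}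

theorem empiricalProb_eq (t : ℕ) (i : ι) (l : ℕ) (j : ι) : N.empiricalProb V γ sel b t i l j
    = N.forwardProb (N.virtualAvg V γ sel b t) (arrivalAvg b t) i l j := rfl

theorem empiricalProb_nonneg (t : ℕ) (i : ι) (l : ℕ) (j : ι) :
    0 ≤ N.empiricalProb V γ sel b t i l j :=
  forwardProb_nonneg (virtualAvg_nonneg t) i l j

theorem empiricalProb_le_one (t : ℕ) (i : ι) (l : ℕ) (j : ι) :
    N.empiricalProb V γ sel b t i l j ≤ 1 :=
  forwardProb_le_one (virtualAvg_nonneg t) i l j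

theorem sum_empiricalProb_le_one (t : ℕ) (i : ι) (l : ℕ) :
    ∑ j, N.empiricalProb V γ sel b t i l j ≤ 1 :=
  sum_forwardProb_le_one (virtualAvg_nonneg t) i l

theorem matchingFlow_nonneg (t : ℕ) (i j : ι) (l : ℕ) :
    0 ≤ N.matchingFlow V γ sel b ρ t i j l :=
  routedFlow_nonneg i j l

theorem matchingFlow_eq_zero {t : ℕ} {i j : ι} {l : ℕ} (h : N.virtualAvg V γ sel b t i j l = 0) :
    N.matchingFlow V γ sel b ρ t i j l = 0 :=
  routedFlow_eq_zero (by rw [empiricalProb_eq, forwardProb_eq, h, zero_div])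

theorem IsArgmaxRule.isFlow_matchingFlow (hsel : N.IsArgmaxRule sel) (t : ℕ) :
    N.IsFlow (N.matchingFlow V γ sel b ρ t) := fun i j l h =>
  matchingFlow_eq_zero (hsel.isFlow_virtualAvg t i j l h)

theorem matchingFlow_dest (t : ℕ) (j : ι) (l : ℕ) :
    N.matchingFlow V γ sel b ρ t N.d j l = 0 :=
  matchingFlow_eq_zero (virtualAvg_dest t j l)

theorem matchingQueue_succ (t : ℕ) : N.matchingQueue V γ sel b ρ (t + 1)
    = N.queueStep (N.matchingQueue V γ sel b ρ t) (N.matchingFlow V γ sel b ρ t) (b t) := rfl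

theorem matchingQueue_eq_queue (t : ℕ) : N.matchingQueue V γ sel b ρ t
    = N.queue b (N.matchingFlow V γ sel b ρ) t := by
  induction t with
  | zero => rfl
  | succ t ih => rw [matchingQueue_succ, ih, queue]

/-- Integrality makes the rounding in `routedFlow` exact: every packet of the backlog is routed. -/
theorem exists_matchingQueue_eq_natCast (t : ℕ) (i : ι) (l : ℕ) :
    ∃ n : ℕ, N.matchingQueue V γ sel b ρ t i l = n := by
  induction t generalizing i l with
  | zero => exact ⟨0, by simp [matchingQueue]⟩
  | succ t ih =>
    rw [matchingQueue_succ, queueStep]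
    split_ifs
    · exact ⟨0, by simp⟩
    · obtain ⟨n, hn⟩ := ih i (l + 1)
      obtain ⟨m, hm, hmn⟩ := exists_outFlow_routedFlow_eq
        (p := N.empiricalProb V γ sel b t) (Q := N.matchingQueue V γ sel b ρ t) (r := ρ t)
        (empiricalProb_nonneg t) i (l + 1)
      rw [hn, Nat.floor_natCast] at hmn
      obtain ⟨k, hk⟩ : ∃ k : ℕ, inFlow (N.matchingFlow V γ sel b ρ t) i (l + 1) = k :=
        ⟨_, (Nat.cast_sum _ _).symm⟩
      refine ⟨n - m + k + b t i l, ?_⟩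
      rw [hn, hk]
      change (n : ℝ) - outFlow (routedFlow _ _ _) i (l + 1) + k + _ = _
      rw [hm]
      push_cast [Nat.cast_sub hmn]
      ring

theorem matchingQueue_nonneg (t : ℕ) (i : ι) (l : ℕ) : 0 ≤ N.matchingQueue V γ sel b ρ t i l := by
  obtain ⟨n, hn⟩ := exists_matchingQueue_eq_natCast (N := N) (V := V) (γ := γ) (sel := sel)
    (b := b) (ρ := ρ) t i l
  rw [hn]
  exact Nat.cast_nonneg n

theorem outFlow_matchingFlow_le (t : ℕ) (i : ι) (l : ℕ) :
    outFlow (N.matchingFlow V γ sel b ρ t) i l ≤ N.matchingQueue V γ sel b ρ t i l := by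
  obtain ⟨m, hm, hmn⟩ := exists_outFlow_routedFlow_eq
    (p := N.empiricalProb V γ sel b t) (Q := N.matchingQueue V γ sel b ρ t) (r := ρ t)
    (empiricalProb_nonneg t) i l
  change outFlow (routedFlow _ _ _) i l ≤ _
  rw [hm]
  exact (Nat.cast_le.2 hmn).trans (Nat.floor_le (matchingQueue_nonneg t i l))

theorem matchingFlow_le (t : ℕ) (i j : ι) (l : ℕ) :
    N.matchingFlow V γ sel b ρ t i j l ≤ N.matchingQueue V γ sel b ρ t i l :=
  (le_outFlow (matchingFlow_nonneg t) i j l).trans (outFlow_matchingFlow_le t i l)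

/-- The bound depends on the slot and on `A` but not on arrivals or marks, so it serves both
integrability and a deterministic range of packet indices. -/
theorem exists_matchingQueue_le (N : Network ι) (V γ : ℝ) (sel : ℕ → ι → ι → (ℕ → ℝ) → ℕ) (A : ℝ)
    (t : ℕ) : ∃ M : ℕ, ∀ (b : ℕ → ι → ℕ → ℕ) (ρ : ℕ → ι → ℕ → ℕ → ℝ),
      (∀ s i l, (b s i l : ℝ) ≤ A) → ∀ i l, N.matchingQueue V γ sel b ρ t i l ≤ M := by
  induction t with
  | zero => exact ⟨0, fun b ρ _ i l => by simp [matchingQueue]⟩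
  | succ t ih =>
    obtain ⟨M, hM⟩ := ih
    refine ⟨⌈(M : ℝ) + Fintype.card ι * M + A⌉₊, fun b ρ hb i l => ?_⟩
    have hA : 0 ≤ A := (Nat.cast_nonneg _).trans (hb 0 i l)
    refine le_trans ?_ (Nat.le_ceil _)
    rw [matchingQueue_succ, queueStep]
    split_ifs
    · positivity
    · have h1 := outFlow_nonneg (matchingFlow_nonneg (N := N) (V := V) (γ := γ) (sel := sel)
        (b := b) (ρ := ρ) t) i (l + 1)
      have h2 : inFlow (N.matchingFlow V γ sel b ρ t) i (l + 1) ≤ Fintype.card ι * M := by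
        refine (Finset.sum_le_card_nsmul _ _ (M : ℝ) fun j _ =>
          (matchingFlow_le t j i (l + 1)).trans (hM b ρ hb j (l + 1))).trans ?_
        simp
      linarith [hM b ρ hb i (l + 1), hb t i l]

theorem matchingQueue_of_lt (hb : ∀ t i l, N.L < l → b t i l = 0) (hsel : N.IsArgmaxRule sel)
    (t : ℕ) (i : ι) {l : ℕ} (hl : N.L < l) : N.matchingQueue V γ sel b ρ t i l = 0 := by
  rw [matchingQueue_eq_queue]
  exact queue_of_lt hb (fun t => hsel.isFlow_matchingFlow t) t i hl

theorem matchingQueue_congr_marks {ρ' : ℕ → ι → ℕ → ℕ → ℝ} {t : ℕ} (h : ∀ s < t, ρ s = ρ' s) :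
    N.matchingQueue V γ sel b ρ t = N.matchingQueue V γ sel b ρ' t := by
  induction t with
  | zero => rfl
  | succ t ih =>
    rw [matchingQueue_succ, matchingQueue_succ, matchingFlow, matchingFlow,
      ih fun s hs => h s (by omega), h t (by omega)]

theorem virtualAvg_congr {b' : ℕ → ι → ℕ → ℕ} {t : ℕ} (h : ∀ s < t, b s = b' s) :
    N.virtualAvg V γ sel b t = N.virtualAvg V γ sel b' t := by
  funext i j l
  refine congrArg (· / (t : ℝ)) (Finset.sum_congr rfl fun s hs => ?_)
  beta_reduce
  rw [virtualFlow_congr fun s' hs' => h s' (hs'.trans (Finset.mem_range.1 hs))]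

theorem arrivalAvg_congr {b' : ℕ → ι → ℕ → ℕ} {t : ℕ} (h : ∀ s < t, b s = b' s) :
    (arrivalAvg b t : ι → ℕ → ℝ) = arrivalAvg b' t := by
  funext i l
  refine congrArg (· / (t : ℝ)) (Finset.sum_congr rfl fun s hs => ?_)
  beta_reduce
  rw [h s (Finset.mem_range.1 hs)]

theorem measurable_virtualAvg (hsel : N.IsArgmaxRule sel) (t : ℕ) (i j : ι) (l : ℕ) :
    Measurable fun b => N.virtualAvg V γ sel b t i j l :=
  measurable_timeAvg (fun τ => measurable_virtualFlow hsel τ i j l) t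

theorem measurable_arrivalAvg (t : ℕ) (i : ι) (l : ℕ) :
    Measurable fun b : ℕ → ι → ℕ → ℕ => arrivalAvg b t i l :=
  measurable_timeAvg (fun τ => measurable_apply τ i l) t

theorem measurable_available (hsel : N.IsArgmaxRule sel) (t : ℕ) (i : ι) (l : ℕ) :
    Measurable fun b => N.available (N.virtualAvg V γ sel b t) (arrivalAvg b t) i l :=
  ((measurable_upFrom (measurable_inFlow (measurable_virtualAvg hsel t) i) _ _).add
    (measurable_upFrom (measurable_arrivalAvg t i) _ _)).sub
    (measurable_upFrom (measurable_outFlow (measurable_virtualAvg hsel t) i) _ _)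

theorem measurable_empiricalProb (hsel : N.IsArgmaxRule sel) (t : ℕ) (i : ι) (l : ℕ) (j : ι) :
    Measurable fun b => N.empiricalProb V γ sel b t i l j :=
  (measurable_virtualAvg hsel t i j l).div ((measurable_available hsel t i l).max
    (measurable_outFlow (measurable_virtualAvg hsel t) i l))

theorem measurable_matchingQueue (hsel : N.IsArgmaxRule sel) (t : ℕ) (i : ι) (l : ℕ) :
    Measurable fun z : (ℕ → ι → ℕ → ℕ) × (ℕ → ι → ℕ → ℕ → ℝ) =>
      N.matchingQueue V γ sel z.1 z.2 t i l := by
  induction t generalizing i l with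
  | zero => exact measurable_const
  | succ t ih =>
    have hμ : ∀ i j l, Measurable fun z : (ℕ → ι → ℕ → ℕ) × (ℕ → ι → ℕ → ℕ → ℝ) =>
        N.matchingFlow V γ sel z.1 z.2 t i j l :=
      measurable_routedFlow (fun i l j => (measurable_empiricalProb hsel t i l j).comp
        measurable_fst) ih (fun i l k => by fun_prop)
    simp only [matchingQueue_succ, queueStep]
    by_cases h : i = N.d ∨ l = 0
    · simp only [h, if_true, measurable_const]
    · simp only [h, if_false]
      exact (((ih i (l + 1)).sub (measurable_outFlow hμ i _)).add (measurable_inFlow hμ i _)).add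
        ((measurable_apply t i l).comp measurable_fst)

theorem measurable_matchingFlow (hsel : N.IsArgmaxRule sel) (t : ℕ) (i j : ι) (l : ℕ) :
    Measurable fun z : (ℕ → ι → ℕ → ℕ) × (ℕ → ι → ℕ → ℕ → ℝ) =>
      N.matchingFlow V γ sel z.1 z.2 t i j l :=
  measurable_routedFlow (fun i l j => (measurable_empiricalProb hsel t i l j).comp
    measurable_fst) (measurable_matchingQueue hsel t) (fun i l k => by fun_prop) i j l

end Matching

end Network

/-- A realization of the marks. -/
def marksPath {Ω : Type*} (r : ℕ → ι → ℕ → ℕ → Ω → ℝ) (ω : Ω) : ℕ → ι → ℕ → ℕ → ℝ :=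
  fun s i l k => r s i l k ω

theorem upFrom_eq_add_of {L l : ℕ} {g : ℕ → ℝ} (h : L < l → g l = 0) :
    upFrom L g l = g l + upFrom L g (l + 1) := by
  rcases le_or_gt l L with hl | hl
  · exact upFrom_eq_add hl g
  · rw [upFrom_of_lt hl, upFrom_of_lt (by omega), h hl, add_zero]

namespace Network

variable {N : Network ι} {V γ : ℝ} {sel : ℕ → ι → ι → (ℕ → ℝ) → ℕ}

/-! ### Slow variation of the empirical averages -/

section Path

variable {b : ℕ → ι → ℕ → ℕ}

/-- This is the recursion of the queues with one slot replaced by one lifetime. It makes `available`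
the right target for the backlogs, and at `l = L` it needs the flow at `L + 1` to vanish. -/
theorem available_eq_add (hsel : N.IsArgmaxRule sel) (t : ℕ) (i : ι) {l : ℕ} (hl : l ≤ N.L) :
    N.available (N.virtualAvg V γ sel b t) (arrivalAvg b t) i l
      = N.available (N.virtualAvg V γ sel b t) (arrivalAvg b t) i (l + 1)
        - outFlow (N.virtualAvg V γ sel b t) i (l + 1)
        + inFlow (N.virtualAvg V γ sel b t) i (l + 1) + arrivalAvg b t i l := by
  have h0 : N.L < l + 1 → ∀ i j, N.virtualAvg V γ sel b t i j (l + 1) = 0 := fun h i j =>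
    hsel.isFlow_virtualAvg t i j _ (by omega)
  have h1 : upFrom N.L (inFlow (N.virtualAvg V γ sel b t) i) (l + 1) = _ :=
    upFrom_eq_add_of fun h => by simp [inFlow, h0 h]
  have h2 : upFrom N.L (outFlow (N.virtualAvg V γ sel b t) i) (l + 1) = _ :=
    upFrom_eq_add_of fun h => by simp [outFlow, h0 h]
  have h3 := upFrom_eq_add hl (arrivalAvg b t i)
  rw [available, available, h1, h2, h3]
  ring

theorem outFlow_sub_available_le (t : ℕ) (i : ι) {l : ℕ} (hl : l ≤ N.L) :
    outFlow (N.virtualAvg V γ sel b t) i l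
      - N.available (N.virtualAvg V γ sel b t) (arrivalAvg b t) i l
      ≤ (N.virtualQueue V γ sel b t).2 i l / t := by
  have h := balance_virtualAvg_le (N := N) (V := V) (γ := γ) (sel := sel) (b := b) t i l
  rw [upFrom_eq_add hl (outFlow _ i)] at h
  rw [available]
  linarith

theorem available_eq_timeAvg (t : ℕ) (i : ι) (l : ℕ) :
    N.available (N.virtualAvg V γ sel b t) (arrivalAvg b t) i l
      = timeAvg (fun τ => upFrom N.L (inFlow (N.virtualFlow V γ sel b τ) i) (l + 1)
        + upFrom N.L (fun k => (b τ i k : ℝ)) l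
        - upFrom N.L (outFlow (N.virtualFlow V γ sel b τ) i) (l + 1)) t := by
  have e : upFrom N.L (arrivalAvg b t i) l
      = timeAvg (fun τ => upFrom N.L (fun k => (b τ i k : ℝ)) l) t :=
    upFrom_timeAvg N.L (fun τ k => (b τ i k : ℝ)) l t
  rw [available, timeAvg_sub, timeAvg_add, virtualAvg, upFrom_outFlow_flowAvg,
    upFrom_inFlow_flowAvg, e]

theorem abs_balance_le {A : ℝ} (hb : ∀ t i l, (b t i l : ℝ) ≤ A) (τ : ℕ) (i : ι) {l : ℕ}
    (hl : 1 ≤ l) : |upFrom N.L (inFlow (N.virtualFlow V γ sel b τ) i) (l + 1)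
        + upFrom N.L (fun k => (b τ i k : ℝ)) l
        - upFrom N.L (outFlow (N.virtualFlow V γ sel b τ) i) (l + 1)| ≤ N.stepBound γ A := by
  have h := N.abs_upFrom_balance_le (l := l) (l' := l + 1)
    (abs_virtualFlow_le (V := V) (γ := γ) (sel := sel) (a := b) τ)
    (lam := fun i k => (b τ i k : ℝ)) (A := A)
    (fun i k => by rw [Nat.abs_cast]; exact hb τ i k) γ i hl (by omega)
  rw [← abs_neg]
  convert h using 2
  ring

/-- A bound for the variation of the empirical averages during `L` slots. -/
noncomputable def driftRate (N : Network ι) (γ A : ℝ) (t : ℕ) : ℝ :=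
  (2 * (N.capSum + N.stepBound γ A + Fintype.card ι * N.capSum) * N.L + 1) / (t + 1)

theorem stepBound_nonneg {A : ℝ} (hA : 0 ≤ A) : 0 ≤ N.stepBound γ A := by
  have := N.capSum_nonneg
  rw [stepBound]
  positivity

theorem driftRate_pos {A : ℝ} (hA : 0 ≤ A) (t : ℕ) : 0 < N.driftRate γ A t := by
  have := N.capSum_nonneg
  have := stepBound_nonneg (N := N) (γ := γ) hA
  rw [driftRate]
  positivity

theorem tendsto_driftRate (A : ℝ) : Tendsto (N.driftRate γ A) atTop (𝓝 0) := by
  have h := (tendsto_one_div_add_atTop_nhds_zero_nat (𝕜 := ℝ)).const_mul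
    (2 * (N.capSum + N.stepBound γ A + Fintype.card ι * N.capSum) * N.L + 1)
  rw [mul_zero] at h
  refine h.congr fun t => ?_
  rw [driftRate, mul_one_div]

/-- An upper bound, known in slot `t`, for the change of the forwarding probabilities during the
next `L` slots; its product with the available amount is small. -/
noncomputable def probVariation (N : Network ι) (V γ : ℝ) (sel : ℕ → ι → ι → (ℕ → ℝ) → ℕ) (A : ℝ)
    (t : ℕ) (i : ι) (l : ℕ) (b : ℕ → ι → ℕ → ℕ) : ℝ :=
  N.driftRate γ A t / max (max (N.available (N.virtualAvg V γ sel b t) (arrivalAvg b t) i l)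
    (outFlow (N.virtualAvg V γ sel b t) i l)) (N.driftRate γ A t)

/-- Flow, available amount and outgoing flow are running means of bounded sequences; together they
move by at most `driftRate` within `L` slots, which is inserted into `abs_forwardProb_sub_le`. -/
theorem abs_empiricalProb_sub_le {A : ℝ} (hb : ∀ t i l, (b t i l : ℝ) ≤ A) {t s : ℕ} (hts : t ≤ s)
    (hst : s ≤ t + N.L) (i : ι) {l : ℕ} (hl : 1 ≤ l) (j : ι) :
    |N.empiricalProb V γ sel b s i l j - N.empiricalProb V γ sel b t i l j|
      ≤ N.probVariation V γ sel A t i l b := by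
  have hA : 0 ≤ A := (Nat.cast_nonneg _).trans (hb 0 i l)
  obtain ⟨k, rfl⟩ := Nat.exists_eq_add_of_le hts
  have hk : (k : ℝ) ≤ N.L := by exact_mod_cast (by omega)
  refine abs_forwardProb_sub_le (virtualAvg_nonneg t) (virtualAvg_nonneg (t + k))
    (driftRate_pos hA t) ?_
  have h1 : |N.virtualAvg V γ sel b (t + k) i j l - N.virtualAvg V γ sel b t i j l| ≤ _ :=
    abs_timeAvg_add_sub_le (fun τ => abs_virtualFlow_le τ i j l) t k
  have h2 := abs_timeAvg_add_sub_le (fun τ => abs_balance_le (N := N) (V := V) (γ := γ)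
    (sel := sel) hb τ i hl) t k
  rw [← available_eq_timeAvg, ← available_eq_timeAvg] at h2
  have h3 := abs_timeAvg_add_sub_le (fun τ => abs_outFlow_le
    (abs_virtualFlow_le (N := N) (V := V) (γ := γ) (sel := sel) (a := b) τ) i l) t k
  rw [← congrFun (outFlow_flowAvg (N.virtualFlow V γ sel b) i (t + k)) l,
    ← congrFun (outFlow_flowAvg (N.virtualFlow V γ sel b) i t) l] at h3
  refine (add_le_add (add_le_add h1 h2) h3).trans ?_
  rw [← add_div, ← add_div, driftRate]
  have h4 := N.capSum_nonneg
  have h5 := stepBound_nonneg (N := N) (γ := γ) hA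
  have h6 : 2 * (N.capSum + N.stepBound γ A + Fintype.card ι * N.capSum) * k
      ≤ 2 * (N.capSum + N.stepBound γ A + Fintype.card ι * N.capSum) * N.L := by
    gcongr
  refine div_le_div_of_nonneg_right ?_ (by positivity)
  linarith

theorem probVariation_mem {A : ℝ} (hA : 0 ≤ A) (t : ℕ) (i : ι) (l : ℕ) :
    0 ≤ N.probVariation V γ sel A t i l b ∧ N.probVariation V γ sel A t i l b ≤ 1 := by
  have h := driftRate_pos (N := N) (γ := γ) hA t
  exact ⟨div_nonneg h.le (le_max_of_le_right h.le),
    div_le_one_of_le₀ (le_max_right _ _) (le_max_of_le_right h.le)⟩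

theorem probVariation_mul_available_le {A : ℝ} (hA : 0 ≤ A) (t : ℕ) (i : ι) (l : ℕ) :
    N.probVariation V γ sel A t i l b
      * N.available (N.virtualAvg V γ sel b t) (arrivalAvg b t) i l ≤ N.driftRate γ A t := by
  have h := driftRate_pos (N := N) (γ := γ) hA t
  have hp : 0 < max (max (N.available (N.virtualAvg V γ sel b t) (arrivalAvg b t) i l)
    (outFlow (N.virtualAvg V γ sel b t) i l)) (N.driftRate γ A t) := lt_max_of_lt_right h
  refine (mul_le_mul_of_nonneg_left ((le_max_left _ _).trans (le_max_left _ _))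
    (probVariation_mem hA t i l).1).trans_eq (div_mul_cancel₀ _ hp.ne')

end Path

/-! ### Mean flows of the flow-matching policy -/

/-- Weights in `[-1, 1]` that are functions of the arrivals before slot `t`. -/
structure IsWeight (t : ℕ) (G : (ℕ → ι → ℕ → ℕ) → ℝ) : Prop where
  measurable : Measurable G
  dependsOn : DependsOn G (Set.Iio t)
  abs_le_one : ∀ b, |G b| ≤ 1

section Random

variable {Ω : Type*} [MeasurableSpace Ω] {P : Measure Ω} [IsProbabilityMeasure P] {Amax : ℝ}
  {lam : ι → ℕ → ℝ} {a : ℕ → ι → ℕ → Ω → ℕ} {r : ℕ → ι → ℕ → ℕ → Ω → ℝ}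

theorem measurable_marksPath (hm : IsMarks P a r) : Measurable (marksPath r) :=
  measurable_pi_lambda _ fun t => measurable_pi_lambda _ fun i => measurable_pi_lambda _ fun l =>
    measurable_pi_lambda _ fun k => hm.measurable t i l k

-- For a fixed arrival path the probabilities are deterministic, and whether a `k`-th packet is
-- present in slot `s` depends on marks of earlier slots only, so it is independent of the mark this
-- packet draws.
open Classical in
theorem integral_matchingFlow_of_path (hm : IsMarks P a r) (hsel : N.IsArgmaxRule sel)
    {b : ℕ → ι → ℕ → ℕ} {A : ℝ} (hb : ∀ t i l, (b t i l : ℝ) ≤ A) (s : ℕ) (i j : ι) (l : ℕ) :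
    ∫ ω, N.matchingFlow V γ sel b (marksPath r ω) s i j l ∂P
      = N.empiricalProb V γ sel b s i l j
        * ∫ ω, N.matchingQueue V γ sel b (marksPath r ω) s i l ∂P := by
  obtain ⟨M, hM⟩ := exists_matchingQueue_le N V γ sel A s
  set p := N.empiricalProb V γ sel b s i l
  set Q : Ω → ℝ := fun ω => N.matchingQueue V γ sel b (marksPath r ω) s i l with hQ
  have hfl : ∀ ω, ⌊Q ω⌋₊ ≤ M := fun ω => by
    have := Nat.floor_le_floor (hM b (marksPath r ω) hb i l)
    rwa [Nat.floor_natCast] at this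
  have hterm : ∀ k, ∫ ω, (if k < ⌊Q ω⌋₊ then (1 : ℝ) else 0)
      * (if SendsTo p (r s i l k ω) j then 1 else 0) ∂P
      = p j * ∫ ω, (if k < ⌊Q ω⌋₊ then (1 : ℝ) else 0) ∂P := by
    intro k
    let G : (ℕ × ι × ℕ × ℕ → ℝ) → ℝ := fun f =>
      if k < ⌊N.matchingQueue V γ sel b (fun s i l k => f (s, i, l, k)) s i l⌋₊ then 1 else 0
    have hG : Measurable G := by
      refine Measurable.ite (measurableSet_lt measurable_const (Measurable.nat_floor ?_))
        measurable_const measurable_const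
      exact (measurable_matchingQueue hsel s i l).comp
        (measurable_const.prodMk (by fun_prop))
    have hdep : DependsOn G {q | q.1 < s} := by
      intro f f' h
      have : N.matchingQueue V γ sel b (fun s i l k => f (s, i, l, k)) s
          = N.matchingQueue V γ sel b (fun s i l k => f' (s, i, l, k)) s :=
        matchingQueue_congr_marks fun s' hs' => by
          funext i l k
          exact h _ hs'
      simp only [G, this]
    have hind := iIndepFun_indepFun_of_dependsOn hm.indep
      (fun q => hm.measurable q.1 q.2.1 q.2.2.1 q.2.2.2) (S := {q | q.1 < s})
      (k := (s, i, l, k)) (by simp) hG hdep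
    have hS : Measurable fun u : ℝ => if SendsTo p u j then (1 : ℝ) else 0 :=
      Measurable.ite (measurableSet_sendsTo (p := fun _ => p) (r := fun u => u) (fun _ => measurable_const)
        measurable_id j)
        measurable_const measurable_const
    have h := (hind.comp measurable_id hS).integral_fun_mul_eq_mul_integral
      (hG.comp (measurable_pi_lambda _ fun q =>
        hm.measurable q.1 q.2.1 q.2.2.1 q.2.2.2)).aestronglyMeasurable
      (hS.comp (hm.measurable s i l k)).aestronglyMeasurable
    have h2 := integral_sendsTo (hm.measurable s i l k) (hm.uniform s i l k)
      (p := p) (fun j => empiricalProb_nonneg s i l j) (sum_empiricalProb_le_one s i l) j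
    rw [← h2, mul_comm]
    exact h
  have hQm : Measurable Q :=
    (measurable_matchingQueue hsel s i l).comp (measurable_const.prodMk (measurable_marksPath hm))
  have hint1 : ∀ k, MemLp (fun ω => if k < ⌊Q ω⌋₊ then (1 : ℝ) else 0) ⊤ P := by
    intro k
    refine memLp_top_of_bound (Measurable.ite (measurableSet_lt measurable_const hQm.nat_floor)
      measurable_const measurable_const).aestronglyMeasurable 1 (Eventually.of_forall fun ω => ?_)
    split_ifs <;> simp
  have hint2 : ∀ k, MemLp (fun ω => if SendsTo p (r s i l k ω) j then (1 : ℝ) else 0) ⊤ P := by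
    intro k
    refine memLp_top_of_bound (Measurable.ite (measurableSet_sendsTo (p := fun _ => p) (fun _ => measurable_const)
      (hm.measurable s i l k) j) measurable_const measurable_const).aestronglyMeasurable 1
      (Eventually.of_forall fun ω => ?_)
    split_ifs <;> simp
  have e1 : ∀ ω, N.matchingFlow V γ sel b (marksPath r ω) s i j l
      = ∑ k ∈ Finset.range M, (if k < ⌊Q ω⌋₊ then (1 : ℝ) else 0)
        * (if SendsTo p (r s i l k ω) j then 1 else 0) := fun ω => routedFlow_eq_sum (hfl ω) j
  have e2 : ∀ ω, Q ω = ∑ k ∈ Finset.range M, (if k < ⌊Q ω⌋₊ then (1 : ℝ) else 0) := by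
    intro ω
    obtain ⟨n, hn⟩ := exists_matchingQueue_eq_natCast (N := N) (V := V) (γ := γ) (sel := sel)
      (b := b) (ρ := marksPath r ω) s i l
    have hnM := hfl ω
    have hn' : Q ω = n := hn
    rw [hn', Nat.floor_natCast] at hnM
    rw [hn', Nat.floor_natCast]
    rw [← Finset.sum_filter, Finset.sum_const, nsmul_one]
    congr 1
    have : (Finset.range M).filter (· < n) = Finset.range n := by
      ext k
      simp only [Finset.mem_range, Finset.mem_filter]
      omega
    rw [this, Finset.card_range]
  simp only [e1]
  rw [integral_finsetSum _ fun k _ => (memLp_top_mul (hint1 k) (hint2 k)).integrable le_top]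
  simp only [hterm]
  rw [← Finset.mul_sum, ← integral_finsetSum _ fun k _ => (hint1 k).integrable le_top]
  simp only [← e2]

variable (ha : N.IsArrival P Amax lam a) (hm : IsMarks P a r) (hsel : N.IsArgmaxRule sel)
include ha

theorem IsArrival.nonneg : 0 ≤ Amax := by
  obtain ⟨ω, hω⟩ := ha.ae_le.exists
  exact (Nat.cast_nonneg _).trans (hω 0 N.d 0)

theorem IsArrival.memLp_isWeight {t : ℕ} {G : (ℕ → ι → ℕ → ℕ) → ℝ} (hG : IsWeight t G) :
    MemLp (fun ω => G (arrivalPath a ω)) ⊤ P :=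
  ha.memLp_of_bound hG.measurable fun b _ => hG.abs_le_one b

include hsel

theorem IsArrival.memLp_virtualAvg (t : ℕ) (i j : ι) (l : ℕ) :
    MemLp (fun ω => N.virtualAvg V γ sel (arrivalPath a ω) t i j l) ⊤ P :=
  ha.memLp_of_bound (measurable_virtualAvg hsel t i j l) fun _ _ => abs_virtualAvg_le t i j l

theorem IsArrival.memLp_available (t : ℕ) (i : ι) {l : ℕ} (hl : 1 ≤ l) :
    MemLp (fun ω => N.available (N.virtualAvg V γ sel (arrivalPath a ω) t)
      (arrivalAvg (arrivalPath a ω) t) i l) ⊤ P :=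
  ha.memLp_of_bound (measurable_available hsel t i l) fun b hb => by
    rw [available_eq_timeAvg]
    exact abs_timeAvg_le (fun τ => abs_balance_le hb τ i hl) t

theorem isWeight_probVariation (t : ℕ) (i : ι) (l : ℕ) :
    IsWeight t (N.probVariation V γ sel Amax t i l) where
  measurable := ((measurable_const).div (((measurable_available hsel t i l).max
    (measurable_outFlow (measurable_virtualAvg hsel t) i l)).max measurable_const))
  dependsOn := fun b b' h => by
    simp only [probVariation, virtualAvg_congr (b' := b') h, arrivalAvg_congr (b' := b') h]
  abs_le_one := fun b => by
    have := probVariation_mem (N := N) (V := V) (γ := γ) (sel := sel) (b := b) ha.nonneg t i l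
    rw [abs_of_nonneg this.1]
    exact this.2

-- This closure property is the reason for quantifying over all weights in the induction over
-- lifetimes.
omit ha [IsProbabilityMeasure P] in
theorem IsWeight.mul_empiricalProb {t : ℕ} {G : (ℕ → ι → ℕ → ℕ) → ℝ} (hG : IsWeight t G)
    (i : ι) (l : ℕ) (j : ι) : IsWeight t fun b => G b * N.empiricalProb V γ sel b t i l j where
  measurable := hG.measurable.mul (measurable_empiricalProb hsel t i l j)
  dependsOn := fun b b' h => by
    simp only [hG.dependsOn h, empiricalProb_eq, virtualAvg_congr (b' := b') h,
      arrivalAvg_congr (b' := b') h]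
  abs_le_one := fun b => by
    rw [abs_mul, abs_of_nonneg (empiricalProb_nonneg t i l j)]
    exact mul_le_one₀ (hG.abs_le_one b) (empiricalProb_nonneg t i l j)
      (empiricalProb_le_one t i l j)

include hm

theorem IsArrival.memLp_matchingQueue (t : ℕ) (i : ι) (l : ℕ) :
    MemLp (fun ω => N.matchingQueue V γ sel (arrivalPath a ω) (marksPath r ω) t i l) ⊤ P := by
  obtain ⟨M, hM⟩ := exists_matchingQueue_le N V γ sel Amax t
  refine memLp_top_of_bound ((measurable_matchingQueue hsel t i l).comp
    (ha.measurable_path.prodMk (measurable_marksPath hm))).aestronglyMeasurable M ?_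
  filter_upwards [ha.ae_le] with ω hω
  rw [Real.norm_eq_abs, abs_of_nonneg (matchingQueue_nonneg t i l)]
  exact hM _ _ hω i l

theorem IsArrival.memLp_matchingFlow (t : ℕ) (i j : ι) (l : ℕ) :
    MemLp (fun ω => N.matchingFlow V γ sel (arrivalPath a ω) (marksPath r ω) t i j l) ⊤ P := by
  refine (ha.memLp_matchingQueue (V := V) (γ := γ) hm hsel t i l).mono ((measurable_matchingFlow hsel t i j l).comp
    (ha.measurable_path.prodMk (measurable_marksPath hm))).aestronglyMeasurable
    (Eventually.of_forall fun ω => ?_)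
  rw [Real.norm_eq_abs, Real.norm_eq_abs, abs_of_nonneg (matchingFlow_nonneg t i j l),
    abs_of_nonneg (matchingQueue_nonneg t i l)]
  exact matchingFlow_le t i j l

/-- Given the arrivals, the mean flow is the forwarding probability times the mean backlog. -/
theorem IsArrival.integral_mul_matchingFlow {t : ℕ} {G : (ℕ → ι → ℕ → ℕ) → ℝ}
    (hG : IsWeight t G) (s : ℕ) (i j : ι) (l : ℕ) :
    ∫ ω, G (arrivalPath a ω) * N.matchingFlow V γ sel (arrivalPath a ω) (marksPath r ω) s i j l ∂P
      = ∫ ω, G (arrivalPath a ω) * N.empiricalProb V γ sel (arrivalPath a ω) s i l j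
        * N.matchingQueue V γ sel (arrivalPath a ω) (marksPath r ω) s i l ∂P := by
  have hind : IndepFun (arrivalPath a) (marksPath r) P := hm.indep_arrivals
  have hp : MemLp (fun ω => N.empiricalProb V γ sel (arrivalPath a ω) s i l j) ⊤ P :=
    ha.memLp_of_bound (measurable_empiricalProb hsel s i l j) (K := 1) fun b _ => by
      rw [abs_of_nonneg (empiricalProb_nonneg s i l j)]
      exact empiricalProb_le_one s i l j
  -- Arrivals and marks are independent, so integrating over the marks first reduces both sides to a
  -- fixed arrival path.
  have h1 := IndepFun_integral_eq_integral_integral hind ha.measurable_path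
    (measurable_marksPath hm) (F := fun b ρ => G b * N.matchingFlow V γ sel b ρ s i j l)
    ((hG.measurable.comp measurable_fst).mul (measurable_matchingFlow hsel s i j l))
    ((memLp_top_mul (ha.memLp_isWeight hG) (ha.memLp_matchingFlow hm hsel s i j l)).integrable
      le_top)
  have h2 := IndepFun_integral_eq_integral_integral hind ha.measurable_path
    (measurable_marksPath hm) (F := fun b ρ => G b * N.empiricalProb V γ sel b s i l j
      * N.matchingQueue V γ sel b ρ s i l)
    (((hG.measurable.comp measurable_fst).mul ((measurable_empiricalProb hsel s i l j).comp
      measurable_fst)).mul (measurable_matchingQueue hsel s i l))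
    ((memLp_top_mul (memLp_top_mul (ha.memLp_isWeight hG) hp)
      (ha.memLp_matchingQueue hm hsel s i l)).integrable le_top)
  rw [h1, h2]
  refine integral_congr_ae ?_
  filter_upwards [ha.ae_le] with ω hω
  simp only [integral_const_mul]
  rw [integral_matchingFlow_of_path hm hsel hω, mul_assoc]

/-- If the weighted mean backlogs match the available virtual flow, so do the weighted mean
flows. -/
theorem IsArrival.abs_integral_matchingFlow_sub_le {t s : ℕ} (hts : t ≤ s) (hst : s ≤ t + N.L)
    {i : ι} {l : ℕ} (hl : 1 ≤ l) (hlL : l ≤ N.L) {ε ε' : ℝ}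
    (hε : ∀ G, IsWeight t G → |∫ ω, G (arrivalPath a ω)
        * N.matchingQueue V γ sel (arrivalPath a ω) (marksPath r ω) s i l ∂P
      - ∫ ω, G (arrivalPath a ω) * N.available (N.virtualAvg V γ sel (arrivalPath a ω) t)
        (arrivalAvg (arrivalPath a ω) t) i l ∂P| ≤ ε)
    (hε' : ∫ ω, (N.virtualQueue V γ sel (arrivalPath a ω) t).2 i l / t ∂P ≤ ε')
    (j : ι) {G : (ℕ → ι → ℕ → ℕ) → ℝ} (hG : IsWeight t G) :
    |∫ ω, G (arrivalPath a ω)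
        * N.matchingFlow V γ sel (arrivalPath a ω) (marksPath r ω) s i j l ∂P
      - ∫ ω, G (arrivalPath a ω) * N.virtualAvg V γ sel (arrivalPath a ω) t i j l ∂P|
      ≤ N.driftRate γ Amax t + 2 * ε + ε' := by
  have hA := ha.nonneg
  have hGm := ha.memLp_isWeight hG
  have hQm := ha.memLp_matchingQueue (V := V) (γ := γ) hm hsel s i l
  have hqm := ha.memLp_available (V := V) (γ := γ) hsel t i hl
  have hxm := ha.memLp_virtualAvg (V := V) (γ := γ) hsel t i j l
  have hpm : ∀ s, MemLp (fun ω => N.empiricalProb V γ sel (arrivalPath a ω) s i l j) ⊤ P :=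
    fun s => ha.memLp_of_bound (measurable_empiricalProb hsel s i l j) (K := 1) fun b _ => by
      rw [abs_of_nonneg (empiricalProb_nonneg s i l j)]
      exact empiricalProb_le_one s i l j
  have hvw := isWeight_probVariation (V := V) (γ := γ) ha hsel t i l
  have hvm := ha.memLp_isWeight hvw
  have hGp := hG.mul_empiricalProb (V := V) (γ := γ) hsel i l j
  have hGpm := ha.memLp_isWeight hGp
  rw [ha.integral_mul_matchingFlow hm hsel hG]
  set g : Ω → ℝ := fun ω => G (arrivalPath a ω)
  set Q : Ω → ℝ := fun ω => N.matchingQueue V γ sel (arrivalPath a ω) (marksPath r ω) s i l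
  set q : Ω → ℝ := fun ω => N.available (N.virtualAvg V γ sel (arrivalPath a ω) t)
        (arrivalAvg (arrivalPath a ω) t) i l
  set x : Ω → ℝ := fun ω => N.virtualAvg V γ sel (arrivalPath a ω) t i j l
  set p : ℕ → Ω → ℝ := fun s ω => N.empiricalProb V γ sel (arrivalPath a ω) s i l j
  set v : Ω → ℝ := fun ω => N.probVariation V γ sel Amax t i l (arrivalPath a ω)
  have hg1 : ∀ ω, |g ω| ≤ 1 := fun ω => hG.abs_le_one _
  have hQ0 : ∀ ω, 0 ≤ Q ω := fun ω => matchingQueue_nonneg s i l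
  -- the forwarding probabilities hardly change
  have hT1 : |∫ ω, g ω * (p s ω - p t ω) * Q ω ∂P| ≤ N.driftRate γ Amax t + ε := by
    have h1 : |∫ ω, g ω * (p s ω - p t ω) * Q ω ∂P| ≤ ∫ ω, v ω * Q ω ∂P := by
      refine (abs_integral_le_integral_abs).trans (integral_mono_ae
        ((memLp_top_mul (memLp_top_mul hGm ((hpm s).sub (hpm t))) hQm).integrable le_top).abs
        ((memLp_top_mul hvm hQm).integrable le_top) ?_)
      filter_upwards [ha.ae_le] with ω hω
      have h2 : |p s ω - p t ω| ≤ v ω := abs_empiricalProb_sub_le hω hts hst i hl j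
      rw [abs_mul, abs_mul, abs_of_nonneg (hQ0 ω)]
      refine mul_le_mul_of_nonneg_right ?_ (hQ0 ω)
      exact (mul_le_of_le_one_left (abs_nonneg _) (hg1 ω)).trans h2
    -- The bound `v` on the change is a weight itself, so `Q` may be replaced by `q`, and `v * q` is
    -- at most `driftRate`.
    have h3 := (abs_le.1 (hε _ hvw)).2
    have h4 : ∫ ω, v ω * q ω ∂P ≤ N.driftRate γ Amax t := by
      refine (integral_mono ((memLp_top_mul hvm hqm).integrable le_top) (integrable_const _)
        fun ω => probVariation_mul_available_le hA t i l).trans_eq ?_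
      simp
    change ∫ ω, v ω * Q ω ∂P - ∫ ω, v ω * q ω ∂P ≤ ε at h3
    linarith
  have hT2 : |∫ ω, g ω * p t ω * Q ω ∂P - ∫ ω, g ω * p t ω * q ω ∂P| ≤ ε := hε _ hGp
  -- the virtual queue bounds the overload
  have hT3 : |∫ ω, g ω * (p t ω * q ω - x ω) ∂P| ≤ ε' := by
    refine (abs_integral_le_integral_abs).trans (le_trans (integral_mono
      ((memLp_top_mul hGm ((memLp_top_mul (hpm t) hqm).sub hxm)).integrable le_top).abs
      (((ha.memLp_virtualQueue_snd hsel t i hl).integrable le_top).div_const _) fun ω => ?_) hε')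
    change |g ω * (p t ω * q ω - x ω)| ≤ _
    rw [abs_mul]
    refine (mul_le_of_le_one_left (abs_nonneg _) (hg1 ω)).trans ?_
    refine (abs_forwardProb_mul_available_sub_le (virtualAvg_nonneg t) i l j).trans (max_le ?_ ?_)
    · exact div_nonneg (virtualQueue_snd_nonneg t i l) (Nat.cast_nonneg t)
    · exact outFlow_sub_available_le t i hlL
  have i1 : Integrable (fun ω => g ω * (p s ω - p t ω) * Q ω) P :=
    (memLp_top_mul (memLp_top_mul hGm ((hpm s).sub (hpm t))) hQm).integrable le_top
  have i2 : Integrable (fun ω => g ω * p t ω * Q ω) P :=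
    (memLp_top_mul hGpm hQm).integrable le_top
  have i3 : Integrable (fun ω => g ω * p t ω * q ω) P :=
    (memLp_top_mul hGpm hqm).integrable le_top
  have i4 : Integrable (fun ω => g ω * x ω) P := (memLp_top_mul hGm hxm).integrable le_top
  have e1 : ∫ ω, g ω * p s ω * Q ω ∂P
      = ∫ ω, g ω * (p s ω - p t ω) * Q ω ∂P + ∫ ω, g ω * p t ω * Q ω ∂P := by
    rw [← integral_add i1 i2]
    exact integral_congr_ae (Eventually.of_forall fun ω => by ring)
  have e2 : ∫ ω, g ω * (p t ω * q ω - x ω) ∂P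
      = ∫ ω, g ω * p t ω * q ω ∂P - ∫ ω, g ω * x ω ∂P := by
    rw [← integral_sub i3 i4]
    exact integral_congr_ae (Eventually.of_forall fun ω => by ring)
  change |∫ ω, g ω * p s ω * Q ω ∂P - ∫ ω, g ω * x ω ∂P| ≤ _
  rw [e2] at hT3
  rw [e1]
  rw [abs_le] at *
  constructor <;> linarith [hT1.1, hT1.2, hT2.1, hT2.2, hT3.1, hT3.2]

/-- If the weighted mean backlogs and flows match the virtual ones at lifetime `l + 1`, so do the
weighted mean backlogs at lifetime `l` one slot later. -/
theorem IsArrival.abs_integral_matchingQueue_succ_sub_le {t s : ℕ} (hts : t ≤ s)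
    {i : ι} (hi : i ≠ N.d) {l : ℕ} (hl : 1 ≤ l) (hlL : l ≤ N.L) {ε ε' : ℝ}
    {G : (ℕ → ι → ℕ → ℕ) → ℝ} (hG : IsWeight t G)
    (hε : |∫ ω, G (arrivalPath a ω)
        * N.matchingQueue V γ sel (arrivalPath a ω) (marksPath r ω) s i (l + 1) ∂P
      - ∫ ω, G (arrivalPath a ω) * N.available (N.virtualAvg V γ sel (arrivalPath a ω) t)
        (arrivalAvg (arrivalPath a ω) t) i (l + 1) ∂P| ≤ ε)
    (hε' : ∀ i j, |∫ ω, G (arrivalPath a ω)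
        * N.matchingFlow V γ sel (arrivalPath a ω) (marksPath r ω) s i j (l + 1) ∂P
      - ∫ ω, G (arrivalPath a ω) * N.virtualAvg V γ sel (arrivalPath a ω) t i j (l + 1) ∂P| ≤ ε') :
    |∫ ω, G (arrivalPath a ω)
        * N.matchingQueue V γ sel (arrivalPath a ω) (marksPath r ω) (s + 1) i l ∂P
      - ∫ ω, G (arrivalPath a ω) * N.available (N.virtualAvg V γ sel (arrivalPath a ω) t)
        (arrivalAvg (arrivalPath a ω) t) i l ∂P|
      ≤ ε + 2 * (Fintype.card ι * ε')
        + ∫ ω, |arrivalAvg (arrivalPath a ω) t i l - lam i l| ∂P := by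
  have hGm := ha.memLp_isWeight hG
  set g : Ω → ℝ := fun ω => G (arrivalPath a ω)
  set Q : Ω → ℝ := fun ω =>
    N.matchingQueue V γ sel (arrivalPath a ω) (marksPath r ω) s i (l + 1)
  set q : Ω → ℝ := fun ω => N.available (N.virtualAvg V γ sel (arrivalPath a ω) t)
        (arrivalAvg (arrivalPath a ω) t) i (l + 1)
  set μ : ι → ι → Ω → ℝ := fun i j ω =>
    N.matchingFlow V γ sel (arrivalPath a ω) (marksPath r ω) s i j (l + 1)
  set x : ι → ι → Ω → ℝ := fun i j ω => N.virtualAvg V γ sel (arrivalPath a ω) t i j (l + 1)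
  have iQ : Integrable (fun ω => g ω * Q ω) P :=
    (memLp_top_mul hGm (ha.memLp_matchingQueue hm hsel s i (l + 1))).integrable le_top
  have iq : Integrable (fun ω => g ω * q ω) P :=
    (memLp_top_mul hGm (ha.memLp_available hsel t i (by omega))).integrable le_top
  have iμ : ∀ i j, Integrable (fun ω => g ω * μ i j ω) P := fun i j =>
    (memLp_top_mul hGm (ha.memLp_matchingFlow hm hsel s i j (l + 1))).integrable le_top
  have ix : ∀ i j, Integrable (fun ω => g ω * x i j ω) P := fun i j =>
    (memLp_top_mul hGm (ha.memLp_virtualAvg hsel t i j (l + 1))).integrable le_top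
  have ia : Integrable (fun ω => g ω * (a s i l ω : ℝ)) P :=
    (memLp_top_mul hGm (ha.memLp s i l)).integrable le_top
  have hlm : MemLp (fun ω => arrivalAvg (arrivalPath a ω) t i l) ⊤ P :=
    ha.memLp_of_bound (measurable_arrivalAvg t i l) (K := Amax) fun b hb =>
      abs_timeAvg_le (fun τ => by rw [Nat.abs_cast]; exact hb τ i l) t
  have il : Integrable (fun ω => g ω * arrivalAvg (arrivalPath a ω) t i l) P :=
    (memLp_top_mul hGm hlm).integrable le_top
  have isum : ∀ (z : ι → Ω → ℝ), (∀ j, Integrable (fun ω => g ω * z j ω) P) →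
      Integrable (fun ω => ∑ j, g ω * z j ω) P := fun z hz => integrable_finsetSum _ fun j _ => hz j
  have e1 : ∫ ω, g ω * N.matchingQueue V γ sel (arrivalPath a ω) (marksPath r ω) (s + 1) i l ∂P
      = ∫ ω, g ω * Q ω ∂P - ∑ j, ∫ ω, g ω * μ i j ω ∂P + ∑ j, ∫ ω, g ω * μ j i ω ∂P
        + ∫ ω, g ω * (a s i l ω : ℝ) ∂P := by
    rw [← integral_finsetSum _ fun j _ => iμ i j, ← integral_finsetSum _ fun j _ => iμ j i,
      ← integral_sub iQ (isum _ fun j => iμ i j),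
      ← integral_add (by exact iQ.sub (isum _ fun j => iμ i j)) (isum _ fun j => iμ j i),
      ← integral_add (by exact (iQ.sub (isum _ fun j => iμ i j)).add (isum _ fun j => iμ j i)) ia]
    refine integral_congr_ae (Eventually.of_forall fun ω => ?_)
    beta_reduce
    rw [matchingQueue_succ, queueStep, if_neg (by simp only [hi, false_or]; omega),
      ← Finset.mul_sum, ← Finset.mul_sum, ← mul_sub, ← mul_add, ← mul_add]
    rfl
  have e2 : ∫ ω, g ω * N.available (N.virtualAvg V γ sel (arrivalPath a ω) t)
        (arrivalAvg (arrivalPath a ω) t) i l ∂P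
      = ∫ ω, g ω * q ω ∂P - ∑ j, ∫ ω, g ω * x i j ω ∂P + ∑ j, ∫ ω, g ω * x j i ω ∂P
        + ∫ ω, g ω * arrivalAvg (arrivalPath a ω) t i l ∂P := by
    rw [← integral_finsetSum _ fun j _ => ix i j, ← integral_finsetSum _ fun j _ => ix j i,
      ← integral_sub iq (isum _ fun j => ix i j),
      ← integral_add (by exact iq.sub (isum _ fun j => ix i j)) (isum _ fun j => ix j i),
      ← integral_add (by exact (iq.sub (isum _ fun j => ix i j)).add (isum _ fun j => ix j i)) il]
    refine integral_congr_ae (Eventually.of_forall fun ω => ?_)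
    beta_reduce
    rw [available_eq_add hsel t i hlL,
      ← Finset.mul_sum, ← Finset.mul_sum, ← mul_sub, ← mul_add, ← mul_add]
    rfl
  have hsum : ∀ u w : ι → ℝ, (∀ j, |u j - w j| ≤ ε') →
      |∑ j, u j - ∑ j, w j| ≤ Fintype.card ι * ε' := by
    intro u w h
    rw [← Finset.sum_sub_distrib]
    exact abs_sum_le_card_mul _ fun j _ => h j
  have h1 := hsum _ _ fun j => hε' i j
  have h2 := hsum _ _ fun j => hε' j i
  -- The arrivals of slot `s ≥ t` average to `lam i l` against `g`; what remains is the error of the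
  -- empirical rate, which vanishes in `L¹` by the law of large numbers.
  have h3 : |∫ ω, g ω * (a s i l ω : ℝ) ∂P - ∫ ω, g ω * arrivalAvg (arrivalPath a ω) t i l ∂P|
      ≤ ∫ ω, |arrivalAvg (arrivalPath a ω) t i l - lam i l| ∂P := by
    rw [ha.integral_mul hts hG.measurable hG.dependsOn, ← integral_mul_const,
      ← integral_sub ((hGm.integrable le_top).mul_const _) il]
    have hd : Integrable (fun ω => arrivalAvg (arrivalPath a ω) t i l - lam i l) P :=
      (hlm.sub (memLp_const _)).integrable le_top
    refine (abs_integral_le_integral_abs).trans (integral_mono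
      (by exact (((hGm.integrable le_top).mul_const _).sub il).abs) hd.abs fun ω => ?_)
    beta_reduce
    rw [← mul_sub, abs_mul, abs_sub_comm]
    exact mul_le_of_le_one_left (abs_nonneg _) (hG.abs_le_one _)
  rw [e1, e2]
  change |∫ ω, g ω * Q ω ∂P - ∫ ω, g ω * q ω ∂P| ≤ ε at hε
  change |∑ j, ∫ ω, g ω * μ i j ω ∂P - ∑ j, ∫ ω, g ω * x i j ω ∂P| ≤ _ at h1
  change |∑ j, ∫ ω, g ω * μ j i ω ∂P - ∑ j, ∫ ω, g ω * x j i ω ∂P| ≤ _ at h2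
  rw [abs_le] at *
  constructor <;> linarith [hε.1, hε.2, h1.1, h1.2, h2.1, h2.2, h3.1, h3.2]

/-- The weighted mean backlogs and flows of the flow-matching policy match the virtual ones. -/
theorem IsArrival.exists_tendsto_matching {ε₀ : ℕ → ℝ} (hε₀ : Tendsto ε₀ atTop (𝓝 0))
    (hU : ∀ t, ∀ i, i ≠ N.d → ∀ l, 1 ≤ l → l ≤ N.L →
      ∫ ω, (N.virtualQueue V γ sel (arrivalPath a ω) t).2 i l / t ∂P ≤ ε₀ t)
    (k : ℕ) (hk : k ≤ N.L) :
    ∃ ε ε' : ℕ → ℝ, Tendsto ε atTop (𝓝 0) ∧ Tendsto ε' atTop (𝓝 0) ∧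
      ∀ t s, t + k ≤ s → s ≤ t + N.L → ∀ G, IsWeight t G →
        (∀ i, i ≠ N.d → |∫ ω, G (arrivalPath a ω)
          * N.matchingQueue V γ sel (arrivalPath a ω) (marksPath r ω) s i (N.L + 1 - k) ∂P
        - ∫ ω, G (arrivalPath a ω) * N.available (N.virtualAvg V γ sel (arrivalPath a ω) t)
          (arrivalAvg (arrivalPath a ω) t) i (N.L + 1 - k) ∂P| ≤ ε t) ∧
        ∀ i j, |∫ ω, G (arrivalPath a ω)
          * N.matchingFlow V γ sel (arrivalPath a ω) (marksPath r ω) s i j (N.L + 1 - k) ∂P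
        - ∫ ω, G (arrivalPath a ω)
          * N.virtualAvg V γ sel (arrivalPath a ω) t i j (N.L + 1 - k) ∂P| ≤ ε' t := by
  induction k with
  | zero =>
    -- At lifetime `L + 1` backlog, available amount and flows are all zero. Each lower lifetime
    -- costs one slot, hence the condition `t + k ≤ s`.
    refine ⟨fun _ => 0, fun _ => 0, tendsto_const_nhds, tendsto_const_nhds,
      fun t s _ _ G hG => ⟨fun i hi => ?_, fun i j => ?_⟩⟩
    · have h1 : ∀ ω, N.matchingQueue V γ sel (arrivalPath a ω) (marksPath r ω) s i (N.L + 1 - 0)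
          = 0 := fun ω => matchingQueue_of_lt (fun t i l hl => ha.support t i l ω (by omega))
            hsel s i (by omega)
      have h2 : ∀ ω, N.available (N.virtualAvg V γ sel (arrivalPath a ω) t)
          (arrivalAvg (arrivalPath a ω) t) i (N.L + 1 - 0) = 0 := fun ω => by
        rw [available, upFrom_of_lt (by omega), upFrom_of_lt (by omega), upFrom_of_lt (by omega)]
        simp
      simp only [h1, h2, sub_self, abs_zero, le_refl]
    · have h1 : ∀ ω, N.virtualAvg V γ sel (arrivalPath a ω) t i j (N.L + 1 - 0) = 0 := fun ω =>
        hsel.isFlow_virtualAvg t i j _ (by omega)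
      have h2 : ∀ ω, N.matchingFlow V γ sel (arrivalPath a ω) (marksPath r ω) s i j (N.L + 1 - 0)
          = 0 := fun ω => hsel.isFlow_matchingFlow s i j _ (by omega)
      simp only [h1, h2, sub_self, abs_zero, le_refl]
  | succ k ih =>
    obtain ⟨ε, ε', hε, hε', hind⟩ := ih (by omega)
    obtain ⟨l, hl⟩ : ∃ l, l = N.L + 1 - (k + 1) := ⟨_, rfl⟩
    have hl1 : N.L + 1 - k = l + 1 := by omega
    rw [hl1] at hind
    rw [← hl]
    have hl0 : 1 ≤ l := by omega
    have hlL : l ≤ N.L := by omega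
    set η : ℕ → ℝ := fun t => ε t + 2 * (Fintype.card ι * ε' t)
      + ∑ i, ∫ ω, |arrivalAvg (arrivalPath a ω) t i l - lam i l| ∂P
    have hη0 : Tendsto η atTop (𝓝 0) := by
      have h1 := tendsto_finsetSum Finset.univ
        fun i _ => ha.tendsto_integral_abs_arrivalAvg_sub i l
      have h2 := (hε.add ((hε'.const_mul (Fintype.card ι : ℝ)).const_mul 2)).add h1
      simpa using h2
    have hQ : ∀ t s, t + (k + 1) ≤ s → s ≤ t + N.L → ∀ G, IsWeight t G →
        ∀ i, i ≠ N.d → |∫ ω, G (arrivalPath a ω)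
          * N.matchingQueue V γ sel (arrivalPath a ω) (marksPath r ω) s i l ∂P
        - ∫ ω, G (arrivalPath a ω) * N.available (N.virtualAvg V γ sel (arrivalPath a ω) t)
          (arrivalAvg (arrivalPath a ω) t) i l ∂P| ≤ η t := by
      intro t s hs hs' G hG i hi
      obtain ⟨s, rfl⟩ : ∃ s', s = s' + 1 := ⟨s - 1, by omega⟩
      obtain ⟨h1, h2⟩ := hind t s (by omega) (by omega) G hG
      refine (ha.abs_integral_matchingQueue_succ_sub_le hm hsel (by omega) hi hl0 hlL hG
        (h1 i hi) h2).trans ?_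
      refine add_le_add le_rfl ?_
      exact Finset.single_le_sum
        (f := fun i => ∫ ω, |arrivalAvg (arrivalPath a ω) t i l - lam i l| ∂P)
        (fun i _ => integral_nonneg fun ω => abs_nonneg _) (Finset.mem_univ i)
    -- The absolute value keeps the bound non-negative, as needed at the destination, where both
    -- flows vanish.
    refine ⟨η, fun t => |N.driftRate γ Amax t + 2 * η t + ε₀ t|, hη0, ?_,
      fun t s hs hs' G hG => ⟨hQ t s hs hs' G hG, fun i j => ?_⟩⟩
    · have h1 := (((tendsto_driftRate (N := N) (γ := γ) Amax).add (hη0.const_mul 2)).add hε₀).abs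
      simpa using h1
    · by_cases hi : i = N.d
      · subst hi
        simp only [matchingFlow_dest, virtualAvg_dest, mul_zero, sub_self, abs_zero, abs_nonneg]
      · exact (ha.abs_integral_matchingFlow_sub_le hm hsel (by omega) hs' hl0 hlL
          (fun G hG => hQ t s hs hs' G hG i hi) (hU t i hi l hl0 hlL) j hG).trans (le_abs_self _)

/-- The mean flows of the flow-matching policy and the mean empirical averages of the virtual flows
are asymptotically equal. -/
theorem IsArrival.tendsto_integral_matchingFlow_sub {ε₀ : ℕ → ℝ} (hε₀ : Tendsto ε₀ atTop (𝓝 0))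
    (hU : ∀ t, ∀ i, i ≠ N.d → ∀ l, 1 ≤ l → l ≤ N.L →
      ∫ ω, (N.virtualQueue V γ sel (arrivalPath a ω) t).2 i l / t ∂P ≤ ε₀ t)
    (i j : ι) (l : ℕ) :
    Tendsto (fun t =>
      ∫ ω, N.matchingFlow V γ sel (arrivalPath a ω) (marksPath r ω) t i j l ∂P
      - ∫ ω, N.virtualAvg V γ sel (arrivalPath a ω) t i j l ∂P) atTop (𝓝 0) := by
  by_cases hl : 1 ≤ l ∧ l ≤ N.L
  · obtain ⟨_, ε', -, hε', h⟩ := ha.exists_tendsto_matching hm hsel hε₀ hU (N.L + 1 - l) (by omega)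
    rw [← tendsto_add_atTop_iff_nat N.L]
    have e : N.L + 1 - (N.L + 1 - l) = l := by omega
    rw [e] at h
    have h1 : ∀ t, |∫ ω, N.matchingFlow V γ sel (arrivalPath a ω) (marksPath r ω) (t + N.L) i j l ∂P
        - ∫ ω, N.virtualAvg V γ sel (arrivalPath a ω) t i j l ∂P| ≤ ε' t := by
      intro t
      have := (h t (t + N.L) (by omega) le_rfl (fun _ => 1)
        ⟨measurable_const, fun _ _ _ => rfl, fun _ => by simp⟩).2 i j
      simpa only [one_mul] using this
    -- The induction compares slot `t + L` with averages up to `t`; this shift of the averages is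
    -- negligible.
    have h2 : ∀ t : ℕ, |∫ ω, N.virtualAvg V γ sel (arrivalPath a ω) (t + N.L) i j l ∂P
        - ∫ ω, N.virtualAvg V γ sel (arrivalPath a ω) t i j l ∂P|
        ≤ 2 * N.capSum * N.L / (t + 1) := by
      intro t
      have hx : ∀ t, Integrable (fun ω => N.virtualAvg V γ sel (arrivalPath a ω) t i j l) P :=
        fun t => (ha.memLp_virtualAvg hsel t i j l).integrable le_top
      rw [← integral_sub (hx _) (hx _)]
      refine (abs_integral_le_integral_abs).trans ((integral_mono ((hx _).sub (hx _)).abs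
        (integrable_const _) fun ω => abs_timeAvg_add_sub_le
          (fun τ => abs_virtualFlow_le τ i j l) t N.L).trans_eq ?_)
      simp
    refine squeeze_zero_norm (a := fun t : ℕ => ε' t + 2 * N.capSum * N.L / (t + 1)) (fun t => ?_) ?_
    · rw [Real.norm_eq_abs]
      have := abs_sub_le (∫ ω, N.matchingFlow V γ sel (arrivalPath a ω) (marksPath r ω)
        (t + N.L) i j l ∂P) (∫ ω, N.virtualAvg V γ sel (arrivalPath a ω) t i j l ∂P)
        (∫ ω, N.virtualAvg V γ sel (arrivalPath a ω) (t + N.L) i j l ∂P)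
      rw [abs_sub_comm (∫ ω, N.virtualAvg V γ sel (arrivalPath a ω) t i j l ∂P)] at this
      linarith [h1 t, h2 t]
    · have h3 := (tendsto_one_div_add_atTop_nhds_zero_nat (𝕜 := ℝ)).const_mul
        (2 * N.capSum * N.L)
      have h4 := hε'.add h3
      simpa [div_eq_mul_inv] using h4
  · have h1 : ∀ ω t, N.virtualAvg V γ sel (arrivalPath a ω) t i j l = 0 := fun ω t =>
      hsel.isFlow_virtualAvg t i j _ (fun h => hl h.2)
    have h2 : ∀ ω t, N.matchingFlow V γ sel (arrivalPath a ω) (marksPath r ω) t i j l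
        = 0 := fun ω t => hsel.isFlow_matchingFlow t i j _ (fun h => hl h.2)
    simp [h1, h2]

end Random

end Network

namespace Network

variable {N : Network ι} {V γ : ℝ} {sel : ℕ → ι → ι → (ℕ → ℝ) → ℕ}

/-! ### Admissibility, cost and limits of the flow-matching policy -/

theorem linkFlow_sub (x y : Flow ι) (i j : ι) :
    N.linkFlow (x - y) i j = N.linkFlow x i j - N.linkFlow y i j := by
  simp only [linkFlow, Pi.sub_apply, Finset.sum_sub_distrib]

theorem delivered_sub (x y : Flow ι) :
    N.delivered (x - y) = N.delivered x - N.delivered y := by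
  simp only [delivered, inFlow, Pi.sub_apply, Finset.sum_sub_distrib]

theorem cost_sub (x y : Flow ι) : N.cost (x - y) = N.cost x - N.cost y := by
  simp only [cost, linkFlow_sub, mul_sub, Finset.sum_sub_distrib]

theorem tendsto_sub_of_continuous {F : Flow ι → ℝ} (hF : Continuous F)
    (hsub : ∀ x y, F (x - y) = F x - F y) {x y : ℕ → Flow ι}
    (h : Tendsto (fun t => x t - y t) atTop (𝓝 0)) :
    Tendsto (fun t => F (x t) - F (y t)) atTop (𝓝 0) := by
  have h0 : F 0 = 0 := by simpa using hsub 0 0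
  have h1 := (hF.tendsto 0).comp h
  rw [h0] at h1
  exact h1.congr fun t => hsub _ _

section Random

variable {Ω : Type*} [MeasurableSpace Ω] {P : Measure Ω} [IsProbabilityMeasure P] {Amax : ℝ}
  {lam : ι → ℕ → ℝ} {a : ℕ → ι → ℕ → Ω → ℕ} {r : ℕ → ι → ℕ → ℕ → Ω → ℝ}

/-- The mean of the empirical averages of the virtual flows. -/
noncomputable def meanAvg (N : Network ι) (V γ : ℝ) (sel : ℕ → ι → ι → (ℕ → ℝ) → ℕ)
    (P : Measure Ω) (a : ℕ → ι → ℕ → Ω → ℕ) (t : ℕ) : Flow ι :=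
  meanFlow P fun ω => N.virtualAvg V γ sel (arrivalPath a ω) t

variable (ha : N.IsArrival P Amax lam a) (hsel : N.IsArgmaxRule sel)
include ha hsel

theorem IsArrival.meanAvg_eq (t : ℕ) : N.meanAvg V γ sel P a t
    = flowAvg (fun t => meanFlow P fun ω => N.virtualFlow V γ sel (arrivalPath a ω) t) t := by
  funext i j l
  simp only [meanAvg, meanFlow, virtualAvg, flowAvg, timeAvg]
  rw [integral_div, integral_finsetSum _ fun τ _ => ha.integrable_virtualFlow hsel τ i j l]

theorem IsArrival.integrable_virtualAvg (t : ℕ) (i j : ι) (l : ℕ) :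
    Integrable (fun ω => N.virtualAvg V γ sel (arrivalPath a ω) t i j l) P :=
  (ha.memLp_virtualAvg hsel t i j l).integrable le_top

theorem IsArrival.linkFlow_meanAvg_le (t : ℕ) (i j : ι) :
    N.linkFlow (N.meanAvg V γ sel P a t) i j ≤ N.C i j := by
  rw [meanAvg, linkFlow_meanFlow (ha.integrable_virtualAvg hsel t)]
  refine (integral_mono (integrable_linkFlow (ha.integrable_virtualAvg hsel t) N i j)
    (integrable_const _) fun ω => hsel.linkFlow_virtualAvg_le t i j).trans_eq ?_
  simp

omit hsel in
theorem IsArrival.integral_totalRate_arrivalAvg {t : ℕ} (ht : 0 < t) :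
    Integrable (fun ω => N.totalRate (arrivalAvg (arrivalPath a ω) t)) P ∧
      ∫ ω, N.totalRate (arrivalAvg (arrivalPath a ω) t) ∂P = N.totalRate lam := by
  have hi : ∀ i l, Integrable (fun ω => arrivalAvg (arrivalPath a ω) t i l) P := fun i l =>
    (integrable_finsetSum _ fun τ _ => ha.integrable τ i l).div_const _
  refine ⟨integrable_finsetSum _ fun i _ => integrable_finsetSum _ fun l _ => hi i l, ?_⟩
  simp only [totalRate]
  rw [integral_finsetSum _ fun i _ => integrable_finsetSum _ fun l _ => hi i l]
  refine Finset.sum_congr rfl fun i _ => ?_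
  rw [integral_finsetSum _ fun l _ => hi i l]
  refine Finset.sum_congr rfl fun l _ => ?_
  simp only [arrivalAvg, timeAvg, arrivalPath]
  rw [integral_div, integral_finsetSum _ fun τ _ => ha.integrable τ i l]
  simp only [ha.mean, Finset.sum_const, Finset.card_range, nsmul_eq_mul]
  rw [mul_div_cancel_left₀]
  positivity

theorem IsArrival.delivered_meanAvg_ge {t : ℕ} (ht : 0 < t) :
    γ * N.totalRate lam - ∫ ω, (N.virtualQueue V γ sel (arrivalPath a ω) t).1 / t ∂P
      ≤ N.delivered (N.meanAvg V γ sel P a t) := by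
  obtain ⟨h1, h2⟩ := ha.integral_totalRate_arrivalAvg ht
  have hU := ((ha.memLp_virtualQueue_fst (V := V) (γ := γ) hsel t).integrable le_top).div_const
    (t : ℝ)
  rw [meanAvg, delivered_meanFlow (ha.integrable_virtualAvg hsel t), ← h2, ← integral_const_mul,
    ← integral_sub (h1.const_mul γ) hU]
  refine integral_mono ((h1.const_mul γ).sub hU)
    (integrable_delivered (ha.integrable_virtualAvg hsel t) N) fun ω => ?_
  have := sub_delivered_virtualAvg_le (N := N) (V := V) (γ := γ) (sel := sel)
    (b := arrivalPath a ω) t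
  beta_reduce
  linarith

theorem IsArrival.eventually_delivered_meanAvg_ge (hV : 0 ≤ V) {y : Flow ι}
    (hy : N.Feasible lam γ y) {ε : ℝ} (hε : 0 < ε) :
    ∀ᶠ t in atTop, γ * N.totalRate lam - ε ≤ N.delivered (N.meanAvg V γ sel P a t) := by
  obtain ⟨η, hη, hU⟩ := ha.exists_tendsto_virtualQueue hsel hV hy
  filter_upwards [hη.eventually (gt_mem_nhds hε), eventually_gt_atTop 0] with t h1 h2
  linarith [ha.delivered_meanAvg_ge (V := V) (γ := γ) hsel h2, (hU t).1]

variable (hm : IsMarks P a r)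
include hm

theorem IsArrival.integrable_matchingProcess (t : ℕ) (i j : ι) (l : ℕ) :
    Integrable (fun ω => matchingProcess N V γ sel a r t ω i j l) P :=
  (ha.memLp_matchingFlow hm hsel t i j l).integrable le_top

theorem IsArrival.tendsto_meanFlow_matchingProcess_sub (hV : 0 ≤ V) {y : Flow ι}
    (hy : N.Feasible lam γ y) :
    Tendsto (fun t => meanFlow P (matchingProcess N V γ sel a r t) - N.meanAvg V γ sel P a t)
      atTop (𝓝 0) := by
  obtain ⟨η, hη, hU⟩ := ha.exists_tendsto_virtualQueue hsel hV hy
  simp only [tendsto_pi_nhds]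
  exact fun i j l => ha.tendsto_integral_matchingFlow_sub hm hsel hη (fun t => (hU t).2) i j l

/-- The mean empirical average respects the capacities in every slot and reliability asymptotically;
the mean flow inherits both in the limit before any averaging. Availability holds on every path,
since at most the packets present are sent. -/
theorem IsArrival.admissible_matchingProcess (hV : 0 ≤ V) {y : Flow ι}
    (hy : N.Feasible lam γ y) : N.Admissible P a lam γ (matchingProcess N V γ sel a r) where
  integrable := ha.integrable_matchingProcess hsel hm
  isFlow := fun t ω => hsel.isFlow_matchingFlow t
  nonneg := Eventually.of_forall fun ω t i j l => matchingFlow_nonneg t i j l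
  capacity := fun i j _ => by
    refine avgLE_of_eventually_le fun ε hε => ?_
    have h := tendsto_sub_of_continuous (continuous_linkFlow (N := N) i j)
      (fun x y => linkFlow_sub x y i j)
      (ha.tendsto_meanFlow_matchingProcess_sub hsel hm hV hy)
    filter_upwards [h.eventually (gt_mem_nhds hε)] with t ht
    rw [← linkFlow_meanFlow (ha.integrable_matchingProcess hsel hm t)]
    linarith [ha.linkFlow_meanAvg_le (V := V) (γ := γ) hsel t i j]
  availability := Eventually.of_forall fun ω t i l _ _ => by
    refine (outFlow_matchingFlow_le t i l).trans_eq ?_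
    rw [matchingQueue_eq_queue]
    rfl
  reliability := by
    refine avgGE_of_eventually_ge fun ε hε => ?_
    have h := tendsto_sub_of_continuous (continuous_delivered (N := N)) delivered_sub
      (ha.tendsto_meanFlow_matchingProcess_sub hsel hm hV hy)
    filter_upwards [h.eventually (lt_mem_nhds (neg_lt_zero.2 (half_pos hε))),
      ha.eventually_delivered_meanAvg_ge hsel hV hy (half_pos hε)] with t h1 h2
    rw [← delivered_meanFlow (ha.integrable_matchingProcess hsel hm t)]
    linarith

theorem IsArrival.avgLE_cost_matchingProcess (hV : 0 < V) {y : Flow ι}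
    (hy : N.Feasible lam γ y) :
    AvgLE (fun t => ∫ ω, N.cost (matchingProcess N V γ sel a r t ω) ∂P)
      (N.cost y + (1 + Fintype.card ι * N.L) * N.stepBound γ Amax ^ 2 / 2 / V) := by
  refine avgLE_of_eventually_le fun ε hε => ?_
  have h := tendsto_sub_of_continuous (continuous_cost (N := N)) cost_sub
    (ha.tendsto_meanFlow_matchingProcess_sub hsel hm hV.le hy)
  filter_upwards [h.eventually (gt_mem_nhds hε), eventually_gt_atTop 0] with t h1 h2
  rw [← cost_meanFlow (ha.integrable_matchingProcess hsel hm t)]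
  -- The cost of the mean empirical average at the single slot `t` is the time average of the mean
  -- virtual costs up to `t`, so the virtual cost bound applies to it.
  have h3 := ha.timeAvg_cost_virtualFlow_le hsel hy hV h2
  simp only [← cost_meanFlow (ha.integrable_virtualFlow hsel _), ← cost_flowAvg] at h3
  rw [← ha.meanAvg_eq hsel] at h3
  linarith

/-- If the long-term average of the virtual flow exists, the flow-matching policy attains it. -/
theorem IsArrival.matching_of_hasAvg (hV : 0 ≤ V) {y : Flow ι} (hy : N.Feasible lam γ y)
    {x : Flow ι}
    (hx : ∀ i j l, HasAvg (fun t => ∫ ω, virtualProcess N V γ sel a t ω i j l ∂P) (x i j l)) :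
    (∀ i j l, HasAvg (fun t => ∫ ω, matchingProcess N V γ sel a r t ω i j l ∂P) (x i j l)) ∧
      (∀ i j, (i, j) ∈ N.E → N.linkFlow x i j ≤ N.C i j) ∧
      γ * N.totalRate lam ≤ N.delivered x ∧
      HasAvg (fun t => ∫ ω, N.cost (matchingProcess N V γ sel a r t ω) ∂P) (N.cost x) := by
  have hX : Tendsto (N.meanAvg V γ sel P a) atTop (𝓝 x) := by
    simp only [tendsto_pi_nhds]
    intro i j l
    refine (hx i j l).congr fun t => ?_
    rw [ha.meanAvg_eq hsel]
    rfl
  have hM : Tendsto (fun t => meanFlow P (matchingProcess N V γ sel a r t)) atTop (𝓝 x) := by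
    have h := (ha.tendsto_meanFlow_matchingProcess_sub (V := V) hsel hm hV hy).add hX
    simpa using h
  refine ⟨fun i j l => hasAvg_of_tendsto ?_, fun i j _ => ?_, ?_, hasAvg_of_tendsto ?_⟩
  · exact ((show Continuous fun y : Flow ι => y i j l by fun_prop).tendsto x).comp hM
  · exact le_of_tendsto' (((continuous_linkFlow i j).tendsto x).comp hX)
      fun t => ha.linkFlow_meanAvg_le hsel t i j
  · refine le_of_forall_pos_sub_le fun ε hε => ?_
    exact ge_of_tendsto ((continuous_delivered.tendsto x).comp hX)
      (ha.eventually_delivered_meanAvg_ge hsel hV hy hε)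
  · refine ((continuous_cost.tendsto x).comp hM).congr fun t => ?_
    exact cost_meanFlow (ha.integrable_matchingProcess hsel hm t) N

end Random

end Network

end CloudNet

/-! ### Assembly of the proposition -/

theorem proposition5 {ι : Type*} [Fintype ι] [LinearOrder ι] (N : CloudNet.Network ι)
    (Amax γ : ℝ) :
    ∃ B : ℝ, ∀ (V : ℝ), 0 ≤ V →
      ∀ (sel : ℕ → ι → ι → (ℕ → ℝ) → ℕ), N.IsArgmaxRule sel →
      ∀ {Ω : Type*} [MeasurableSpace Ω] (P : Measure Ω) [IsProbabilityMeasure P]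
        (lam : ι → ℕ → ℝ) (a : ℕ → ι → ℕ → Ω → ℕ) (r : ℕ → ι → ℕ → ℕ → Ω → ℝ),
      N.IsArrival P Amax lam a → CloudNet.IsMarks P a r →
      (lam, γ) ∈ N.capacityRegion →
      -- the flow-matching policy is admissible
      N.Admissible P a lam γ (CloudNet.matchingProcess N V γ sel a r) ∧
      -- its cost is within `B / V` of the optimal cost
      (0 < V → ∀ c ∈ N.achievableCosts lam γ,
        CloudNet.AvgLE (fun t => ∫ ω, N.cost (CloudNet.matchingProcess N V γ sel a r t ω) ∂P)
          (c + B / V)) ∧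
      -- if the long-term average `x` of the virtual flow exists, then all averages
      -- exist, the flows match, the constraints hold for the limits, and the cost is `h(x)`
      (∀ x : CloudNet.Flow ι,
        (∀ i j l, CloudNet.HasAvg
          (fun t => ∫ ω, CloudNet.virtualProcess N V γ sel a t ω i j l ∂P) (x i j l)) →
        (∀ i j l, CloudNet.HasAvg
          (fun t => ∫ ω, CloudNet.matchingProcess N V γ sel a r t ω i j l ∂P) (x i j l)) ∧
        (∀ i j, (i, j) ∈ N.E → N.linkFlow x i j ≤ N.C i j) ∧
        γ * N.totalRate lam ≤ N.delivered x ∧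
        CloudNet.HasAvg
          (fun t => ∫ ω, N.cost (CloudNet.matchingProcess N V γ sel a r t ω) ∂P)
          (N.cost x)) := by
  refine ⟨(1 + Fintype.card ι * N.L) * N.stepBound γ Amax ^ 2 / 2,
    fun V hV sel hsel Ω _ P _ lam a r ha hm hcap => ?_⟩
  obtain ⟨Ω', _, P', _, Amax', a', x', ha', hx'⟩ := hcap
  -- The witness of the capacity region may live on another probability space with another arrival
  -- bound; only a feasible flow for the same rates is kept.
  obtain ⟨y, -, -, hy, -⟩ := hx'.exists_feasible ha'
  refine ⟨ha.admissible_matchingProcess hsel hm hV hy, fun hV' c hc => ?_,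
    fun x hx => ha.matching_of_hasAvg hsel hm hV hy hx⟩
  obtain ⟨Ω'', _, P'', _, Amax'', a'', x'', ha'', hx'', hc''⟩ := hc
  -- Likewise a competitor is replaced by a feasible flow of no larger cost, so the constant depends
  -- on `Amax` of the given arrivals and not on the competitor.
  obtain ⟨z, hz, hzc⟩ := hx''.exists_feasible_cost_le ha'' hc''
  intro ε hε
  filter_upwards [ha.avgLE_cost_matchingProcess hsel hm hV' hz ε hε] with T hT
  linarith
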